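/- **Setting.** Let $\Lambda\in\mathbb R$ and let $H=H(X,Y)$ be a real function that is smooth on $R_\Lambda=\{(X,Y)\neq(0,0),\ 1+\frac{\Lambda}{12}(X^2+Y^2)\neq0\}$. In coordinates $(U,V,X^2,X^3)=(U,V,X,Y)$ consider the continuous metric $$ds^2=\omega^{-2}\big(g_{ij}\,dX^i\,dX^j-2\,dU\,dV\big),\qquad g_{ij}=\delta_{ij}+2U_+H_{,ij}+U_+^2\,\delta^{kl}H_{,ik}H_{,jl},$$ $$\omega=1+\tfrac{\Lambda}{12}\big(X^2+Y^2-2UV-2U_+G\big),\qquad G=H-X^iH_{,i},\qquad U_+=\max(U,0),$$ on the domain $W$ where $\omega\ne0$, $\det g_{ij}\neq0$, and $U<0$ or $(X,Y)\in R_\Lambda$. A solution of the geodesic equation is a Filippov solution of the corresponding first-order system $w'=f(w)$ for $w=(\text{position},\text{velocity})$: $w$ is absolutely continuous on compact subintervals and $w'(t)\in\bigcap_{\delta>0}\bigcap_{|S|=0}\overline{\mathrm{co}}\,f(B_\delta(w(t))\setminus S)$ for almost every $t$. Let $B$ be the background: Minkowski space if $\Lambda=0$, and the (anti-)de Sitter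 hyperboloid $Z_2^2+Z_3^2+\epsilon Z_4^2-2\tilde U\tilde V=\epsilon a^2$ with $a=\sqrt{3/|\Lambda|}$, $\epsilon=\mathrm{sign}\,\Lambda$ if $\Lambda\ne0$. It carries the conformally flat coordinates $(\mathcal U,\mathcal V,x,y)$ with $$(\tilde U,\tilde V,Z_2,Z_3)=\Omega^{-1}(\mathcal U,\mathcal V,x,y),\quad Z_4=a\big(\tfrac2\Omega-1\big),\quad \Omega=1+\tfrac{\Lambda}{12}(x^2+y^2-2\,\mathcal U\mathcal V),\quad ds^2=\Omega^{-2}(dx^2+dy^2-2\,d\mathcal U\,d\mathcal V)$$ (for $\Lambda=0$ these are global coordinates, $\Omega=1$, and there is no $Z_4$), and, if $\Lambda\neq0$, also their reflection under $Z_4\mapsto-Z_4$. The impulsive wave spacetime $M$ consists of the two halves $\tilde U<0$ and $\tilde U>0$ of $B$, joined along the wave surface $\{U=0\}$ by the coordinates $(U,V,X,Y)\in W$ through $$\mathcal U=U,\quad \mathcal V=V+\Theta(U)H+\tfrac12U_+(H_{,X}^2+H_{,Y}^2),\quad x=X+U_+H_{,X},\quad y=Y+U_+H_{,Y},$$ where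 $\Theta$ is the Heaviside function with $\Theta(0)=0$. The singular generators $U=0$, $z=\pm1$ do not belong to $M$; these are $\tilde U=Z_2=Z_3=0$, $z=Z_4/a=\pm1$ for $\Lambda\neq0$, and the axis $\mathcal U=0$, $x=y=0$ for $\Lambda=0$. A geodesic of $M$ is a curve on an open interval which near each time is, in $(U,V,X,Y)\in W$ or in one of the conformally flat coordinate systems of a half, a Filippov solution of the geodesic equation. It runs into a singular point at a finite end of its interval if its position in $B$ converges there to a point of a singular generator. **Theorem 3.6.** 1. (Local existence and uniqueness.) For every initial position in $W$ with $U\neq0$, every initial velocity and every initial time, the geodesic equation of the continuous metric has a Filippov solution on some interval around the initial time, whose position is a $C^1$ curve whose derivative is the velocity component. Any two Filippov solutions in $W$ with these initial data, on intervals containing the initial time, agree on the intersection of their intervals. 2. For every initial position in $M$ with $U\ne0$ and every initial velocity there is a geodesic of $M$ with these initial data on an open interval that is maximal, i.e. such that the geodesic does not extend to a geodesic on a larger open interval. Every geodesic of $M$ with a point off $\{U=0\}$ is $C^1$, and two geodesics with the same position (off $\{U=0\}$) and velocity at some time agree on the intersection of their intervals. 3. (Completeness.) Let $\gamma$ be a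 maximal geodesic of $M$ on the interval $I$ with a point off $\{U=0\}$. If $\gamma$ does not run into a singular point $U=0$, $z=\pm1$ in the future, then $I$ is unbounded above; if it does not in the past, then $I$ is unbounded below. In particular, every maximal geodesic starting at $U\neq0$ that runs into a singular point $U=0$, $z=\pm1$ neither in the future nor in the past is defined on all of $\mathbb R$. -/

import Mathlib

open scoped ContDiff

noncomputable section

namespace ImpulsiveWave

/-! ### Differential equations with discontinuous right-hand side -/

section Filippov

variable {E : Type*} [NormedAddCommGroup E] [NormedSpace ℝ E] [MeasureTheory.MeasureSpace E]

/-- The Filippov set-valued map of `f`: the intersection over all `δ > 0` and all Lebesgue null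
sets `S` of the closed convex hulls of `f (B_δ(x) \ S)`. As all `δ > 0` are intersected, equivalent
norms on `E` give the same set. -/
def filippovMap (f : E → E) (x : E) : Set E :=
  ⋂ (δ : ℝ) (_ : 0 < δ), ⋂ (S : Set E) (_ : MeasureTheory.volume S = 0),
    closedConvexHull ℝ (f '' (Metric.closedBall x δ \ S))

/-- `w` is a Filippov solution of `w' = f w` on the interval `I`, with values in `D`: it is
absolutely continuous on every compact subinterval of `I`, and `w'(t)` exists and belongs to
`filippovMap f (w t)` for almost every `t ∈ I`. -/
structure IsFilippovSolution (f : E → E) (D : Set E) (I : Set ℝ) (w : ℝ → E) : Prop where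
  mem : ∀ t ∈ I, w t ∈ D
  absCont : ∀ a ∈ I, ∀ b ∈ I, AbsolutelyContinuousOnInterval w a b
  inclusion : ∀ᵐ t : ℝ, t ∈ I → ∃ d ∈ filippovMap f (w t), HasDerivAt w d t

end Filippov

/-! ### The geodesic equation of a metric given in coordinates -/

/-- Coordinate space, with the coordinates `0 = U`, `1 = V`, `2 = X`, `3 = Y`. -/
abbrev Coord : Type := Fin 4 → ℝ

/-- Positions and velocities. -/
abbrev Phase : Type := Coord × Coord

/-- The `i`-th partial derivative. -/
def pd {n : ℕ} (i : Fin n) (f : (Fin n → ℝ) → ℝ) (x : Fin n → ℝ) : ℝ :=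
  fderiv ℝ f x (Pi.single i 1)

/-- Christoffel symbols `Γ^k_{ij}` of the metric with coefficient matrix `g`. -/
def christoffel (g : Coord → Matrix (Fin 4) (Fin 4) ℝ) (x : Coord) (k i j : Fin 4) : ℝ :=
  1 / 2 * ∑ l, (g x)⁻¹ k l *
    (pd i (fun y => g y j l) x + pd j (fun y => g y i l) x - pd l (fun y => g y i j) x)

/-- The right-hand side of the geodesic equation, written as a first-order system. -/
def geodesicField (g : Coord → Matrix (Fin 4) (Fin 4) ℝ) (w : Phase) : Phase :=
  (w.2, fun k => -∑ i, ∑ j, christoffel g w.1 k i j * w.2 i * w.2 j)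

/-! ### The continuous form of the metric -/

/-- The kink function `U₊`. -/
def kink (u : ℝ) : ℝ := max u 0

/-- The Heaviside function. -/
def heaviside (u : ℝ) : ℝ := if 0 < u then 1 else 0

/-- The pair `(X, Y)` of spatial coordinates. -/
def spatial (x : Coord) : Fin 2 → ℝ := ![x 2, x 3]

/-- `G = H - X^i H_{,i}`. -/
def funG (H : (Fin 2 → ℝ) → ℝ) (X : Fin 2 → ℝ) : ℝ := H X - ∑ i, X i * pd i H X

/-- `g_{ij} = δ_{ij} + 2 U₊ H_{,ij} + U₊² δ^{kl} H_{,ik} H_{,jl}`. -/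
def spatialMetric (H : (Fin 2 → ℝ) → ℝ) (x : Coord) : Matrix (Fin 2) (Fin 2) ℝ :=
  Matrix.of fun i j => (if i = j then 1 else 0)
    + 2 * kink (x 0) * pd i (pd j H) (spatial x)
    + kink (x 0) ^ 2 * ∑ k, pd i (pd k H) (spatial x) * pd j (pd k H) (spatial x)

/-- `ω = 1 + Λ/12 (X² + Y² - 2UV - 2 U₊ G)`. -/
def omega (Λ : ℝ) (H : (Fin 2 → ℝ) → ℝ) (x : Coord) : ℝ :=
  1 + Λ / 12 * (x 2 ^ 2 + x 3 ^ 2 - 2 * x 0 * x 1 - 2 * kink (x 0) * funG H (spatial x))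

/-- The continuous metric `ω⁻² (g_{ij} dX^i dX^j - 2 dU dV)` of the impulsive wave. -/
def waveMetric (Λ : ℝ) (H : (Fin 2 → ℝ) → ℝ) (x : Coord) : Matrix (Fin 4) (Fin 4) ℝ :=
  (omega Λ H x ^ 2)⁻¹ •
    !![0, -1, 0, 0;
       -1, 0, 0, 0;
       0, 0, spatialMetric H x 0 0, spatialMetric H x 0 1;
       0, 0, spatialMetric H x 1 0, spatialMetric H x 1 1]

/-- The points `(X, Y)` of the wave surface off the singularities: `z = 1` is the origin, `z = -1` is
the point at infinity of the `(X, Y)`-plane, and for `Λ < 0` the circle `1 + Λ/12 (X² + Y²) = 0`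
is the infinity `z = ±∞` of the wave surface and not a part of it. -/
def regularSet (Λ : ℝ) : Set (Fin 2 → ℝ) :=
  {X | X ≠ 0 ∧ 1 + Λ / 12 * (X 0 ^ 2 + X 1 ^ 2) ≠ 0}

/-- The coordinate domain on which `waveMetric` is a nondegenerate, locally Lipschitz metric. In
front of the impulse, where `U < 0`, the function `H` does not enter. -/
def waveDomain (Λ : ℝ) (H : (Fin 2 → ℝ) → ℝ) : Set Coord :=
  {x | omega Λ H x ≠ 0 ∧ (spatialMetric H x).det ≠ 0 ∧ (x 0 < 0 ∨ spatial x ∈ regularSet Λ)}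

/-- `w = (position, velocity)` is, on the interval `I`, a solution in the sense of Filippov of the
geodesic equation of the metric `waveMetric Λ H`, as a first-order system. -/
def IsWaveSolution (Λ : ℝ) (H : (Fin 2 → ℝ) → ℝ) (I : Set ℝ) (w : ℝ → Phase) : Prop :=
  IsFilippovSolution (geodesicField (waveMetric Λ H)) (waveDomain Λ H ×ˢ Set.univ) I w

/-! ### The constant curvature background -/

/-- `Ω = 1 + Λ/12 (x² + y² - 2 𝒰 𝒱)`. -/
def bigOmega (Λ : ℝ) (x : Coord) : ℝ :=
  1 + Λ / 12 * (x 2 ^ 2 + x 3 ^ 2 - 2 * x 0 * x 1)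

/-- The conformally flat background metric `Ω⁻² (dx² + dy² - 2 d𝒰 d𝒱)`. -/
def backgroundMetric (Λ : ℝ) (x : Coord) : Matrix (Fin 4) (Fin 4) ℝ :=
  (bigOmega Λ x ^ 2)⁻¹ • !![0, -1, 0, 0; -1, 0, 0, 0; 0, 0, 1, 0; 0, 0, 0, 1]

/-- Five dimensional space, with the coordinates `0 = Ũ`, `1 = Ṽ`, `2 = Z₂`, `3 = Z₃` and
`4 = s`, where `s` is the rescaled coordinate with `Z₄ = a (2 s - 1)`, `a = √(3/|Λ|)`; so the
coordinate `z = Z₄/a` is `2 s - 1`. -/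
abbrev Ambient : Type := Fin 5 → ℝ

/-- The background spacetime: for `Λ ≠ 0` the (anti-)de Sitter hyperboloid
`Z₂² + Z₃² + ε Z₄² - 2 Ũ Ṽ = ε a²`, `ε = sign Λ`, which in terms of `s` is
`s² - s + Λ/12 (Z₂² + Z₃² - 2 Ũ Ṽ) = 0`; for `Λ = 0` Minkowski space, as the hyperplane `s = 1`. -/
def background (Λ : ℝ) : Set Ambient :=
  {Z | Z 4 ^ 2 - Z 4 + Λ / 12 * (Z 2 ^ 2 + Z 3 ^ 2 - 2 * Z 0 * Z 1) = 0 ∧ (Λ = 0 → Z 4 = 1)}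

/-- The conformally flat coordinates of the background,
`(Ũ, Ṽ, Z₂, Z₃) = (𝒰, 𝒱, x, y)/Ω`, `Z₄ = a (2/Ω - 1)`. -/
def stereo (Λ : ℝ) (x : Coord) : Ambient :=
  (bigOmega Λ x)⁻¹ • ![x 0, x 1, x 2, x 3, 1]

/-- The same coordinates composed with the reflection `Z₄ ↦ -Z₄` (for `Λ ≠ 0`), which cover the
points `Z₄ = -a`. -/
def stereoReflected (Λ : ℝ) (x : Coord) : Ambient :=
  (bigOmega Λ x)⁻¹ • ![x 0, x 1, x 2, x 3, bigOmega Λ x - 1]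

/-- The coordinate transformation from the continuous to the conformally flat coordinates:
`𝒰 = U`, `𝒱 = V + Θ H + ½ U₊ (H_{,X}² + H_{,Y}²)`, `x = X + U₊ H_{,X}`, `y = Y + U₊ H_{,Y}`. -/
def toConformal (H : (Fin 2 → ℝ) → ℝ) (x : Coord) : Coord :=
  ![x 0,
    x 1 + heaviside (x 0) * H (spatial x)
      + 1 / 2 * kink (x 0) * (pd 0 H (spatial x) ^ 2 + pd 1 H (spatial x) ^ 2),
    x 2 + kink (x 0) * pd 0 H (spatial x),
    x 3 + kink (x 0) * pd 1 H (spatial x)]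

/-! ### The impulsive wave spacetime

The spacetime consists of the two halves `Ũ < 0` and `Ũ > 0` of the background, joined along the
wave surface `U = 0`, without its singular generators, by the continuous coordinates. A point of
the halves is given by its place in `background Λ`; a point of the wave surface is given by its
place in the boundary of the half `Ũ < 0` (from the half `Ũ > 0`, it is approached with `𝒱` shifted
by `H`). The spacetime is presented by three families of coordinates, the transitions between which
are smooth isometries. -/

/-- The coordinate systems of the spacetime. -/
inductive Chart
  | conformal
  | reflected
  | wave

/-- The coordinate domains. -/
def Chart.dom (Λ : ℝ) (H : (Fin 2 → ℝ) → ℝ) : Chart → Set Coord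
  | .conformal => {x | bigOmega Λ x ≠ 0 ∧ x 0 ≠ 0}
  | .reflected => {x | bigOmega Λ x ≠ 0 ∧ x 0 ≠ 0 ∧ Λ ≠ 0}
  | .wave => waveDomain Λ H

/-- The metric in each of the coordinate systems. -/
def Chart.metric (Λ : ℝ) (H : (Fin 2 → ℝ) → ℝ) : Chart → Coord → Matrix (Fin 4) (Fin 4) ℝ
  | .conformal => backgroundMetric Λ
  | .reflected => backgroundMetric Λ
  | .wave => waveMetric Λ H

/-- The point of the spacetime with given coordinates. -/
def Chart.point (Λ : ℝ) (H : (Fin 2 → ℝ) → ℝ) : Chart → Coord → Ambient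
  | .conformal => stereo Λ
  | .reflected => stereoReflected Λ
  | .wave => fun x => stereo Λ (toConformal H x)

/-- `γ` is a geodesic, in the sense of Filippov, of the impulsive wave spacetime on the open
interval `I`: around each time it is, in one of the coordinate systems, a Filippov solution of the
geodesic equation. -/
structure IsGeodesic (Λ : ℝ) (H : (Fin 2 → ℝ) → ℝ) (I : Set ℝ) (γ : ℝ → Ambient) : Prop where
  isOpen : IsOpen I
  ordConnected : I.OrdConnected
  locally_solution : ∀ t₀ ∈ I, ∃ (k : Chart) (ε : ℝ) (w : ℝ → Phase),
    0 < ε ∧ Set.Ioo (t₀ - ε) (t₀ + ε) ⊆ I ∧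
    IsFilippovSolution (geodesicField (k.metric Λ H)) (k.dom Λ H ×ˢ Set.univ)
      (Set.Ioo (t₀ - ε) (t₀ + ε)) w ∧
    ∀ t ∈ Set.Ioo (t₀ - ε) (t₀ + ε), γ t = k.point Λ H (w t).1

/-- `γ` is a continuously differentiable curve of the impulsive wave spacetime on the open
set `I`. -/
def IsC1Curve (Λ : ℝ) (H : (Fin 2 → ℝ) → ℝ) (I : Set ℝ) (γ : ℝ → Ambient) : Prop :=
  ∀ t₀ ∈ I, ∃ (k : Chart) (ε : ℝ) (c : ℝ → Coord),
    0 < ε ∧ Set.Ioo (t₀ - ε) (t₀ + ε) ⊆ I ∧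
    ContDiffOn ℝ 1 c (Set.Ioo (t₀ - ε) (t₀ + ε)) ∧
    ∀ t ∈ Set.Ioo (t₀ - ε) (t₀ + ε), c t ∈ k.dom Λ H ∧ γ t = k.point Λ H (c t)

/-- `γ` is a geodesic on `I` that extends to no larger open interval. -/
def IsMaximalGeodesic (Λ : ℝ) (H : (Fin 2 → ℝ) → ℝ) (I : Set ℝ) (γ : ℝ → Ambient) : Prop :=
  IsGeodesic Λ H I γ ∧
    ∀ (J : Set ℝ) (γ' : ℝ → Ambient), IsGeodesic Λ H J γ' → I ⊆ J → Set.EqOn γ γ' I → J = I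

/-- The singular generators of the wave surface: the points of the background with `Ũ = 0` and
`Z₂ = Z₃ = 0`. For `Λ ≠ 0` the latter means `z = ±1`, and for `Λ = 0` it is the axis `ρ = 0`. -/
def singularSet (Λ : ℝ) : Set Ambient :=
  {Z | Z ∈ background Λ ∧ Z 0 = 0 ∧ Z 2 = 0 ∧ Z 3 = 0}

/-- The curve `γ` on the interval `I` runs into a singular point `U = 0`, `z = ±1` as the parameter
increases to the finite upper end of `I`. -/
def RunsIntoSingularityInFuture (Λ : ℝ) (I : Set ℝ) (γ : ℝ → Ambient) : Prop :=
  ∃ b : ℝ, IsLUB I b ∧ ∃ p ∈ singularSet Λ, Filter.Tendsto γ (nhdsWithin b (Set.Iio b)) (nhds p)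

/-- The curve `γ` on the interval `I` runs into a singular point `U = 0`, `z = ±1` as the parameter
decreases to the finite lower end of `I`. -/
def RunsIntoSingularityInPast (Λ : ℝ) (I : Set ℝ) (γ : ℝ → Ambient) : Prop :=
  ∃ a : ℝ, IsGLB I a ∧ ∃ p ∈ singularSet Λ, Filter.Tendsto γ (nhdsWithin a (Set.Ioi a)) (nhds p)

end ImpulsiveWave

end

noncomputable section

open Set Filter Topology MeasureTheory Metric

namespace ImpulsiveWave

/-! ### Absolutely continuous functions and differential equations -/

section AbsolutelyContinuous

variable {E F : Type*} [NormedAddCommGroup E] [NormedSpace ℝ E] [NormedAddCommGroup F]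
  [NormedSpace ℝ F]

/-! On either side of the impulse the continuous metric agrees with a smooth metric that extends
across `U = 0`: the background metric in front, and behind it the metric with `U` in place of `U₊`.
The latter is the pullback of the background metric by `plusMap`
(`IsProfile.metricForm_plusMetric`), so on each side geodesics are background geodesics. These are
explicit: in five-dimensional space they solve the linear equation `Z'' = -κ (Z - center)` with `κ`
constant, and they exist for all times (`isBackgroundGeodesic_flow`,
`IsBackgroundGeodesic.eq_flow`).

The geodesic field may jump across `U = 0`, and the only obstruction to treating this as two smooth
problems is tangency. On both sides the `U`-component of the equation reads `U'' = A U' - B U` with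
`A`, `B` locally bounded. The bound `|U''| ≤ K (|U| + |U'|)` holds off a null set and therefore
survives in the Filippov inclusion; by Gronwall, `U = U' = 0` at one time implies the same at all
times (`IsWaveSolution.degenerate`). A solution with a point off the surface thus meets it
transversally. Near a crossing it is a smooth solution of one side before and of the other side
after, with the same state in the continuous coordinates (`exists_normalForm`). Existence and
uniqueness follow, first locally and then by a connectedness argument; maximal geodesics are unions
of all geodesics with the given data.

For completeness, let the interval end at a finite time `β`. The constant `κ` is a multiple of the
squared norm of the velocity and does not change at a crossing, because the metric is continuous.
After a crossing, `Ũ` is a nonzero multiple of the generalized sine with this `κ`, so successive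
crossings are separated by a fixed amount of time (`IsGeodesic.exists_ne_zero`). Hence just before
`β` the geodesic coincides with a complete background geodesic `F` (`IsGeodesic.exists_eqOn_flow`).
If `F β` is off `Ũ = 0`, the geodesic continues in the background; if it is on `Ũ = 0` but off the
singular generators, it continues by a transversal crossing. By maximality `F β` is a singular
point. The past is reduced to the future by time reversal. -/

theorem absolutelyContinuousOnInterval_clm (l : E →L[ℝ] F) {w : ℝ → E} {a b : ℝ}
    (hw : AbsolutelyContinuousOnInterval w a b) :
    AbsolutelyContinuousOnInterval (fun t => l (w t)) a b := by
  have h := Filter.Tendsto.const_mul ‖l‖ hw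
  rw [mul_zero] at h
  refine squeeze_zero (fun t => Finset.sum_nonneg fun i _ => dist_nonneg) (fun t => ?_) h
  rw [Finset.mul_sum]
  exact Finset.sum_le_sum fun i _ => l.lipschitz.dist_le_mul _ _

/-- The difference of `w` and a primitive of `g` is absolutely continuous with derivative zero
almost everywhere, hence constant. This turns almost-everywhere statements about Filippov solutions
into classical ones. -/
theorem hasDerivWithinAt_of_ae [CompleteSpace E] {w g : ℝ → E} {a b : ℝ}
    (hw : AbsolutelyContinuousOnInterval w a b) (hab : a ≤ b) (hg : ContinuousOn g (Icc a b))
    (h : ∀ᵐ t : ℝ, t ∈ Icc a b → HasDerivAt w (g t) t) :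
    ∀ t ∈ Icc a b, HasDerivWithinAt w (g t) (Icc a b) t := by
  -- Extending `g` by its boundary values makes the primitive differentiable on the whole line.
  set G : ℝ → E := fun t => g (projIcc a b hab t) with hG
  have hGc : Continuous G := (continuousOn_iff_continuous_domRestrict.1 hg).comp continuous_projIcc
  have hGe : ∀ t ∈ Icc a b, G t = g t := fun t ht => by simp [hG, projIcc_of_mem hab ht]
  set W : ℝ → E := fun t => ∫ s in a..t, G s with hW
  have hWd : ∀ t, HasDerivAt W (G t) t := fun t =>
    (hGc.integral_hasStrictDerivAt a t).hasDerivAt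
  have hW1 : ContDiff ℝ 1 W := by
    rw [contDiff_one_iff_deriv]
    refine ⟨fun t => (hWd t).differentiableAt, ?_⟩
    rwa [show deriv W = G from funext fun t => (hWd t).deriv]
  obtain ⟨C, hC⟩ := (hw.sub (hW1.contDiffOn.absolutelyContinuousOnInterval
    (a := a) (b := b))).const_of_ae_hasDerivAt_zero (by
      filter_upwards [h] with t ht hta
      rw [uIcc_of_le hab] at hta
      have := (ht hta).sub (hWd t)
      rwa [hGe t hta, sub_self] at this)
  rw [uIcc_of_le hab] at hC
  intro t ht
  have h1 : ∀ s ∈ Icc a b, w s = W s + C := fun s hs => by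
    rw [← hC s hs]; simp
  have h2 := ((hWd t).add_const C).hasDerivWithinAt (s := Icc a b)
  rw [hGe t ht] at h2
  exact h2.congr h1 (h1 t ht)

theorem le_of_ae_deriv_nonpos {M : ℝ → ℝ} {a b : ℝ} (hab : a ≤ b)
    (hM : AbsolutelyContinuousOnInterval M a b)
    (h : ∀ᵐ t : ℝ, t ∈ Icc a b → ∃ d ≤ 0, HasDerivAt M d t) : M b ≤ M a := by
  have h1 := hM.integral_deriv_eq_sub
  have h2 : 0 ≤ ∫ t in a..b, -deriv M t := by
    refine intervalIntegral.integral_nonneg_of_ae_restrict hab ?_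
    rw [EventuallyLE, ae_restrict_iff' measurableSet_Icc]
    filter_upwards [h] with t ht hta
    obtain ⟨d, hd, hd'⟩ := ht hta
    simpa [hd'.deriv] using hd
  rw [intervalIntegral.integral_neg] at h2
  linarith

/-- A Gronwall inequality for absolutely continuous solutions of `u' = p`, `|p'| ≤ K (|u| + |p|)`
with vanishing initial data. -/
theorem eq_zero_of_ae_abs_le {u p : ℝ → ℝ} {a b c K : ℝ} (hc : c ∈ Icc a b) (hK : 0 ≤ K)
    (hu : AbsolutelyContinuousOnInterval u a b) (hp : AbsolutelyContinuousOnInterval p a b)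
    (h : ∀ᵐ t : ℝ, t ∈ Icc a b → HasDerivAt u (p t) t ∧
      ∃ d, HasDerivAt p d t ∧ |d| ≤ K * (|u t| + |p t|))
    (hu0 : u c = 0) (hp0 : p c = 0) : ∀ t ∈ Icc a b, u t = 0 ∧ p t = 0 := by
  -- For `N = u² + p²` this bounds `|N'| = |2 u p + 2 p p'|` by `(1 + 3 K) N`.
  have key : ∀ (x y d : ℝ), |d| ≤ K * (|x| + |y|) →
      |2 * x * y + 2 * y * d| ≤ (1 + 3 * K) * (x ^ 2 + y ^ 2) := by
    intro x y d hd
    have h1 : |2 * x * y + 2 * y * d| ≤ 2 * |x| * |y| + 2 * |y| * |d| := by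
      refine (abs_add_le _ _).trans (le_of_eq ?_)
      simp [abs_mul]
    have h2 : |y| * |d| ≤ |y| * (K * (|x| + |y|)) := by gcongr
    have h3 : 2 * |x| * |y| ≤ x ^ 2 + y ^ 2 := by
      rw [← sq_abs x, ← sq_abs y]; nlinarith [sq_nonneg (|x| - |y|)]
    have h4 : |y| ^ 2 = y ^ 2 := sq_abs y
    nlinarith [mul_le_mul_of_nonneg_left h3 hK, mul_nonneg hK (sq_nonneg x)]
  set L := 1 + 3 * K with hL
  have hN : AbsolutelyContinuousOnInterval (u * u + p * p) a b := (hu.mul hu).add (hp.mul hp)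
  -- `N e^{σ t}` is nonincreasing for `σ = -L`, which is used after `c`, and nondecreasing for `σ =
  -- L`, which is used before `c`.
  have main : ∀ (σ : ℝ), AbsolutelyContinuousOnInterval
      ((u * u + p * p) * fun t => Real.exp (σ * t)) a b := fun σ => by
    refine hN.mul (ContDiffOn.absolutelyContinuousOnInterval ?_)
    exact (by fun_prop : ContDiff ℝ 1 fun t : ℝ => Real.exp (σ * t)).contDiffOn
  have der : ∀ (σ : ℝ), ∀ᵐ t : ℝ, t ∈ Icc a b → ∃ d, |d| ≤ L * (u t ^ 2 + p t ^ 2) ∧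
      HasDerivAt ((u * u + p * p) * fun t => Real.exp (σ * t))
        ((d + σ * (u t ^ 2 + p t ^ 2)) * Real.exp (σ * t)) t := fun σ => by
    filter_upwards [h] with t ht hta
    obtain ⟨h1, d, h2, h3⟩ := ht hta
    refine ⟨_, key _ _ _ h3, ?_⟩
    have h4 : HasDerivAt (fun t : ℝ => Real.exp (σ * t)) (Real.exp (σ * t) * (σ * 1)) t :=
      ((hasDerivAt_id t).const_mul σ).exp
    refine (((h1.mul h1).add (h2.mul h2)).mul h4).congr_deriv ?_
    simp only [Pi.add_apply, Pi.mul_apply]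
    ring
  intro t ht
  suffices hs : u t ^ 2 + p t ^ 2 ≤ 0 by
    constructor <;> nlinarith [sq_nonneg (u t), sq_nonneg (p t)]
  have hab : a ≤ b := ht.1.trans ht.2
  rcases le_total c t with hct | hct
  · have hsub : Icc c t ⊆ Icc a b := Icc_subset_Icc hc.1 ht.2
    have := le_of_ae_deriv_nonpos hct ((main (-L)).mono (by
      rwa [uIcc_of_le hct, uIcc_of_le hab])) (by
      filter_upwards [der (-L)] with s hs hsI
      obtain ⟨d, hd, hd'⟩ := hs (hsub hsI)
      refine ⟨_, ?_, hd'⟩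
      have := abs_le.1 hd
      exact mul_nonpos_of_nonpos_of_nonneg (by linarith) (Real.exp_pos _).le)
    simp only [Pi.add_apply, Pi.mul_apply, hu0, hp0, mul_zero, add_zero, zero_mul] at this
    have := nonpos_of_mul_nonpos_left this (Real.exp_pos _)
    linarith
  · have hsub : Icc t c ⊆ Icc a b := Icc_subset_Icc ht.1 hc.2
    have := le_of_ae_deriv_nonpos hct ((main L).mono (by
      rwa [uIcc_of_le hct, uIcc_of_le hab])).neg (by
      filter_upwards [der L] with s hs hsI
      obtain ⟨d, hd, hd'⟩ := hs (hsub hsI)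
      refine ⟨_, ?_, hd'.neg⟩
      have := abs_le.1 hd
      have := mul_nonneg (by linarith : 0 ≤ d + L * (u s ^ 2 + p s ^ 2)) (Real.exp_pos (L * s)).le
      linarith)
    simp only [Pi.neg_apply, Pi.add_apply, Pi.mul_apply, hu0, hp0, mul_zero, add_zero,
      zero_mul] at this
    have := nonpos_of_mul_nonpos_left (by linarith :
      (u t * u t + p t * p t) * Real.exp (L * t) ≤ 0) (Real.exp_pos _)
    linarith

/-- Uniqueness for an autonomous differential equation on a compact interval. -/
theorem eqOn_of_hasDerivWithinAt_Icc {f : E → E} {s : Set E} {K : NNReal} {w₁ w₂ : ℝ → E}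
    {a b c : ℝ} (hf : LipschitzOnWith K f s) (hc : c ∈ Icc a b)
    (h₁ : ∀ t ∈ Icc a b, w₁ t ∈ s ∧ HasDerivWithinAt w₁ (f (w₁ t)) (Icc a b) t)
    (h₂ : ∀ t ∈ Icc a b, w₂ t ∈ s ∧ HasDerivWithinAt w₂ (f (w₂ t)) (Icc a b) t)
    (h : w₁ c = w₂ c) : EqOn w₁ w₂ (Icc a b) := by
  have hcont : ∀ w : ℝ → E, (∀ t ∈ Icc a b, w t ∈ s ∧ HasDerivWithinAt w (f (w t)) (Icc a b) t) →
      ContinuousOn w (Icc a b) := fun w hw t ht => (hw t ht).2.continuousWithinAt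
  rw [← Icc_union_Icc_eq_Icc hc.1 hc.2]
  have s1 : Icc a c ⊆ Icc a b := Icc_subset_Icc_right hc.2
  have s2 : Icc c b ⊆ Icc a b := Icc_subset_Icc_left hc.1
  have d1 : ∀ w : ℝ → E, (∀ t ∈ Icc a b, w t ∈ s ∧ HasDerivWithinAt w (f (w t)) (Icc a b) t) →
      ∀ t ∈ Ioc a c, HasDerivWithinAt w (f (w t)) (Iic t) t := fun w hw t ht =>
    (hw t (s1 (Ioc_subset_Icc_self ht))).2.mono_of_mem_nhdsWithin
      (Icc_mem_nhdsLE_of_mem ⟨ht.1, ht.2.trans hc.2⟩)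
  have d2 : ∀ w : ℝ → E, (∀ t ∈ Icc a b, w t ∈ s ∧ HasDerivWithinAt w (f (w t)) (Icc a b) t) →
      ∀ t ∈ Ico c b, HasDerivWithinAt w (f (w t)) (Ici t) t := fun w hw t ht =>
    (hw t (s2 (Ico_subset_Icc_self ht))).2.mono_of_mem_nhdsWithin
      (Icc_mem_nhdsGE_of_mem ⟨hc.1.trans ht.1, ht.2⟩)
  refine EqOn.union ?_ ?_
  · exact ODE_solution_unique_of_mem_Icc_left (v := fun _ => f) (s := fun _ => s)
      (fun _ _ => hf) ((hcont _ h₁).mono s1) (d1 _ h₁)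
      (fun t ht => (h₁ t (s1 (Ioc_subset_Icc_self ht))).1) ((hcont _ h₂).mono s1) (d1 _ h₂)
      (fun t ht => (h₂ t (s1 (Ioc_subset_Icc_self ht))).1) h
  · exact ODE_solution_unique_of_mem_Icc_right (v := fun _ => f) (s := fun _ => s)
      (fun _ _ => hf) ((hcont _ h₁).mono s2) (d2 _ h₁)
      (fun t ht => (h₁ t (s2 (Ico_subset_Icc_self ht))).1) ((hcont _ h₂).mono s2) (d2 _ h₂)
      (fun t ht => (h₂ t (s2 (Ico_subset_Icc_self ht))).1) h

end AbsolutelyContinuous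

/-- A property that near each point of an interval holds either everywhere or nowhere. -/
theorem forall_of_locally_all_or_none {J : Set ℝ} (hJ : J.OrdConnected) {P : ℝ → Prop} {t₀ : ℝ}
    (ht₀ : t₀ ∈ J) (h₀ : P t₀)
    (h : ∀ τ ∈ J, ∃ ε > 0, ∀ a ∈ J, |a - τ| < ε → P a → ∀ b ∈ J, |b - τ| < ε → P b) :
    ∀ t ∈ J, P t := by
  classical
  -- The truth value of `P` is locally constant on `J`, hence continuous into the discrete space
  -- `Bool`, hence constant on the connected set `J`.
  have hc : ContinuousOn (fun t => decide (P t)) J := by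
    intro τ hτ
    obtain ⟨ε, hε, H⟩ := h τ hτ
    refine ContinuousWithinAt.congr_of_eventuallyEq
      (continuousWithinAt_const (b := decide (P τ))) ?_ rfl
    filter_upwards [self_mem_nhdsWithin, mem_nhdsWithin_of_mem_nhds (ball_mem_nhds τ hε)]
      with a ha haε
    have h1 : |a - τ| < ε := haε
    have h2 : |τ - τ| < ε := by simpa using hε
    exact decide_eq_decide.2 ⟨fun p => H a ha h1 p τ hτ h2, fun p => H τ hτ h2 p a ha h1⟩
  intro t ht
  have := hJ.isPreconnected.constant hc ht ht₀
  simpa [h₀] using this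

/-! ### The Filippov map -/

section FilippovMap

variable {E : Type*} [NormedAddCommGroup E] [NormedSpace ℝ E] [MeasureSpace E]

/-- The intersection defining `filippovMap` may be tested on one `δ` and one null set. All
information about Filippov solutions on the discontinuity is obtained in this way, from closed
convex constraints that hold off a null set. -/
theorem filippovMap_subset {f : E → E} {x : E} {S C : Set E} (hS : volume S = 0)
    (hC : Convex ℝ C) (hC' : IsClosed C) (h : ∀ᶠ y in 𝓝 x, y ∉ S → f y ∈ C) :
    filippovMap f x ⊆ C := by
  obtain ⟨δ, hδ, H⟩ := nhds_basis_closedBall.eventually_iff.1 h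
  intro d hd
  simp only [filippovMap, mem_iInter] at hd
  refine closedConvexHull_min ?_ hC hC' (hd δ hδ S hS)
  rintro _ ⟨y, hy, rfl⟩
  exact H hy.1 hy.2

theorem filippovMap_subset_singleton {f g : E → E} {x : E} (hfg : f =ᶠ[𝓝 x] g)
    (hg : ContinuousAt g x) : filippovMap f x ⊆ {g x} := by
  intro d hd
  refine mem_singleton_iff.2 (dist_le_zero.1 (le_of_forall_pos_le_add fun ε hε => ?_))
  rw [zero_add]
  refine filippovMap_subset (S := ∅) (C := closedBall (g x) ε) measure_empty
    (convex_closedBall _ _) isClosed_closedBall ?_ hd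
  filter_upwards [hfg, hg (closedBall_mem_nhds _ hε)] with y hy hy' _
  rwa [hy]

/-- Removing a null set leaves a dense part of the ball, so at a point of continuity `f x` is a
limit of the remaining values. -/
theorem mem_filippovMap {f : E → E} {x : E} [(volume : Measure E).IsOpenPosMeasure]
    (hf : ContinuousAt f x) : f x ∈ filippovMap f x := by
  simp only [filippovMap, mem_iInter]
  intro δ hδ S hS
  refine closure_subset_closedConvexHull ?_
  have hd : Dense Sᶜ := Measure.dense_of_ae (μ := volume) (p := fun y => y ∈ Sᶜ) (by
    rw [ae_iff]; simpa using hS)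
  have hx : x ∈ closure (ball x δ ∩ Sᶜ) :=
    hd.open_subset_closure_inter isOpen_ball (mem_ball_self hδ)
  refine closure_mono (image_mono ?_) (mem_closure_image hf hx)
  exact fun y hy => ⟨ball_subset_closedBall hy.1, hy.2⟩

theorem IsFilippovSolution.mono {f : E → E} {D D' : Set E} {I J : Set ℝ} {w : ℝ → E}
    (h : IsFilippovSolution f D I w) (hJ : J ⊆ I) (hD : D ⊆ D') : IsFilippovSolution f D' J w where
  mem t ht := hD (h.mem t (hJ ht))
  absCont a ha b hb := h.absCont a (hJ ha) b (hJ hb)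
  inclusion := by
    filter_upwards [h.inclusion] with t ht htJ using ht (hJ htJ)

theorem IsFilippovSolution.continuousOn {f : E → E} {D : Set E} {I : Set ℝ} {w : ℝ → E}
    (h : IsFilippovSolution f D I w) : ContinuousOn w I := by
  intro t ht
  -- The set `I` is arbitrary. The cases are: points of `I` on both sides of `t`, `t` the last
  -- point, `t` the first point, `t` the only point.
  by_cases hl : ∃ a ∈ I, a < t <;> by_cases hr : ∃ b ∈ I, t < b
  · obtain ⟨a, ha, hat⟩ := hl
    obtain ⟨b, hb, htb⟩ := hr
    have := (h.absCont a ha b hb).continuousOn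
    rw [uIcc_of_le (hat.trans htb).le] at this
    exact (this.continuousAt (Icc_mem_nhds hat htb)).continuousWithinAt
  · obtain ⟨a, ha, hat⟩ := hl
    have := (h.absCont a ha t ht).continuousOn t (by simp)
    rw [uIcc_of_le hat.le] at this
    refine this.mono_of_mem_nhdsWithin ?_
    refine mem_of_superset (inter_mem_nhdsWithin I (Ioi_mem_nhds hat)) ?_
    exact fun s hs => ⟨(mem_Ioi.1 hs.2).le, not_lt.1 fun h => hr ⟨s, hs.1, h⟩⟩
  · obtain ⟨b, hb, htb⟩ := hr
    have := (h.absCont t ht b hb).continuousOn t (by simp)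
    rw [uIcc_of_le htb.le] at this
    refine this.mono_of_mem_nhdsWithin ?_
    refine mem_of_superset (inter_mem_nhdsWithin I (Iio_mem_nhds htb)) ?_
    exact fun s hs => ⟨not_lt.1 fun h => hl ⟨s, hs.1, h⟩, (mem_Iio.1 hs.2).le⟩
  · have : I ⊆ {t} := fun s hs => le_antisymm (not_lt.1 fun h => hr ⟨s, hs, h⟩)
      (not_lt.1 fun h => hl ⟨s, hs, h⟩)
    exact continuousWithinAt_singleton.mono this

/-- Where the right-hand side is continuous, a Filippov solution is a classical solution; the
endpoints of the interval may lie on the discontinuity. -/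
theorem IsFilippovSolution.hasDerivWithinAt [CompleteSpace E] {f g : E → E} {D : Set E}
    {I : Set ℝ} {w : ℝ → E} (h : IsFilippovSolution f D I w) {a b : ℝ} (hab : a ≤ b)
    (haI : a ∈ I) (hbI : b ∈ I) (hI : I.OrdConnected)
    (hfg : ∀ t ∈ Ioo a b, f =ᶠ[𝓝 (w t)] g) (hg : ∀ t ∈ Icc a b, ContinuousAt g (w t)) :
    ∀ t ∈ Icc a b, HasDerivWithinAt w (g (w t)) (Icc a b) t := by
  have hsub : Icc a b ⊆ I := hI.out haI hbI
  refine hasDerivWithinAt_of_ae (h.absCont a haI b hbI) hab ?_ ?_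
  · intro t ht
    exact (hg t ht).comp_continuousWithinAt ((h.continuousOn).mono hsub t ht)
  · filter_upwards [h.inclusion, (countable_singleton a).ae_notMem volume,
      (countable_singleton b).ae_notMem volume] with t ht hta htb htI
    have hlt : t ∈ Ioo a b := ⟨lt_of_le_of_ne htI.1 (Ne.symm hta), lt_of_le_of_ne htI.2 htb⟩
    obtain ⟨d, hd, hd'⟩ := ht (hsub htI)
    rwa [← mem_singleton_iff.1 (filippovMap_subset_singleton (hfg t hlt) (hg t htI) hd)]

/-- Absolutely continuous curves that satisfy the differential equation classically, except at one
time, are Filippov solutions. -/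
theorem IsFilippovSolution.of_hasDerivAt [(volume : Measure E).IsOpenPosMeasure] {f : E → E}
    {D : Set E} {I : Set ℝ} {w : ℝ → E} (τ : ℝ) (hmem : ∀ t ∈ I, w t ∈ D)
    (hac : ∀ a ∈ I, ∀ b ∈ I, AbsolutelyContinuousOnInterval w a b)
    (h : ∀ t ∈ I, t ≠ τ → ContinuousAt f (w t) ∧ HasDerivAt w (f (w t)) t) :
    IsFilippovSolution f D I w where
  mem := hmem
  absCont := hac
  inclusion := by
    filter_upwards [(countable_singleton τ).ae_notMem volume] with t ht htI
    exact ⟨_, mem_filippovMap (h t htI ht).1, (h t htI ht).2⟩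

end FilippovMap

/-! ### The geodesic equation in variational form -/

/-- The bilinear form with coefficient matrix `g x`. -/
def metricForm (g : Coord → Matrix (Fin 4) (Fin 4) ℝ) (x u w : Coord) : ℝ :=
  ∑ i, ∑ j, g x i j * u i * w j

theorem fderiv_eq_sum_pd {n : ℕ} (f : (Fin n → ℝ) → ℝ) (x d : Fin n → ℝ) :
    fderiv ℝ f x d = ∑ i, d i * pd i f x := by
  conv_lhs => rw [pi_eq_sum_univ' d]
  simp [pd, map_sum]

section Form

variable {g : Coord → Matrix (Fin 4) (Fin 4) ℝ}

theorem metricForm_add_right (x u w w' : Coord) :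
    metricForm g x u (w + w') = metricForm g x u w + metricForm g x u w' := by
  simp [metricForm, mul_add, Finset.sum_add_distrib]

theorem metricForm_sub_right (x u w w' : Coord) :
    metricForm g x u (w - w') = metricForm g x u w - metricForm g x u w' := by
  simp [metricForm, mul_sub, Finset.sum_sub_distrib]

theorem metricForm_comm {x : Coord} (h : ∀ i j, g x i j = g x j i) (u w : Coord) :
    metricForm g x u w = metricForm g x w u := by
  unfold metricForm
  rw [Finset.sum_comm]
  refine Finset.sum_congr rfl fun i _ => Finset.sum_congr rfl fun j _ => ?_
  rw [h j i]; ring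

theorem metricForm_eq_dotProduct (x u w : Coord) :
    metricForm g x u w = u ⬝ᵥ (g x).mulVec w := by
  simp only [metricForm, dotProduct, Matrix.mulVec, Finset.mul_sum]
  exact Finset.sum_congr rfl fun i _ => Finset.sum_congr rfl fun j _ => by ring

theorem eq_zero_of_metricForm_right {x w : Coord} (hdet : (g x).det ≠ 0)
    (h : ∀ u, metricForm g x u w = 0) : w = 0 := by
  refine Matrix.eq_zero_of_mulVec_eq_zero hdet (dotProduct_eq_zero _ fun u => ?_)
  rw [dotProduct_comm, ← metricForm_eq_dotProduct, h]

theorem metricForm_comp_fderiv {φ A B : Coord → Coord} {x : Coord}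
    (hg : ∀ i j, DifferentiableAt ℝ (fun y => g y i j) (φ x)) (hφ : DifferentiableAt ℝ φ x)
    (hA : DifferentiableAt ℝ A x) (hB : DifferentiableAt ℝ B x) (d : Coord) :
    fderiv ℝ (fun y => metricForm g (φ y) (A y) (B y)) x d =
      fderiv ℝ (fun z => metricForm g z (A x) (B x)) (φ x) (fderiv ℝ φ x d)
      + metricForm g (φ x) (fderiv ℝ A x d) (B x) + metricForm g (φ x) (A x) (fderiv ℝ B x d) := by
  have hA' : ∀ i, HasFDerivAt (fun y => A y i)
      ((ContinuousLinearMap.proj (R := ℝ) (φ := fun _ : Fin 4 => ℝ) i).comp (fderiv ℝ A x)) x :=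
    fun i => hasFDerivAt_pi'.1 hA.hasFDerivAt i
  have hB' : ∀ i, HasFDerivAt (fun y => B y i)
      ((ContinuousLinearMap.proj (R := ℝ) (φ := fun _ : Fin 4 => ℝ) i).comp (fderiv ℝ B x)) x :=
    fun i => hasFDerivAt_pi'.1 hB.hasFDerivAt i
  have hg' : ∀ i j, HasFDerivAt (fun y => g (φ y) i j)
      ((fderiv ℝ (fun z => g z i j) (φ x)).comp (fderiv ℝ φ x)) x := fun i j =>
    (hg i j).hasFDerivAt.comp x hφ.hasFDerivAt
  have h1 : HasFDerivAt (fun y => metricForm g (φ y) (A y) (B y)) _ x :=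
    HasFDerivAt.fun_sum fun i (_ : i ∈ Finset.univ) => HasFDerivAt.fun_sum fun j
      (_ : j ∈ Finset.univ) => ((hg' i j).mul (hA' i)).mul (hB' j)
  have h2 : HasFDerivAt (fun z => metricForm g z (A x) (B x)) _ (φ x) :=
    HasFDerivAt.fun_sum fun i (_ : i ∈ Finset.univ) => HasFDerivAt.fun_sum fun j
      (_ : j ∈ Finset.univ) => ((hg i j).hasFDerivAt.mul_const (A x i)).mul_const (B x j)
  rw [h1.fderiv, h2.fderiv]
  simp only [metricForm, ← Finset.sum_add_distrib, sum_apply]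
  refine Finset.sum_congr rfl fun i _ => Finset.sum_congr rfl fun j _ => ?_
  simp
  ring

/-- The geodesic equation as the Euler-Lagrange equation of the energy. -/
theorem metricForm_geodesicField {x : Coord}
    (hg : ∀ i j, DifferentiableAt ℝ (fun y => g y i j) x) (hdet : (g x).det ≠ 0) (v u : Coord) :
    metricForm g x u (geodesicField g (x, v)).2 =
      -fderiv ℝ (fun y => metricForm g y v u) x v
      + 1 / 2 * fderiv ℝ (fun y => metricForm g y v v) x u := by
  have hform : ∀ v u d : Coord, fderiv ℝ (fun y => metricForm g y v u) x d =
      ∑ k, ∑ i, ∑ j, d k * pd k (fun y => g y i j) x * v i * u j := fun v u d => by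
    have h2 : HasFDerivAt (fun z => metricForm g z v u) _ x :=
      HasFDerivAt.fun_sum fun i (_ : i ∈ Finset.univ) => HasFDerivAt.fun_sum fun j
        (_ : j ∈ Finset.univ) => ((hg i j).hasFDerivAt.mul_const (v i)).mul_const (u j)
    rw [h2.fderiv]
    simp only [sum_apply]
    conv_rhs => rw [Finset.sum_comm]
    refine Finset.sum_congr rfl fun i _ => ?_
    conv_rhs => rw [Finset.sum_comm]
    refine Finset.sum_congr rfl fun j _ => ?_
    simp only [smul_apply, smul_eq_mul, fderiv_eq_sum_pd, Finset.mul_sum]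
    exact Finset.sum_congr rfl fun k _ => by ring
  -- The Christoffel symbols of the first kind, contracted twice with `v`; the acceleration is `-g⁻¹
  -- T`.
  set T : Fin 4 → ℝ := fun l => ∑ i, ∑ j, 1 / 2 *
    (pd i (fun y => g y j l) x + pd j (fun y => g y i l) x - pd l (fun y => g y i j) x)
      * v i * v j with hT
  have ha : (geodesicField g (x, v)).2 = -((g x)⁻¹.mulVec T) := by
    funext k
    simp only [geodesicField, christoffel, hT, Pi.neg_apply, Matrix.mulVec, dotProduct,
      Finset.mul_sum, Finset.sum_mul, neg_inj]
    rw [Finset.sum_comm]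
    conv_rhs => rw [Finset.sum_comm]; enter [2, i]; rw [Finset.sum_comm]
    rw [Finset.sum_comm]
    exact Finset.sum_congr rfl fun i _ => Finset.sum_congr rfl fun j _ =>
      Finset.sum_congr rfl fun l _ => by ring
  rw [metricForm_eq_dotProduct, ha, Matrix.mulVec_neg, Matrix.mulVec_mulVec,
    Matrix.mul_nonsing_inv _ (isUnit_iff_ne_zero.2 hdet), Matrix.one_mulVec, hform, hform]
  have e1 : (∑ k, ∑ i, ∑ j, v k * pd k (fun y => g y i j) x * v i * u j) =
      ∑ l, ∑ i, ∑ j, v i * v j * u l * pd i (fun y => g y j l) x := by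
    rw [Finset.sum_comm' (t' := Finset.univ) (s' := fun _ => Finset.univ) (by simp)]
    conv_lhs => enter [2, i]; rw [Finset.sum_comm]
    rw [Finset.sum_comm]
    refine Finset.sum_congr rfl fun l _ => ?_
    rw [Finset.sum_comm]
    exact Finset.sum_congr rfl fun i _ => Finset.sum_congr rfl fun j _ => by ring
  -- Since `v i * v j` is symmetric, the first two terms of the Christoffel symbol contribute
  -- equally.
  have e2 : (∑ l, ∑ i, ∑ j, v i * v j * u l * pd i (fun y => g y j l) x) =
      ∑ l, ∑ i, ∑ j, v i * v j * u l * pd j (fun y => g y i l) x := by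
    refine Finset.sum_congr rfl fun l _ => ?_
    rw [Finset.sum_comm]
    exact Finset.sum_congr rfl fun i _ => Finset.sum_congr rfl fun j _ => by ring
  have e3 : u ⬝ᵥ -T = -(1 / 2 * (∑ l, ∑ i, ∑ j, v i * v j * u l * pd i (fun y => g y j l) x)
      + 1 / 2 * (∑ l, ∑ i, ∑ j, v i * v j * u l * pd j (fun y => g y i l) x))
      + 1 / 2 * ∑ k, ∑ i, ∑ j, u k * pd k (fun y => g y i j) x * v i * v j := by
    simp only [dotProduct, hT, Pi.neg_apply, Finset.mul_sum, mul_neg,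
      ← Finset.sum_neg_distrib, ← Finset.sum_add_distrib]
    exact Finset.sum_congr rfl fun l _ => Finset.sum_congr rfl fun i _ =>
      Finset.sum_congr rfl fun j _ => by ring
  rw [e3, ← e2, e1]
  ring

/-- A map that pulls back the metric `g'` to the metric `g` maps geodesics to geodesics. -/
theorem fderiv_geodesicField_add {g' : Coord → Matrix (Fin 4) (Fin 4) ℝ} {φ : Coord → Coord}
    {x : Coord} (hφ : ContDiffAt ℝ 2 φ x)
    (hg : ∀ i j, DifferentiableAt ℝ (fun y => g y i j) x) (hdet : (g x).det ≠ 0)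
    (hg' : ∀ i j, DifferentiableAt ℝ (fun y => g' y i j) (φ x)) (hdet' : (g' (φ x)).det ≠ 0)
    (hsymm : ∀ i j, g' (φ x) i j = g' (φ x) j i)
    (hform : ∀ᶠ y in 𝓝 x, ∀ u w, metricForm g y u w =
      metricForm g' (φ y) (fderiv ℝ φ y u) (fderiv ℝ φ y w)) (v : Coord) :
    fderiv ℝ φ x (geodesicField g (x, v)).2 + fderiv ℝ (fderiv ℝ φ) x v v =
      (geodesicField g' (φ x, fderiv ℝ φ x v)).2 := by
  have hφ1 : DifferentiableAt ℝ φ x := hφ.differentiableAt (by norm_num)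
  have hφ2 : DifferentiableAt ℝ (fderiv ℝ φ) x :=
    (hφ.fderiv_right (m := 1) (by norm_num)).differentiableAt (by norm_num)
  have hd : ∀ u, HasFDerivAt (fun y => fderiv ℝ φ y u)
      ((fderiv ℝ (fderiv ℝ φ) x).flip u) x := fun u => by
    simpa using hφ2.hasFDerivAt.clm_apply (hasFDerivAt_const u x)
  have hsym2 : ∀ u w, fderiv ℝ (fderiv ℝ φ) x u w = fderiv ℝ (fderiv ℝ φ) x w u :=
    fun u w => (hφ.isSymmSndFDerivAt (by simp)).eq u w
  have hder : ∀ v u d, fderiv ℝ (fun y => metricForm g y v u) x d =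
      fderiv ℝ (fun z => metricForm g' z (fderiv ℝ φ x v) (fderiv ℝ φ x u)) (φ x)
        (fderiv ℝ φ x d)
      + metricForm g' (φ x) (fderiv ℝ (fderiv ℝ φ) x d v) (fderiv ℝ φ x u)
      + metricForm g' (φ x) (fderiv ℝ φ x v) (fderiv ℝ (fderiv ℝ φ) x d u) := fun v u d => by
    rw [EventuallyEq.fderiv_eq (hform.mono fun y hy => hy v u),
      metricForm_comp_fderiv hg' hφ1 (hd v).differentiableAt (hd u).differentiableAt,
      (hd v).fderiv, (hd u).fderiv]
    rfl
  have hx := hform.self_of_nhds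
  -- Both accelerations are compared through their Euler-Lagrange equations. Of the second
  -- derivatives of `φ`, those in the direction `(u, v)` cancel by symmetry, and only the one in the
  -- direction `(v, v)` remains.
  have key : ∀ u, metricForm g' (φ x) (fderiv ℝ φ x u) (fderiv ℝ φ x (geodesicField g (x, v)).2
      + fderiv ℝ (fderiv ℝ φ) x v v - (geodesicField g' (φ x, fderiv ℝ φ x v)).2) = 0 := by
    intro u
    rw [metricForm_sub_right, metricForm_add_right, ← hx, metricForm_geodesicField hg hdet,
      metricForm_geodesicField hg' hdet', hder, hder, hsym2 u v,
      metricForm_comm hsymm (fderiv ℝ (fderiv ℝ φ) x v u),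
      metricForm_comm hsymm (fderiv ℝ (fderiv ℝ φ) x v v)]
    ring
  -- Nondegeneracy of `g` makes the derivative of `φ` injective, hence surjective, so testing
  -- against its image is enough.
  have hinj : Function.Injective (fderiv ℝ φ x) := by
    rw [injective_iff_map_eq_zero]
    intro w hw
    refine eq_zero_of_metricForm_right hdet fun u => ?_
    rw [hx, hw]
    simp [metricForm]
  have hsurj : Function.Surjective (fderiv ℝ φ x) :=
    LinearMap.injective_iff_surjective.1 hinj
  refine sub_eq_zero.1 (eq_zero_of_metricForm_right hdet' fun u => ?_)
  obtain ⟨u, rfl⟩ := hsurj u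
  exact key u

theorem geodesicField_congr {g' : Coord → Matrix (Fin 4) (Fin 4) ℝ} {x : Coord}
    (h : g =ᶠ[𝓝 x] g') (v : Coord) : geodesicField g (x, v) = geodesicField g' (x, v) := by
  have hpd : ∀ k i j, pd k (fun y => g y i j) x = pd k (fun y => g' y i j) x := fun k i j => by
    unfold pd
    rw [EventuallyEq.fderiv_eq (h.mono fun y hy =>
      (by simp only [hy] : (fun y => g y i j) y = (fun y => g' y i j) y))]
  simp only [geodesicField, christoffel, hpd, h.self_of_nhds]

theorem geodesicField_eventuallyEq {g' : Coord → Matrix (Fin 4) (Fin 4) ℝ} {w : Phase}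
    (h : g =ᶠ[𝓝 w.1] g') : geodesicField g =ᶠ[𝓝 w] geodesicField g' := by
  filter_upwards [continuous_fst.continuousAt.eventually h.eventuallyEq_nhds] with y hy
  exact geodesicField_congr hy y.2

theorem contDiffAt_det {n : ℕ} {E : Type*} [NormedAddCommGroup E] [NormedSpace ℝ E]
    {M : E → Matrix (Fin n) (Fin n) ℝ} {x : E}
    (h : ∀ i j, ContDiffAt ℝ ∞ (fun y => M y i j) x) :
    ContDiffAt ℝ ∞ (fun y => (M y).det) x := by
  simp only [Matrix.det_apply]
  refine ContDiffAt.sum fun σ _ => ContDiffAt.const_smul _ ?_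
  exact contDiffAt_prod fun i _ => h _ _

/-- By Cramer's rule the entries of the inverse are quotients of determinants. -/
theorem contDiffAt_matrix_inv {n : ℕ} {E : Type*} [NormedAddCommGroup E] [NormedSpace ℝ E]
    {M : E → Matrix (Fin n) (Fin n) ℝ} {x : E}
    (h : ∀ i j, ContDiffAt ℝ ∞ (fun y => M y i j) x) (hdet : (M x).det ≠ 0) (k l : Fin n) :
    ContDiffAt ℝ ∞ (fun y => (M y)⁻¹ k l) x := by
  simp only [Matrix.inv_def, Ring.inverse_eq_inv', Matrix.smul_apply, smul_eq_mul,
    Matrix.adjugate_apply]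
  refine ((contDiffAt_det h).inv hdet).mul (contDiffAt_det fun i j => ?_)
  by_cases hi : i = l
  · subst hi
    simp only [Matrix.updateRow_self]
    exact contDiffAt_const
  · simp only [Matrix.updateRow_ne hi]
    exact h i j

theorem contDiffAt_pd {n : ℕ} {f : (Fin n → ℝ) → ℝ} {x : Fin n → ℝ} (hf : ContDiffAt ℝ ∞ f x)
    (i : Fin n) : ContDiffAt ℝ ∞ (pd i f) x :=
  (hf.fderiv_right (m := ∞) (by simp)).clm_apply contDiffAt_const

theorem contDiffAt_geodesicField {w : Phase}
    (hg : ∀ i j, ContDiffAt ℝ ∞ (fun y => g y i j) w.1) (hdet : (g w.1).det ≠ 0) :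
    ContDiffAt ℝ ∞ (geodesicField g) w := by
  have hc : ∀ k i j, ContDiffAt ℝ ∞ (fun y => christoffel g y k i j) w.1 := fun k i j => by
    unfold christoffel
    refine contDiffAt_const.mul (ContDiffAt.sum fun l _ =>
      (contDiffAt_matrix_inv hg hdet k l).mul ?_)
    exact ((contDiffAt_pd (hg j l) i).add (contDiffAt_pd (hg i l) j)).sub (contDiffAt_pd (hg i j) l)
  unfold geodesicField
  refine contDiffAt_snd.prodMk (contDiffAt_pi.2 fun k => ?_)
  refine ContDiffAt.neg (ContDiffAt.sum fun i _ => ContDiffAt.sum fun j _ => ?_)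
  refine (((hc k i j).comp w contDiffAt_fst).mul ?_).mul ?_
  · exact (contDiffAt_pi.1 contDiffAt_snd i)
  · exact (contDiffAt_pi.1 contDiffAt_snd j)

end Form

/-! ### The smooth metric behind the impulse and its flattening map

Replacing the kink `U₊` by `U` in the continuous metric gives a smooth metric, which is the pullback
of the background metric. For `H = 0` it is the background metric itself. -/

/-- The projection to the spatial coordinates as a linear map. -/
def spatialL : Coord →L[ℝ] (Fin 2 → ℝ) :=
  ContinuousLinearMap.pi fun i => ContinuousLinearMap.proj (![2, 3] i)

@[simp] theorem spatialL_apply (x : Coord) : spatialL x = spatial x := by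
  funext i; fin_cases i <;> rfl

theorem continuous_spatial : Continuous spatial := by
  rw [show spatial = spatialL from funext fun x => (spatialL_apply x).symm]
  exact spatialL.continuous

/-- The matrix `δ_{ij} + 2 U H_{,ij} + U² δ^{kl} H_{,ik} H_{,jl}`. -/
def plusSpatialMetric (H : (Fin 2 → ℝ) → ℝ) (x : Coord) : Matrix (Fin 2) (Fin 2) ℝ :=
  Matrix.of fun i j => (if i = j then 1 else 0)
    + 2 * x 0 * pd i (pd j H) (spatial x)
    + x 0 ^ 2 * ∑ k, pd i (pd k H) (spatial x) * pd j (pd k H) (spatial x)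

/-- The function `1 + Λ/12 (X² + Y² - 2UV - 2UG)`. -/
def plusOmega (Λ : ℝ) (H : (Fin 2 → ℝ) → ℝ) (x : Coord) : ℝ :=
  1 + Λ / 12 * (x 2 ^ 2 + x 3 ^ 2 - 2 * x 0 * x 1 - 2 * x 0 * funG H (spatial x))

/-- The wave metric with `U` in place of `U₊`. -/
def plusMetric (Λ : ℝ) (H : (Fin 2 → ℝ) → ℝ) (x : Coord) : Matrix (Fin 4) (Fin 4) ℝ :=
  (plusOmega Λ H x ^ 2)⁻¹ •
    !![0, -1, 0, 0;
       -1, 0, 0, 0;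
       0, 0, plusSpatialMetric H x 0 0, plusSpatialMetric H x 0 1;
       0, 0, plusSpatialMetric H x 1 0, plusSpatialMetric H x 1 1]

/-- The coordinate transformation behind the impulse. -/
def plusMap (H : (Fin 2 → ℝ) → ℝ) (x : Coord) : Coord :=
  ![x 0,
    x 1 + H (spatial x) + 1 / 2 * x 0 * (pd 0 H (spatial x) ^ 2 + pd 1 H (spatial x) ^ 2),
    x 2 + x 0 * pd 0 H (spatial x),
    x 3 + x 0 * pd 1 H (spatial x)]

/-- The domain of the metric `plusMetric Λ H`, for a function `H` that is smooth on `R`. -/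
def plusDomain (Λ : ℝ) (H : (Fin 2 → ℝ) → ℝ) (R : Set (Fin 2 → ℝ)) : Set Coord :=
  {x | plusOmega Λ H x ≠ 0 ∧ (plusSpatialMetric H x).det ≠ 0 ∧ spatial x ∈ R}

/-- `H` is smooth on the open set `R`. -/
structure IsProfile (H : (Fin 2 → ℝ) → ℝ) (R : Set (Fin 2 → ℝ)) : Prop where
  isOpen : IsOpen R
  contDiffOn : ContDiffOn ℝ ∞ H R

theorem isProfile_zero : IsProfile 0 univ := ⟨isOpen_univ, contDiffOn_const⟩

theorem isOpen_regularSet (Λ : ℝ) : IsOpen (regularSet Λ) := by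
  refine (isOpen_ne).inter (isOpen_ne_fun (by fun_prop) continuous_const)

@[simp] theorem pd_zero_fun {n : ℕ} (i : Fin n) : pd i (0 : (Fin n → ℝ) → ℝ) = 0 := by
  funext x
  simp [pd]

/-- The terms `U² |∇H|²` of `x² + y²` and `-2 𝒰 𝒱` cancel, and the terms with a single explicit
factor `U` combine to `-2 U (V + H - X^i H_{,i})`. This is the origin of `G` in the conformal
factor. -/
theorem bigOmega_plusMap (Λ : ℝ) (H : (Fin 2 → ℝ) → ℝ) (x : Coord) :
    bigOmega Λ (plusMap H x) = plusOmega Λ H x := by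
  simp [bigOmega, plusMap, plusOmega, funG, Fin.sum_univ_two, spatial]
  left; ring

theorem bigOmega_plusMap_ne_zero {Λ : ℝ} {H : (Fin 2 → ℝ) → ℝ} {R : Set (Fin 2 → ℝ)} {x : Coord}
    (hx : x ∈ plusDomain Λ H R) : bigOmega Λ (plusMap H x) ≠ 0 := by
  rw [bigOmega_plusMap]; exact hx.1

theorem plusOmega_zero (Λ : ℝ) : plusOmega Λ 0 = bigOmega Λ := by
  funext x
  simp [bigOmega, plusOmega, funG]

theorem plusSpatialMetric_zero (x : Coord) : plusSpatialMetric 0 x = 1 := by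
  ext i j
  simp [plusSpatialMetric, Matrix.one_apply]

theorem plusMetric_zero (Λ : ℝ) : plusMetric Λ 0 = backgroundMetric Λ := by
  funext x
  simp [plusMetric, backgroundMetric, plusOmega_zero, plusSpatialMetric_zero]

@[simp] theorem plusMap_zero (x : Coord) : plusMap 0 x = x := by
  funext i
  fin_cases i <;> simp [plusMap]

theorem plusDomain_zero (Λ : ℝ) : plusDomain Λ 0 univ = {x | bigOmega Λ x ≠ 0} := by
  ext x
  simp [plusDomain, plusOmega_zero, plusSpatialMetric_zero]

theorem det_block (s a b c d : ℝ) :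
    (s • !![0, -1, 0, 0; -1, 0, 0, 0; 0, 0, a, b; 0, 0, c, d] :
      Matrix (Fin 4) (Fin 4) ℝ).det = -s ^ 4 * (a * d - b * c) := by
  have h : Fin.succAbove (1 : Fin 4) (2 : Fin 3) = 3 := rfl
  simp [Matrix.det_succ_row_zero, Fin.sum_univ_succ, h]
  ring

theorem det_plusMetric_ne_zero {Λ : ℝ} {H : (Fin 2 → ℝ) → ℝ} {R : Set (Fin 2 → ℝ)} {x : Coord}
    (hx : x ∈ plusDomain Λ H R) : (plusMetric Λ H x).det ≠ 0 := by
  have h2 := hx.2.1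
  rw [Matrix.det_fin_two] at h2
  rw [plusMetric, det_block]
  exact mul_ne_zero (neg_ne_zero.2 (pow_ne_zero _ (inv_ne_zero (pow_ne_zero _ hx.1)))) h2

theorem contDiffAt_comp_spatial {x : Coord} {f : (Fin 2 → ℝ) → ℝ}
    (hf : ContDiffAt ℝ ∞ f (spatial x)) : ContDiffAt ℝ ∞ (fun y => f (spatial y)) x := by
  have h : ContDiffAt ℝ ∞ (f ∘ spatialL) x :=
    ContDiffAt.comp x (by simpa using hf) spatialL.contDiff.contDiffAt
  exact h.congr_of_eventuallyEq (Eventually.of_forall fun y => by simp)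

theorem two_le_infty : (2 : WithTop ℕ∞) ≤ ∞ := by
  exact WithTop.coe_le_coe.2 (le_top : (2 : ℕ∞) ≤ ⊤)

namespace IsProfile

variable {Λ : ℝ} {H : (Fin 2 → ℝ) → ℝ} {R : Set (Fin 2 → ℝ)}

theorem contDiffAt (hH : IsProfile H R) {X : Fin 2 → ℝ} (hX : X ∈ R) : ContDiffAt ℝ ∞ H X :=
  hH.contDiffOn.contDiffAt (hH.isOpen.mem_nhds hX)

theorem pd_comm (hH : IsProfile H R) {X : Fin 2 → ℝ} (hX : X ∈ R) (i j : Fin 2) :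
    pd i (pd j H) X = pd j (pd i H) X := by
  have h := hH.contDiffAt hX
  have h2 : DifferentiableAt ℝ (fderiv ℝ H) X :=
    (h.fderiv_right (m := 1) two_le_infty).differentiableAt (by norm_num)
  have h3 : ∀ i j, pd i (pd j H) X = fderiv ℝ (fderiv ℝ H) X (Pi.single i 1) (Pi.single j 1) := by
    intro i j
    have := h2.hasFDerivAt.clm_apply (hasFDerivAt_const (Pi.single j 1 : Fin 2 → ℝ) X)
    rw [pd, show pd j H = fun y => fderiv ℝ H y (Pi.single j 1) from rfl, this.fderiv]
    simp
  rw [h3, h3]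
  exact (h.isSymmSndFDerivAt (by simpa using two_le_infty)).eq _ _

theorem contDiffAt_plusMap (hH : IsProfile H R) {x : Coord} (hx : spatial x ∈ R) : ContDiffAt ℝ ∞ (plusMap H) x := by
  have h := hH.contDiffAt hx
  have h0 := contDiffAt_comp_spatial h
  have h1 := fun i => contDiffAt_comp_spatial (contDiffAt_pd h i)
  have hc : ∀ i : Fin 4, ContDiffAt ℝ ∞ (fun y : Coord => y i) x := fun i => (contDiff_apply ℝ ℝ i).contDiffAt
  refine contDiffAt_pi.2 fun i => ?_
  fin_cases i
  · exact hc 0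
  · exact ((hc 1).add h0).add ((contDiffAt_const.mul (hc 0)).mul (((h1 0).pow 2).add ((h1 1).pow 2)))
  · exact (hc 2).add ((hc 0).mul (h1 0))
  · exact (hc 3).add ((hc 0).mul (h1 1))

theorem fderiv_plusMap (hH : IsProfile H R) {x : Coord} (hx : spatial x ∈ R) (u : Coord) :
    fderiv ℝ (plusMap H) x u =
      ![u 0,
        u 1 + (u 2 * pd 0 H (spatial x) + u 3 * pd 1 H (spatial x))
          + 1 / 2 * u 0 * (pd 0 H (spatial x) ^ 2 + pd 1 H (spatial x) ^ 2)
          + x 0 * (pd 0 H (spatial x) * (u 2 * pd 0 (pd 0 H) (spatial x)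
              + u 3 * pd 1 (pd 0 H) (spatial x))
            + pd 1 H (spatial x) * (u 2 * pd 0 (pd 1 H) (spatial x)
              + u 3 * pd 1 (pd 1 H) (spatial x))),
        u 2 + u 0 * pd 0 H (spatial x) + x 0 * (u 2 * pd 0 (pd 0 H) (spatial x)
              + u 3 * pd 1 (pd 0 H) (spatial x)),
        u 3 + u 0 * pd 1 H (spatial x) + x 0 * (u 2 * pd 0 (pd 1 H) (spatial x)
              + u 3 * pd 1 (pd 1 H) (spatial x))] := by
  have h := hH.contDiffAt hx
  have hs : ∀ f : (Fin 2 → ℝ) → ℝ, ContDiffAt ℝ ∞ f (spatial x) →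
      HasFDerivAt (fun y => f (spatial y)) ((fderiv ℝ f (spatial x)).comp spatialL) x := by
    intro f hf
    have h1 : HasFDerivAt f (fderiv ℝ f (spatial x)) (spatialL x) := by
      simpa using (hf.differentiableAt (by simp)).hasFDerivAt
    exact (h1.comp x spatialL.hasFDerivAt).congr_of_eventuallyEq
      (Eventually.of_forall fun y => by simp)
  have hs' : ∀ f : (Fin 2 → ℝ) → ℝ, (fderiv ℝ f (spatial x)) (spatial u) =
      u 2 * pd 0 f (spatial x) + u 3 * pd 1 f (spatial x) := fun f => by
    rw [fderiv_eq_sum_pd, Fin.sum_univ_two]; rfl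
  have h0 := hs _ h
  have h1 := fun i => hs _ (contDiffAt_pd h i)
  have hc : ∀ i : Fin 4, HasFDerivAt (fun y : Coord => y i)
      (ContinuousLinearMap.proj (R := ℝ) (φ := fun _ : Fin 4 => ℝ) i) x :=
    fun i => hasFDerivAt_apply i x
  have hd : DifferentiableAt ℝ (plusMap H) x :=
    (hH.contDiffAt_plusMap hx).differentiableAt (by simp)
  funext i
  have hi : fderiv ℝ (plusMap H) x u i = fderiv ℝ (fun y => plusMap H y i) x u := by
    rw [(hasFDerivAt_pi'.1 hd.hasFDerivAt i).fderiv]; rfl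
  rw [hi]
  fin_cases i
  · have e : HasFDerivAt (fun y => plusMap H y 0) _ x := hc 0
    simpa using congrArg (fun l => l u) e.fderiv
  · have e : HasFDerivAt (fun y => plusMap H y 1) _ x := ((hc 1).add h0).add
      (((hasFDerivAt_const (1 / 2 : ℝ) x).mul (hc 0)).mul (((h1 0).pow 2).add ((h1 1).pow 2)))
    refine (congrArg (fun l => l u) e.fderiv).trans ?_
    simp [hs']
    ring
  · have e : HasFDerivAt (fun y => plusMap H y 2) _ x := (hc 2).add ((hc 0).mul (h1 0))
    refine (congrArg (fun l => l u) e.fderiv).trans ?_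
    simp [hs']
    ring
  · have e : HasFDerivAt (fun y => plusMap H y 3) _ x := (hc 3).add ((hc 0).mul (h1 1))
    refine (congrArg (fun l => l u) e.fderiv).trans ?_
    simp [hs']
    ring

/-- The metric `plusMetric Λ H` is the pullback of the background metric by `plusMap H`. -/
theorem metricForm_plusMetric (hH : IsProfile H R) {x : Coord} (hx : spatial x ∈ R) (u w : Coord) :
    metricForm (plusMetric Λ H) x u w = metricForm (backgroundMetric Λ) (plusMap H x)
      (fderiv ℝ (plusMap H) x u) (fderiv ℝ (plusMap H) x w) := by
  have hp := hH.pd_comm hx 0 1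
  rw [hH.fderiv_plusMap hx, hH.fderiv_plusMap hx]
  simp only [metricForm, plusMetric, backgroundMetric, bigOmega_plusMap, Fin.sum_univ_four,
    Matrix.smul_apply, smul_eq_mul, plusSpatialMetric, Fin.sum_univ_two, Matrix.of_apply, hp]
  simp
  ring

theorem contDiffAt_plusOmega (hH : IsProfile H R) {x : Coord} (hx : spatial x ∈ R) :
    ContDiffAt ℝ ∞ (plusOmega Λ H) x := by
  have h : ContDiffAt ℝ ∞ (fun y => bigOmega Λ (plusMap H y)) x := by
    have hb : ContDiff ℝ ∞ (bigOmega Λ) := by unfold bigOmega; fun_prop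
    exact hb.contDiffAt.comp x (hH.contDiffAt_plusMap hx)
  exact h.congr_of_eventuallyEq (Eventually.of_forall fun y => (bigOmega_plusMap Λ H y).symm)

theorem contDiffAt_plusSpatialMetric (hH : IsProfile H R) {x : Coord} (hx : spatial x ∈ R) (i j : Fin 2) :
    ContDiffAt ℝ ∞ (fun y => plusSpatialMetric H y i j) x := by
  have h := hH.contDiffAt hx
  have h2 := fun i j => contDiffAt_comp_spatial (contDiffAt_pd (contDiffAt_pd h j) i)
  have hc : ContDiffAt ℝ ∞ (fun y : Coord => y 0) x := (contDiff_apply ℝ ℝ 0).contDiffAt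
  simp only [plusSpatialMetric, Matrix.of_apply]
  exact (contDiffAt_const.add ((contDiffAt_const.mul hc).mul (h2 i j))).add
    ((hc.pow 2).mul (ContDiffAt.sum fun k _ => (h2 i k).mul (h2 j k)))

theorem contDiffAt_plusMetric (hH : IsProfile H R) {x : Coord} (hx : x ∈ plusDomain Λ H R) (i j : Fin 4) :
    ContDiffAt ℝ ∞ (fun y => plusMetric Λ H y i j) x := by
  have h := hH.contDiffAt_plusSpatialMetric hx.2.2
  simp only [plusMetric, Matrix.smul_apply, smul_eq_mul]
  refine (((hH.contDiffAt_plusOmega hx.2.2).pow 2).inv (pow_ne_zero _ hx.1)).mul ?_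
  fin_cases i <;> fin_cases j <;> simp <;> first | exact contDiffAt_const | apply h

theorem isOpen_plusDomain (hH : IsProfile H R) : IsOpen (plusDomain Λ H R) := by
  rw [isOpen_iff_mem_nhds]
  intro x hx
  have h1 := (hH.contDiffAt_plusOmega (Λ := Λ) hx.2.2).continuousAt.eventually_ne hx.1
  have h2 := (contDiffAt_det (hH.contDiffAt_plusSpatialMetric hx.2.2)).continuousAt.eventually_ne
    hx.2.1
  have h3 := continuous_spatial.continuousAt.eventually (hH.isOpen.mem_nhds hx.2.2)
  filter_upwards [h1, h2, h3] with y a b c using ⟨a, b, c⟩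

theorem contDiffAt_geodesicField (hH : IsProfile H R) {w : Phase} (hw : w.1 ∈ plusDomain Λ H R) :
    ContDiffAt ℝ ∞ (geodesicField (plusMetric Λ H)) w :=
  ImpulsiveWave.contDiffAt_geodesicField (hH.contDiffAt_plusMetric hw) (det_plusMetric_ne_zero hw)

theorem fderiv_plusMap_geodesicField (hH : IsProfile H R) {x : Coord} (hx : x ∈ plusDomain Λ H R) (v : Coord) :
    fderiv ℝ (plusMap H) x (geodesicField (plusMetric Λ H) (x, v)).2
        + fderiv ℝ (fderiv ℝ (plusMap H)) x v v =
      (geodesicField (backgroundMetric Λ) (plusMap H x, fderiv ℝ (plusMap H) x v)).2 := by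
  have hy : plusMap H x ∈ plusDomain Λ 0 univ := by
    rw [plusDomain_zero]; exact bigOmega_plusMap_ne_zero hx
  have hb := isProfile_zero.contDiffAt_plusMetric hy
  have hdet := det_plusMetric_ne_zero hy
  rw [plusMetric_zero] at hb hdet
  refine fderiv_geodesicField_add ((hH.contDiffAt_plusMap hx.2.2).of_le two_le_infty)
    (fun i j => (hH.contDiffAt_plusMetric hx i j).differentiableAt (by simp))
    (det_plusMetric_ne_zero hx) (fun i j => (hb i j).differentiableAt (by simp)) hdet
    (fun i j => ?_) ?_ v
  · fin_cases i <;> fin_cases j <;> simp [backgroundMetric]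
  · filter_upwards [hH.isOpen_plusDomain.mem_nhds hx] with y hy u w
    exact hH.metricForm_plusMetric hy.2.2 u w

end IsProfile

/-! ### Geodesics of the background in conformally flat coordinates -/

/-- The Lorentzian inner product of the coordinates `(𝒰, 𝒱, x, y)`. -/
def lorentz (u w : Coord) : ℝ := u 2 * w 2 + u 3 * w 3 - u 0 * w 1 - u 1 * w 0

theorem metricForm_backgroundMetric (Λ : ℝ) (x u w : Coord) :
    metricForm (backgroundMetric Λ) x u w = (bigOmega Λ x ^ 2)⁻¹ * lorentz u w := by
  simp [metricForm, backgroundMetric, Fin.sum_univ_four, lorentz]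
  ring

theorem bigOmega_eq (Λ : ℝ) (x : Coord) : bigOmega Λ x = 1 + Λ / 12 * lorentz x x := by
  simp [bigOmega, lorentz]; left; ring

theorem hasFDerivAt_bigOmega (Λ : ℝ) (x : Coord) :
    ∃ L : Coord →L[ℝ] ℝ, HasFDerivAt (bigOmega Λ) L x ∧ ∀ d, L d = Λ / 6 * lorentz x d := by
  have hc : ∀ i : Fin 4, HasFDerivAt (fun y : Coord => y i)
      (ContinuousLinearMap.proj (R := ℝ) (φ := fun _ : Fin 4 => ℝ) i) x :=
    fun i => hasFDerivAt_apply i x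
  have h : HasFDerivAt (bigOmega Λ) _ x := (((((hc 2).pow 2).add ((hc 3).pow 2)).sub
    (((hc 0).const_mul 2).mul (hc 1))).const_mul (Λ / 12)).const_add 1
  refine ⟨_, h, fun d => ?_⟩
  simp [lorentz]
  ring

/-- The Euler-Lagrange equation of `Ω⁻² η` gives an acceleration that is a combination of the
velocity and the position only. Its component in the direction of `U` is therefore linear in `U` and
`U'` with continuous coefficients, which is what controls tangency to the wave surface. -/
theorem geodesicField_backgroundMetric {Λ : ℝ} {x : Coord} (hx : bigOmega Λ x ≠ 0) (v : Coord) :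
    (geodesicField (backgroundMetric Λ) (x, v)).2 =
      (2 * (Λ / 6 * lorentz x v) / bigOmega Λ x) • v
        - (Λ / 6 * lorentz v v / bigOmega Λ x) • x := by
  have hy : x ∈ plusDomain Λ 0 univ := by rw [plusDomain_zero]; exact hx
  have hb := isProfile_zero.contDiffAt_plusMetric hy
  have hdet := det_plusMetric_ne_zero hy
  rw [plusMetric_zero] at hb hdet
  obtain ⟨L, hL, hL'⟩ := hasFDerivAt_bigOmega Λ x
  have hder : ∀ v u d : Coord, fderiv ℝ (fun y => metricForm (backgroundMetric Λ) y v u) x d =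
      -2 * (Λ / 6 * lorentz x d) / bigOmega Λ x ^ 3 * lorentz v u := by
    intro v u d
    simp only [metricForm_backgroundMetric]
    have h : HasFDerivAt (fun y => (bigOmega Λ y ^ 2)⁻¹ * lorentz v u) _ x :=
      ((hasDerivAt_inv (pow_ne_zero 2 hx)).comp_hasFDerivAt x (hL.pow 2)).mul_const (lorentz v u)
    rw [h.fderiv]
    simp [hL']
    field_simp
  refine sub_eq_zero.1 (eq_zero_of_metricForm_right hdet fun u => ?_)
  rw [metricForm_sub_right, metricForm_geodesicField
    (fun i j => (hb i j).differentiableAt (by simp)) hdet, hder, hder, metricForm_backgroundMetric]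
  simp [lorentz]
  field_simp
  ring

/-! ### The wave metric on either side of the impulse -/

section Sides

variable (Λ : ℝ) (H : (Fin 2 → ℝ) → ℝ) {x : Coord}

theorem omega_of_nonneg (hx : 0 ≤ x 0) : omega Λ H x = plusOmega Λ H x := by
  simp [omega, plusOmega, kink, hx]

theorem omega_of_nonpos (hx : x 0 ≤ 0) : omega Λ H x = bigOmega Λ x := by
  simp [omega, bigOmega, kink, hx]

theorem spatialMetric_of_nonneg (hx : 0 ≤ x 0) : spatialMetric H x = plusSpatialMetric H x := by
  ext i j
  simp [spatialMetric, plusSpatialMetric, kink, hx]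

theorem spatialMetric_of_nonpos (hx : x 0 ≤ 0) : spatialMetric H x = plusSpatialMetric 0 x := by
  rw [plusSpatialMetric_zero]
  ext i j
  simp [spatialMetric, kink, hx, Matrix.one_apply]

/-- This and the next lemma both apply at `x 0 = 0`: the two smooth metrics coincide on the wave
surface. -/
theorem waveMetric_of_nonneg (hx : 0 ≤ x 0) : waveMetric Λ H x = plusMetric Λ H x := by
  simp only [waveMetric, plusMetric, omega_of_nonneg Λ H hx, spatialMetric_of_nonneg H hx]

theorem waveMetric_of_nonpos (hx : x 0 ≤ 0) : waveMetric Λ H x = plusMetric Λ 0 x := by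
  simp only [waveMetric, plusMetric, omega_of_nonpos Λ H hx, spatialMetric_of_nonpos H hx,
    plusOmega_zero]

/-- The inequality is strict because `Θ 0 = 0`; on the wave surface itself `toConformal` takes the
values of the front side. -/
theorem toConformal_of_pos (hx : 0 < x 0) : toConformal H x = plusMap H x := by
  simp [toConformal, plusMap, kink, heaviside, hx, hx.le]

theorem toConformal_of_nonpos (hx : x 0 ≤ 0) : toConformal H x = plusMap 0 x := by
  rw [plusMap_zero]
  funext i
  fin_cases i <;> simp [toConformal, kink, heaviside, hx, not_lt.2 hx]

end Sides

/-! ### Solutions of `y'' = -κ y` -/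

/-- The solution of `y'' = -κ y`, `y 0 = 1`, `y' 0 = 0`. -/
def gencos (κ t : ℝ) : ℝ :=
  if 0 < κ then Real.cos (√κ * t) else if κ < 0 then Real.cosh (√(-κ) * t) else 1

/-- The solution of `y'' = -κ y`, `y 0 = 0`, `y' 0 = 1`. -/
def gensin (κ t : ℝ) : ℝ :=
  if 0 < κ then Real.sin (√κ * t) / √κ else if κ < 0 then Real.sinh (√(-κ) * t) / √(-κ) else t

theorem gencos_zero (κ : ℝ) : gencos κ 0 = 1 := by simp [gencos]

theorem gensin_zero (κ : ℝ) : gensin κ 0 = 0 := by simp [gensin]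

theorem hasDerivAt_gencos (κ t : ℝ) : HasDerivAt (gencos κ) (-κ * gensin κ t) t := by
  rcases lt_trichotomy κ 0 with h | h | h
  · have h1 : ¬ 0 < κ := h.le.not_gt
    have h2 : √(-κ) ^ 2 = -κ := Real.sq_sqrt (by linarith)
    have h3 : √(-κ) ≠ 0 := (Real.sqrt_pos.2 (by linarith)).ne'
    rw [show gencos κ = fun t => Real.cosh (√(-κ) * t) from funext fun t => by simp [gencos, h, h1]]
    refine (((hasDerivAt_id t).const_mul √(-κ)).cosh).congr_deriv ?_
    simp only [gensin, h1, h, if_true, if_false, id]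
    field_simp
    rw [h2]
    ring
  · subst h
    rw [show gencos 0 = fun t => 1 from funext fun t => by simp [gencos]]
    simpa using hasDerivAt_const t (1 : ℝ)
  · have h2 : √κ ^ 2 = κ := Real.sq_sqrt h.le
    have h3 : √κ ≠ 0 := (Real.sqrt_pos.2 h).ne'
    rw [show gencos κ = fun t => Real.cos (√κ * t) from funext fun t => by simp [gencos, h]]
    refine (((hasDerivAt_id t).const_mul √κ).cos).congr_deriv ?_
    simp only [gensin, h, if_true, id]
    field_simp
    rw [h2]
    ring

theorem hasDerivAt_gensin (κ t : ℝ) : HasDerivAt (gensin κ) (gencos κ t) t := by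
  rcases lt_trichotomy κ 0 with h | h | h
  · have h1 : ¬ 0 < κ := h.le.not_gt
    have h3 : √(-κ) ≠ 0 := (Real.sqrt_pos.2 (by linarith)).ne'
    rw [show gensin κ = fun t => Real.sinh (√(-κ) * t) / √(-κ) from
      funext fun t => by simp [gensin, h, h1]]
    refine ((((hasDerivAt_id t).const_mul √(-κ)).sinh).div_const _).congr_deriv ?_
    simp only [gencos, h1, h, if_true, if_false, id]
    field_simp
  · subst h
    rw [show gensin 0 = fun t => t from funext fun t => by simp [gensin]]
    exact (hasDerivAt_id t).congr_deriv (by simp [gencos])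
  · have h3 : √κ ≠ 0 := (Real.sqrt_pos.2 h).ne'
    rw [show gensin κ = fun t => Real.sin (√κ * t) / √κ from
      funext fun t => by simp [gensin, h]]
    refine ((((hasDerivAt_id t).const_mul √κ).sin).div_const _).congr_deriv ?_
    simp only [gencos, h, if_true, id]
    field_simp

/-- Conservation of energy for `y'' = -κ y`, uniformly in the sign of `κ`. -/
theorem gencos_sq_add (κ t : ℝ) : gencos κ t ^ 2 + κ * gensin κ t ^ 2 = 1 := by
  have h : ∀ t, HasDerivAt (fun t => gencos κ t ^ 2 + κ * gensin κ t ^ 2) 0 t := fun t =>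
    (((hasDerivAt_gencos κ t).pow 2).add (((hasDerivAt_gensin κ t).pow 2).const_mul κ)).congr_deriv
      (by ring)
  have := is_const_of_deriv_eq_zero (fun t => (h t).differentiableAt) (fun t => (h t).deriv) t 0
  simpa [gencos_zero, gensin_zero] using this

/-- The derivative at `0` is `1`, so `0` is an isolated zero. The radius depends on `κ` only; it
becomes the lower bound for the time between two crossings. -/
theorem exists_gensin_ne_zero (κ : ℝ) : ∃ r > 0, ∀ t, 0 < t → t < r → gensin κ t ≠ 0 := by
  have h := (hasDerivAt_gensin κ 0).eventually_ne (c := gensin κ 0) (by simp [gencos_zero])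
  rw [gensin_zero] at h
  obtain ⟨r, hr, H⟩ := Metric.mem_nhdsWithin_iff.1 h
  refine ⟨r, hr, fun t h1 h2 => H ⟨?_, h1.ne'⟩⟩
  simp [abs_of_pos h1, h2]

/-! ### Geodesics of the background as curves in five dimensional space -/

/-- The centre of the hyperboloid. -/
def center : Ambient := ![0, 0, 0, 0, 1 / 2]

/-- The quadratic form defining the hyperboloid, `Λ/12` times the ambient metric. -/
def ambientForm (Λ : ℝ) (A B : Ambient) : ℝ :=
  A 4 * B 4 + Λ / 12 * (A 2 * B 2 + A 3 * B 3 - A 0 * B 1 - A 1 * B 0)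

/-- Completing the square in `s` centres the quadric at `s = 1/2`. For `Λ = 0` the equation leaves
the hyperplanes `s = 0` and `s = 1`, and the second condition selects the latter. -/
theorem mem_background_iff {Λ : ℝ} {Z : Ambient} : Z ∈ background Λ ↔
    ambientForm Λ (Z - center) (Z - center) = 1 / 4 ∧ (Λ = 0 → Z 4 = 1) := by
  simp only [background, mem_ofPred_eq, ambientForm, center]
  refine and_congr_left fun _ => ?_
  simp
  constructor <;> intro h <;> linarith

/-- `Q` is tangent to the background at `P`. -/
def IsTangent (Λ : ℝ) (P Q : Ambient) : Prop :=
  ambientForm Λ (P - center) Q = 0 ∧ (Λ = 0 → Q 4 = 0)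

/-- The constant `κ` in the geodesic equation `Z'' = -κ (Z - center)`. -/
def curvature (Λ : ℝ) (Q : Ambient) : ℝ := 4 * ambientForm Λ Q Q

/-- `Z` is a geodesic of the background on `J`, with velocity `Z'`. -/
def IsBackgroundGeodesic (Λ : ℝ) (J : Set ℝ) (Z Z' : ℝ → Ambient) : Prop :=
  ∀ t ∈ J, Z t ∈ background Λ ∧ IsTangent Λ (Z t) (Z' t) ∧ HasDerivAt Z (Z' t) t ∧
    HasDerivAt Z' (-curvature Λ (Z' t) • (Z t - center)) t

/-- The background geodesic with initial data `P`, `Q`. -/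
def flow (κ : ℝ) (P Q : Ambient) (t : ℝ) : Ambient :=
  center + (gencos κ t • (P - center) + gensin κ t • Q)

/-- The velocity of `flow`. -/
def flowVel (κ : ℝ) (P Q : Ambient) (t : ℝ) : Ambient :=
  (-κ * gensin κ t) • (P - center) + gencos κ t • Q

theorem ambientForm_add_smul (Λ a b c d : ℝ) (A B : Ambient) :
    ambientForm Λ (a • A + b • B) (c • A + d • B) =
      a * c * ambientForm Λ A A + (a * d + b * c) * ambientForm Λ A B
        + b * d * ambientForm Λ B B := by
  simp [ambientForm]; ring

/-- Differentiating the equation of the quadric twice forces `κ = 4 ambientForm Λ Q Q`. With this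
value the curve stays on the quadric by `gencos_sq_add`. For `Λ = 0` the tangency condition gives `κ
= 0`, a straight line. In every case the curve is defined for all times: the background is complete.
-/
theorem isBackgroundGeodesic_flow {Λ : ℝ} {P Q : Ambient} (hP : P ∈ background Λ)
    (hQ : IsTangent Λ P Q) (a : ℝ) : IsBackgroundGeodesic Λ univ
      (fun t => flow (curvature Λ Q) P Q (t - a)) (fun t => flowVel (curvature Λ Q) P Q (t - a)) := by
  intro t _
  set κ := curvature Λ Q with hκ
  have hs := gencos_sq_add κ (t - a)
  rw [mem_background_iff] at hP
  have hQQ : ambientForm Λ Q Q = κ / 4 := by rw [hκ, curvature]; ring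
  have hcv : curvature Λ (flowVel κ P Q (t - a)) = κ := by
    rw [curvature, flowVel, ambientForm_add_smul, hP.1, hQ.1, hQQ]
    linear_combination κ * hs
  have hc : HasDerivAt (fun t => gencos κ (t - a)) (-κ * gensin κ (t - a)) t :=
    (hasDerivAt_gencos κ (t - a)).comp_sub_const t a
  have hsn : HasDerivAt (fun t => gensin κ (t - a)) (gencos κ (t - a)) t :=
    (hasDerivAt_gensin κ (t - a)).comp_sub_const t a
  refine ⟨?_, ?_, ?_, ?_⟩
  · rw [mem_background_iff]
    refine ⟨?_, fun hΛ => ?_⟩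
    · simp only [flow, add_sub_cancel_left]
      rw [ambientForm_add_smul, hP.1, hQ.1, hQQ]
      linear_combination hs / 4
    · have h1 := hP.2 hΛ
      have h2 := hQ.2 hΛ
      have h3 : κ = 0 := by rw [hκ, curvature, ambientForm, h2, hΛ]; ring
      have h5 : center 4 = 1 / 2 := rfl
      simp only [flow, Pi.add_apply, Pi.smul_apply, Pi.sub_apply, smul_eq_mul, h1, h2, h3, h5]
      norm_num [gencos]
  · refine ⟨?_, fun hΛ => ?_⟩
    · simp only [flow, flowVel, add_sub_cancel_left]
      rw [ambientForm_add_smul, hP.1, hQ.1, hQQ]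
      ring
    · have h2 := hQ.2 hΛ
      have h3 : κ = 0 := by rw [hκ, curvature, ambientForm, h2, hΛ]; ring
      simp [flowVel, h2, h3]
  · exact ((hc.smul_const (P - center)).add (hsn.smul_const Q)).const_add center
  · refine (((hsn.const_mul (-κ)).smul_const (P - center)).add
      (hc.smul_const Q)).congr_deriv ?_
    rw [hcv]
    simp only [flow, add_sub_cancel_left]
    module

namespace IsBackgroundGeodesic

variable {Λ : ℝ} {J : Set ℝ} {Z Z' : ℝ → Ambient}

theorem mono {J' : Set ℝ} (h : IsBackgroundGeodesic Λ J Z Z') (hJ : J' ⊆ J) :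
    IsBackgroundGeodesic Λ J' Z Z' := fun t ht => h t (hJ ht)

theorem congr {Y Y' : ℝ → Ambient} (h : IsBackgroundGeodesic Λ J Z Z') (hJ : IsOpen J)
    (hY : EqOn Y Z J) (hY' : EqOn Y' Z' J) : IsBackgroundGeodesic Λ J Y Y' := by
  intro t ht
  obtain ⟨h1, h2, h3, h4⟩ := h t ht
  rw [← hY ht] at h1
  rw [← hY ht, ← hY' ht] at h2
  rw [← hY' ht] at h3
  rw [← hY ht, ← hY' ht] at h4
  exact ⟨h1, h2, h3.congr_of_eventuallyEq (hY.eventuallyEq_of_mem (hJ.mem_nhds ht)),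
    h4.congr_of_eventuallyEq (hY'.eventuallyEq_of_mem (hJ.mem_nhds ht))⟩

/-- The derivative of the form on `(Z', Z')` is a multiple of its value on `(Z - center, Z')`, which
vanishes by tangency. -/
theorem curvature_eq (h : IsBackgroundGeodesic Λ J Z Z') (hJ : IsOpen J) (hJ' : J.OrdConnected)
    {a t : ℝ} (ha : a ∈ J) (ht : t ∈ J) : curvature Λ (Z' t) = curvature Λ (Z' a) := by
  have hd : ∀ t ∈ J, HasDerivAt (fun t => curvature Λ (Z' t)) 0 t := by
    intro t ht
    obtain ⟨-, h2, -, h4⟩ := h t ht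
    have hc := fun i => hasDerivAt_pi.1 h4 i
    have := (((hc 4).mul (hc 4)).add (((((hc 2).mul (hc 2)).add ((hc 3).mul (hc 3))).sub
      ((hc 0).mul (hc 1))).sub ((hc 1).mul (hc 0)) |>.const_mul (Λ / 12))).const_mul 4
    refine this.congr_deriv ?_
    have h5 := h2.1
    simp only [ambientForm] at h5
    simp only [Pi.smul_apply, smul_eq_mul]
    linear_combination (-8 * curvature Λ (Z' t)) * h5
  exact hJ.is_const_of_deriv_eq_zero hJ'.isPreconnected
    (fun t ht => (hd t ht).differentiableAt.differentiableWithinAt)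
    (fun t ht => (hd t ht).deriv) ht ha

/-- Background geodesics are given by `flow`. -/
theorem eq_flow (h : IsBackgroundGeodesic Λ J Z Z') (hJ : IsOpen J) (hJ' : J.OrdConnected)
    {a t : ℝ} (ha : a ∈ J) (ht : t ∈ J) :
    Z t = flow (curvature Λ (Z' a)) (Z a) (Z' a) (t - a) ∧
      Z' t = flowVel (curvature Λ (Z' a)) (Z a) (Z' a) (t - a) := by
  set κ := curvature Λ (Z' a) with hκ
  have hc : ∀ t, HasDerivAt (fun t => gencos κ (t - a)) (-κ * gensin κ (t - a)) t := fun t =>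
    (hasDerivAt_gencos κ (t - a)).comp_sub_const t a
  have hsn : ∀ t, HasDerivAt (fun t => gensin κ (t - a)) (gencos κ (t - a)) t := fun t =>
    (hasDerivAt_gensin κ (t - a)).comp_sub_const t a
  have hz : ∀ t ∈ J, HasDerivAt Z (Z' t) t ∧ HasDerivAt Z' (-κ • (Z t - center)) t :=
    fun t ht => by
      obtain ⟨-, -, h3, h4⟩ := h t ht
      rw [h.curvature_eq hJ hJ' ha ht] at h4
      exact ⟨h3, h4⟩
  -- `hA` and `hB` apply the inverse of the fundamental solution to `(Z - center, Z')`, which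
  -- recovers the initial data and is therefore constant.
  have hA : ∀ t ∈ J, HasDerivAt (fun t => gencos κ (t - a) • (Z t - center)
      - gensin κ (t - a) • Z' t) 0 t := fun t ht => by
    refine (((hc t).smul ((hz t ht).1.sub_const center)).sub
      ((hsn t).smul (hz t ht).2)).congr_deriv ?_
    module
  have hB : ∀ t ∈ J, HasDerivAt (fun t => (κ * gensin κ (t - a)) • (Z t - center)
      + gencos κ (t - a) • Z' t) 0 t := fun t ht => by
    refine ((((hsn t).const_mul κ).smul ((hz t ht).1.sub_const center)).add
      ((hc t).smul (hz t ht).2)).congr_deriv ?_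
    module
  have eA := hJ.is_const_of_deriv_eq_zero hJ'.isPreconnected
    (fun t ht => (hA t ht).differentiableAt.differentiableWithinAt)
    (fun t ht => (hA t ht).deriv) ht ha
  have eB := hJ.is_const_of_deriv_eq_zero hJ'.isPreconnected
    (fun t ht => (hB t ht).differentiableAt.differentiableWithinAt)
    (fun t ht => (hB t ht).deriv) ht ha
  simp only [sub_self, gencos_zero, gensin_zero, one_smul, zero_smul, sub_zero, mul_zero,
    zero_add] at eA eB
  have hs := gencos_sq_add κ (t - a)
  constructor
  · rw [flow, ← eA, ← eB, ← sub_eq_iff_eq_add']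
    have : (gencos κ (t - a) ^ 2 + κ * gensin κ (t - a) ^ 2) • (Z t - center) = Z t - center := by
      rw [hs, one_smul]
    conv_lhs => rw [← this]
    module
  · rw [flowVel, ← eA, ← eB]
    have : (gencos κ (t - a) ^ 2 + κ * gensin κ (t - a) ^ 2) • Z' t = Z' t := by
      rw [hs, one_smul]
    conv_lhs => rw [← this]
    module

theorem eqOn {Y Y' : ℝ → Ambient} (h : IsBackgroundGeodesic Λ J Z Z')
    (hY : IsBackgroundGeodesic Λ J Y Y') (hJ : IsOpen J) (hJ' : J.OrdConnected) {a : ℝ}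
    (ha : a ∈ J) (h0 : Z a = Y a) (h1 : Z' a = Y' a) : EqOn Z Y J ∧ EqOn Z' Y' J := by
  refine ⟨fun t ht => ?_, fun t ht => ?_⟩
  · rw [(h.eq_flow hJ hJ' ha ht).1, (hY.eq_flow hJ hJ' ha ht).1, h0, h1]
  · rw [(h.eq_flow hJ hJ' ha ht).2, (hY.eq_flow hJ hJ' ha ht).2, h0, h1]

end IsBackgroundGeodesic

/-! ### Conformally flat coordinates -/

/-- The derivative of `stereo` at `y` in the direction `v`. -/
def stereoVel (Λ : ℝ) (y v : Coord) : Ambient :=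
  (bigOmega Λ y)⁻¹ • ![v 0, v 1, v 2, v 3, 0]
    - (Λ / 6 * lorentz y v / bigOmega Λ y ^ 2) • ![y 0, y 1, y 2, y 3, 1]

theorem hasFDerivAt_stereo {Λ : ℝ} {y : Coord} (hy : bigOmega Λ y ≠ 0) :
    ∃ L : Coord →L[ℝ] Ambient, HasFDerivAt (stereo Λ) L y ∧ ∀ v, L v = stereoVel Λ y v := by
  obtain ⟨L, hL, hL'⟩ := hasFDerivAt_bigOmega Λ y
  have h1 : HasFDerivAt (fun y : Coord => (![y 0, y 1, y 2, y 3, 1] : Ambient))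
      (ContinuousLinearMap.pi (![.proj 0, .proj 1, .proj 2, .proj 3, 0] :
        Fin 5 → Coord →L[ℝ] ℝ)) y := by
    rw [hasFDerivAt_pi']
    have hc : ∀ i : Fin 4, HasFDerivAt (fun y : Coord => y i)
        (ContinuousLinearMap.proj (R := ℝ) (φ := fun _ : Fin 4 => ℝ) i) y :=
      fun i => hasFDerivAt_apply i y
    intro i
    fin_cases i
    · exact hc 0
    · exact hc 1
    · exact hc 2
    · exact hc 3
    · exact hasFDerivAt_const 1 y
  have h2 : HasFDerivAt (stereo Λ) _ y := ((hasDerivAt_inv hy).comp_hasFDerivAt y hL).smul h1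
  refine ⟨_, h2, fun v => ?_⟩
  funext i
  fin_cases i <;> simp [stereoVel, hL'] <;> ring

theorem stereo_mem_background {Λ : ℝ} {y : Coord} (hy : bigOmega Λ y ≠ 0) :
    stereo Λ y ∈ background Λ := by
  have h := bigOmega_eq Λ y
  refine ⟨?_, fun hΛ => ?_⟩
  · simp [stereo]
    field_simp
    simp only [lorentz] at h
    linear_combination -12 * h
  · simp [stereo, bigOmega, hΛ]

theorem isTangent_stereoVel {Λ : ℝ} {y : Coord} (hy : bigOmega Λ y ≠ 0) (v : Coord) :
    IsTangent Λ (stereo Λ y) (stereoVel Λ y v) := by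
  have h := bigOmega_eq Λ y
  refine ⟨?_, fun hΛ => ?_⟩
  · simp [ambientForm, stereo, stereoVel, center]
    field_simp
    simp only [lorentz] at h ⊢
    linear_combination (24 * (Λ * (v 2 * y 2 + v 3 * y 3 - v 0 * y 1 - v 1 * y 0))) * h
  · simp [stereoVel, hΛ]

/-- The coordinates are isometric up to the factor `Λ/12` in `ambientForm`, so `κ` is intrinsic.
This makes it possible to compare `κ` before and after an impulse. -/
theorem curvature_stereoVel {Λ : ℝ} {y : Coord} (hy : bigOmega Λ y ≠ 0) (v : Coord) :
    curvature Λ (stereoVel Λ y v) = Λ / 3 * metricForm (backgroundMetric Λ) y v v := by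
  have h := bigOmega_eq Λ y
  rw [metricForm_backgroundMetric]
  simp [curvature, ambientForm, stereoVel]
  field_simp
  simp only [lorentz] at h ⊢
  linear_combination (-144 * Λ ^ 2 * (y 2 * v 2 + y 3 * v 3 - y 0 * v 1 - y 1 * v 0) ^ 2) * h

/-- The geodesic equation becomes linear in the ambient space. The fifth component of `stereo` is
`1/Ω` and the others are `y i/Ω`, so only the first two derivatives of `Ω` along the curve are
needed. -/
theorem hasDerivAt_stereoVel {Λ : ℝ} {y v : ℝ → Coord} {t : ℝ} (hy : bigOmega Λ (y t) ≠ 0)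
    (h1 : HasDerivAt y (v t) t)
    (h2 : HasDerivAt v (geodesicField (backgroundMetric Λ) (y t, v t)).2 t) :
    HasDerivAt (fun t => stereoVel Λ (y t) (v t))
      (-curvature Λ (stereoVel Λ (y t) (v t)) • (stereo Λ (y t) - center)) t := by
  rw [geodesicField_backgroundMetric hy] at h2
  obtain ⟨L, hL, hL'⟩ := hasFDerivAt_bigOmega Λ (y t)
  set O := bigOmega Λ (y t) with hO
  have hOd : HasDerivAt (fun t => bigOmega Λ (y t)) (Λ / 6 * lorentz (y t) (v t)) t := by
    rw [← hL']; exact hL.comp_hasDerivAt t h1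
  have hy' := fun i => hasDerivAt_pi.1 h1 i
  have hv' := fun i => hasDerivAt_pi.1 h2 i
  set p := Λ / 6 * lorentz (y t) (v t) with hp
  set e := lorentz (v t) (v t) with he
  have hOm := bigOmega_eq Λ (y t)
  rw [← hO] at hOm
  -- `p` is the derivative of `Ω` along the curve. Its own derivative follows from the acceleration
  -- and `Λ/6 * lorentz y y = 2 (Ω - 1)`.
  have hpd : HasDerivAt (fun t => Λ / 6 * lorentz (y t) (v t))
      (Λ / 6 * e * (2 / O - 1) + 2 * p ^ 2 / O) t := by
    have := (((((hy' 2).mul (hv' 2)).add ((hy' 3).mul (hv' 3))).sub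
      ((hy' 0).mul (hv' 1))).sub ((hy' 1).mul (hv' 0))).const_mul (Λ / 6)
    refine this.congr_deriv ?_
    have e1 : lorentz (v t) (v t) = e := rfl
    have e2 : Λ / 6 * lorentz (y t) (v t) = p := rfl
    simp only [Pi.sub_apply, Pi.smul_apply, smul_eq_mul]
    have hl : Λ / 6 * lorentz (y t) (y t) = 2 * (O - 1) := by rw [hOm]; ring
    simp only [lorentz] at e1 e2 hl
    field_simp
    field_simp at e1 e2 hl
    linear_combination 6 * Λ * O * e1 + 12 * p * e2 - Λ * e * hl
  have hκ : curvature Λ (stereoVel Λ (y t) (v t)) = Λ / 3 * e / O ^ 2 := by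
    rw [curvature_stereoVel hy, metricForm_backgroundMetric, ← hO, ← he]; field_simp
  rw [hκ]
  have main : ∀ i : Fin 4, HasDerivAt (fun t => (bigOmega Λ (y t))⁻¹ * v t i
      - (Λ / 6 * lorentz (y t) (v t) / bigOmega Λ (y t) ^ 2) * y t i)
      (-(Λ / 3 * e / O ^ 2) * (O⁻¹ * y t i)) t := fun i => by
    refine (((hOd.inv hy).mul (hv' i)).sub ((hpd.div (hOd.pow 2) (pow_ne_zero 2 hy)).mul
      (hy' i))).congr_deriv ?_
    simp only [Pi.sub_apply, Pi.smul_apply, Pi.pow_apply, Pi.div_apply, smul_eq_mul, ← hO, ← hp,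
      Pi.inv_apply]
    field_simp
    ring
  rw [hasDerivAt_pi]
  intro i
  fin_cases i
  · simpa [stereoVel, stereo, center] using main 0
  · simpa [stereoVel, stereo, center] using main 1
  · simpa [stereoVel, stereo, center] using main 2
  · simpa [stereoVel, stereo, center] using main 3
  · have : HasDerivAt (fun t => -(Λ / 6 * lorentz (y t) (v t) / bigOmega Λ (y t) ^ 2))
      (-(Λ / 3 * e / O ^ 2) * (O⁻¹ - 1 / 2)) t := by
      refine (hpd.div (hOd.pow 2) (pow_ne_zero 2 hy)).neg.congr_deriv ?_
      simp only [Pi.pow_apply, ← hO, ← hp]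
      field_simp
      ring
    simpa [stereoVel, stereo, center] using this

/-- Solutions of the geodesic equation of `plusMetric Λ H` are geodesics of the background. -/
theorem IsProfile.isBackgroundGeodesic {Λ : ℝ} {H : (Fin 2 → ℝ) → ℝ} {R : Set (Fin 2 → ℝ)}
    (hH : IsProfile H R) {J : Set ℝ} {w : ℝ → Phase}
    (hw : ∀ t ∈ J, (w t).1 ∈ plusDomain Λ H R ∧
      HasDerivAt w (geodesicField (plusMetric Λ H) (w t)) t) :
    IsBackgroundGeodesic Λ J (fun t => stereo Λ (plusMap H (w t).1))
      (fun t => stereoVel Λ (plusMap H (w t).1) (fderiv ℝ (plusMap H) (w t).1 (w t).2)) := by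
  intro t ht
  obtain ⟨hm, hd⟩ := hw t ht
  have hO := bigOmega_plusMap_ne_zero hm
  have hx : HasDerivAt (fun t => (w t).1) (w t).2 t := hd.fst
  have hv : HasDerivAt (fun t => (w t).2) (geodesicField (plusMetric Λ H) (w t)).2 t := hd.snd
  have hs := hH.contDiffAt_plusMap hm.2.2
  have hφ1 : DifferentiableAt ℝ (plusMap H) (w t).1 := hs.differentiableAt (by simp)
  have hy : HasDerivAt (fun t => plusMap H (w t).1) (fderiv ℝ (plusMap H) (w t).1 (w t).2) t :=
    hφ1.hasFDerivAt.comp_hasDerivAt (f := fun t => (w t).1) t hx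
  have hφ2 : DifferentiableAt ℝ (fderiv ℝ (plusMap H)) (w t).1 :=
    (hs.fderiv_right (m := 1) two_le_infty).differentiableAt (by norm_num)
  have hu : HasDerivAt (fun t => fderiv ℝ (plusMap H) (w t).1 (w t).2)
      (geodesicField (backgroundMetric Λ)
        (plusMap H (w t).1, fderiv ℝ (plusMap H) (w t).1 (w t).2)).2 t := by
    have h2 : HasDerivAt (fun t => fderiv ℝ (plusMap H) (w t).1)
        (fderiv ℝ (fderiv ℝ (plusMap H)) (w t).1 (w t).2) t :=
      hφ2.hasFDerivAt.comp_hasDerivAt (f := fun t => (w t).1) t hx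
    refine (h2.clm_apply hv).congr_deriv ?_
    rw [← hH.fderiv_plusMap_geodesicField hm, add_comm]
  obtain ⟨L, hL, hL'⟩ := hasFDerivAt_stereo hO
  refine ⟨stereo_mem_background hO, isTangent_stereoVel hO _, ?_, hasDerivAt_stereoVel hO hy hu⟩
  beta_reduce
  rw [← hL']
  exact hL.comp_hasDerivAt (f := fun t => plusMap H (w t).1) t hy

/-- The last component `1/Ω` determines `Ω`, and then the others determine the coordinates. -/
theorem stereo_injOn {Λ : ℝ} {y y' : Coord} (hy : bigOmega Λ y ≠ 0) (h : stereo Λ y = stereo Λ y') :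
    y = y' := by
  have h4 : (bigOmega Λ y)⁻¹ = (bigOmega Λ y')⁻¹ := by simpa [stereo] using congrFun h 4
  funext i
  have hi : (bigOmega Λ y)⁻¹ * y i = (bigOmega Λ y')⁻¹ * y' i := by
    fin_cases i
    · simpa [stereo] using congrFun h 0
    · simpa [stereo] using congrFun h 1
    · simpa [stereo] using congrFun h 2
    · simpa [stereo] using congrFun h 3
  rw [← h4] at hi
  exact mul_left_cancel₀ (inv_ne_zero hy) hi

theorem stereoVel_injective {Λ : ℝ} {y v v' : Coord} (hy : bigOmega Λ y ≠ 0)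
    (h : stereoVel Λ y v = stereoVel Λ y v') : v = v' := by
  have h4 : Λ / 6 * lorentz y v / bigOmega Λ y ^ 2 = Λ / 6 * lorentz y v' / bigOmega Λ y ^ 2 := by
    have := congrFun h 4
    simp only [stereoVel, Pi.sub_apply, Pi.smul_apply, smul_eq_mul] at this
    simpa using this
  funext i
  have hi : (bigOmega Λ y)⁻¹ * v i = (bigOmega Λ y)⁻¹ * v' i := by
    simp only [stereoVel, h4] at h
    fin_cases i
    · simpa using congrFun (sub_left_injective h) 0
    · simpa using congrFun (sub_left_injective h) 1
    · simpa using congrFun (sub_left_injective h) 2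
    · simpa using congrFun (sub_left_injective h) 3
  exact mul_left_cancel₀ (inv_ne_zero hy) hi

/-- Initial data in the background, off `s = 0`, in conformally flat coordinates. -/
theorem exists_stereo_eq {Λ : ℝ} {P Q : Ambient} (hP : P ∈ background Λ) (hQ : IsTangent Λ P Q)
    (h4 : P 4 ≠ 0) : ∃ y v : Coord, bigOmega Λ y ≠ 0 ∧ stereo Λ y = P ∧ stereoVel Λ y v = Q := by
  set s := P 4 with hs
  -- The coordinates are the ratios `P i/s`, and `v` is their derivative by the quotient rule; the
  -- equation of the quadric gives `Ω = 1/s`.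
  set y : Coord := ![P 0 / s, P 1 / s, P 2 / s, P 3 / s] with hy
  set v : Coord := ![Q 0 / s - P 0 * Q 4 / s ^ 2, Q 1 / s - P 1 * Q 4 / s ^ 2,
    Q 2 / s - P 2 * Q 4 / s ^ 2, Q 3 / s - P 3 * Q 4 / s ^ 2] with hv
  have hO : bigOmega Λ y = 1 / s := by
    have h1 := hP.1
    rw [← hs] at h1
    simp [bigOmega, hy]
    field_simp
    linear_combination 12 * h1
  have hp : Λ / 6 * lorentz y v = -Q 4 / s ^ 2 := by
    have h1 := hP.1
    have h2 := hQ.1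
    simp [ambientForm, center] at h2
    rw [← hs] at h1 h2
    simp [lorentz, hy, hv]
    field_simp
    linear_combination 12 * s * h2 - 12 * Q 4 * h1
  refine ⟨y, v, by rw [hO]; exact one_div_ne_zero h4, ?_, ?_⟩
  · rw [stereo, hO]
    funext i
    fin_cases i <;> simp [hy, ← hs] <;> field_simp
  · rw [stereoVel, hO, hp]
    funext i
    fin_cases i <;> simp [hy, hv] <;> field_simp <;> ring

/-! ### The reflection of the background -/

/-- The reflection `Z₄ ↦ -Z₄`. -/
def reflect (Z : Ambient) : Ambient := ![Z 0, Z 1, Z 2, Z 3, 1 - Z 4]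

/-- The derivative of `reflect`. -/
def reflectVel : Ambient →L[ℝ] Ambient :=
  ContinuousLinearMap.pi (![.proj 0, .proj 1, .proj 2, .proj 3, -.proj 4] :
    Fin 5 → Ambient →L[ℝ] ℝ)

theorem reflectVel_apply (Q : Ambient) : reflectVel Q = ![Q 0, Q 1, Q 2, Q 3, -Q 4] := by
  funext i; fin_cases i <;> rfl

theorem reflect_eq (Z : Ambient) : reflect Z = reflectVel Z + ![0, 0, 0, 0, 1] := by
  rw [reflectVel_apply]
  funext i; fin_cases i <;> simp [reflect]; ring

theorem reflect_sub_center (Z : Ambient) : reflect Z - center = reflectVel (Z - center) := by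
  rw [reflectVel_apply]
  funext i; fin_cases i <;> simp [reflect, center]; ring

theorem reflect_reflect (Z : Ambient) : reflect (reflect Z) = Z := by
  funext i; fin_cases i <;> simp [reflect]

theorem reflectVel_reflectVel (Z : Ambient) : reflectVel (reflectVel Z) = Z := by
  rw [reflectVel_apply, reflectVel_apply]
  funext i; fin_cases i <;> simp

theorem ambientForm_reflectVel (Λ : ℝ) (A B : Ambient) :
    ambientForm Λ (reflectVel A) (reflectVel B) = ambientForm Λ A B := by
  simp [reflectVel_apply, ambientForm]

theorem stereoReflected_eq {Λ : ℝ} {y : Coord} (hy : bigOmega Λ y ≠ 0) :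
    stereoReflected Λ y = reflect (stereo Λ y) := by
  funext i
  fin_cases i <;> simp [stereoReflected, stereo, reflect]
  field_simp

/-- For `Λ = 0` the reflection moves the hyperplane `s = 1` to `s = 0`, which is why this case is
excluded. -/
theorem reflect_mem_background {Λ : ℝ} (hΛ : Λ ≠ 0) {Z : Ambient} (hZ : Z ∈ background Λ) :
    reflect Z ∈ background Λ := by
  rw [mem_background_iff] at hZ ⊢
  rw [reflect_sub_center, ambientForm_reflectVel]
  exact ⟨hZ.1, fun h => absurd h hΛ⟩

theorem IsTangent.reflect {Λ : ℝ} (hΛ : Λ ≠ 0) {P Q : Ambient} (h : IsTangent Λ P Q) :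
    IsTangent Λ (reflect P) (reflectVel Q) := by
  refine ⟨?_, fun h => absurd h hΛ⟩
  rw [reflect_sub_center, ambientForm_reflectVel]
  exact h.1

theorem IsBackgroundGeodesic.reflect {Λ : ℝ} (hΛ : Λ ≠ 0) {J : Set ℝ} {Z Z' : ℝ → Ambient}
    (h : IsBackgroundGeodesic Λ J Z Z') : IsBackgroundGeodesic Λ J
      (fun t => ImpulsiveWave.reflect (Z t)) (fun t => reflectVel (Z' t)) := by
  intro t ht
  obtain ⟨h1, h2, h3, h4⟩ := h t ht
  refine ⟨reflect_mem_background hΛ h1, h2.reflect hΛ, ?_, ?_⟩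
  · simp only [reflect_eq]
    exact (reflectVel.hasFDerivAt.comp_hasDerivAt t h3).add_const _
  · rw [curvature, ambientForm_reflectVel, ← curvature, reflect_sub_center, ← map_smul]
    exact reflectVel.hasFDerivAt.comp_hasDerivAt t h4

/-! ### The two sides of the impulse -/

/-- `u` is positive or negative. -/
def OnSide (b : Bool) (u : ℝ) : Prop := bif b then 0 < u else u < 0

/-- The profile that enters the metric on the given side. -/
def sideProfile (H : (Fin 2 → ℝ) → ℝ) (b : Bool) : (Fin 2 → ℝ) → ℝ := bif b then H else 0

/-- The set on which `sideProfile` is smooth. -/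
def sideSet (Λ : ℝ) (b : Bool) : Set (Fin 2 → ℝ) := bif b then regularSet Λ else univ

/-- The coordinate domain of the smooth metric of the given side. -/
def sideDomain (Λ : ℝ) (H : (Fin 2 → ℝ) → ℝ) (b : Bool) : Set Coord :=
  plusDomain Λ (sideProfile H b) (sideSet Λ b)

/-- The geodesic equation of the smooth metric of the given side. -/
def sideField (Λ : ℝ) (H : (Fin 2 → ℝ) → ℝ) (b : Bool) : Phase → Phase :=
  geodesicField (plusMetric Λ (sideProfile H b))

theorem OnSide.ne_zero {b : Bool} {u : ℝ} (h : OnSide b u) : u ≠ 0 := by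
  cases b
  · exact ne_of_lt h
  · exact ne_of_gt h

theorem exists_onSide {u : ℝ} (h : u ≠ 0) : ∃ b, OnSide b u :=
  h.lt_or_gt.elim (fun h => ⟨false, h⟩) fun h => ⟨true, h⟩

theorem OnSide.eventually {b : Bool} {u : ℝ} (h : OnSide b u) : ∀ᶠ v in 𝓝 u, OnSide b v := by
  cases b
  · exact Iio_mem_nhds h
  · exact Ioi_mem_nhds h

theorem OnSide.unique {b b' : Bool} {u : ℝ} (h : OnSide b u) (h' : OnSide b' u) : b = b' := by
  cases b <;> cases b' <;> simp only [OnSide, cond_true, cond_false] at h h' ⊢ <;> linarith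

section Side

variable {Λ : ℝ} {H : (Fin 2 → ℝ) → ℝ} {x : Coord} {b : Bool}

theorem isProfile_side (hH : IsProfile H (regularSet Λ)) (b : Bool) :
    IsProfile (sideProfile H b) (sideSet Λ b) := by
  cases b
  · exact isProfile_zero
  · exact hH

theorem mem_sideDomain_of_onSide (hx : x ∈ waveDomain Λ H) (h : OnSide b (x 0)) :
    x ∈ sideDomain Λ H b := by
  cases b
  · have h' : x 0 < 0 := h
    refine ⟨?_, ?_, trivial⟩
    · simpa [sideProfile, plusOmega_zero, ← omega_of_nonpos Λ H h'.le] using hx.1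
    · simp [sideProfile, plusSpatialMetric_zero]
  · have h' : 0 < x 0 := h
    refine ⟨?_, ?_, ?_⟩
    · simpa [sideProfile, ← omega_of_nonneg Λ H h'.le] using hx.1
    · simpa [sideProfile, ← spatialMetric_of_nonneg H h'.le] using hx.2.1
    · exact hx.2.2.resolve_left h'.not_gt

/-- A point of the wave surface lies in the open domains of both smooth metrics, so the smooth
solutions of either side can be started there and run across. -/
theorem mem_sideDomain_of_eq_zero (hx : x ∈ waveDomain Λ H) (h : x 0 = 0) (b : Bool) :
    x ∈ sideDomain Λ H b := by
  cases b
  · refine ⟨?_, ?_, trivial⟩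
    · simpa [sideProfile, plusOmega_zero, ← omega_of_nonpos Λ H h.le] using hx.1
    · simp [sideProfile, plusSpatialMetric_zero]
  · refine ⟨?_, ?_, ?_⟩
    · simpa [sideProfile, ← omega_of_nonneg Λ H h.ge] using hx.1
    · simpa [sideProfile, ← spatialMetric_of_nonneg H h.ge] using hx.2.1
    · exact hx.2.2.resolve_left h.not_lt

theorem mem_waveDomain_of_onSide (hx : x ∈ sideDomain Λ H b) (h : OnSide b (x 0)) :
    x ∈ waveDomain Λ H := by
  cases b
  · have h' : x 0 < 0 := h
    have hx' : x ∈ plusDomain Λ 0 univ := hx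
    refine ⟨?_, ?_, .inl h'⟩
    · simpa [omega_of_nonpos Λ H h'.le, ← plusOmega_zero] using hx'.1
    · simpa [spatialMetric_of_nonpos H h'.le] using hx'.2.1
  · have h' : 0 < x 0 := h
    have hx' : x ∈ plusDomain Λ H (regularSet Λ) := hx
    refine ⟨?_, ?_, .inr hx'.2.2⟩
    · simpa [omega_of_nonneg Λ H h'.le] using hx'.1
    · simpa [spatialMetric_of_nonneg H h'.le] using hx'.2.1

theorem eventually_onSide (h : OnSide b (x 0)) : ∀ᶠ y : Coord in 𝓝 x, OnSide b (y 0) :=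
  (continuous_apply 0).continuousAt.eventually h.eventually

theorem waveMetric_eventuallyEq (h : OnSide b (x 0)) :
    waveMetric Λ H =ᶠ[𝓝 x] plusMetric Λ (sideProfile H b) := by
  filter_upwards [eventually_onSide h] with y hy
  cases b
  · exact waveMetric_of_nonpos Λ H (le_of_lt hy)
  · exact waveMetric_of_nonneg Λ H (le_of_lt hy)

theorem geodesicField_waveMetric {w : Phase} (h : OnSide b (w.1 0)) :
    geodesicField (waveMetric Λ H) =ᶠ[𝓝 w] sideField Λ H b :=
  geodesicField_eventuallyEq (waveMetric_eventuallyEq h)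

theorem toConformal_eq (h : OnSide b (x 0)) : toConformal H x = plusMap (sideProfile H b) x := by
  cases b
  · exact toConformal_of_nonpos H (le_of_lt h)
  · exact toConformal_of_pos H h

theorem isOpen_sideDomain (hH : IsProfile H (regularSet Λ)) (b : Bool) :
    IsOpen (sideDomain Λ H b) := (isProfile_side hH b).isOpen_plusDomain

theorem contDiffAt_sideField (hH : IsProfile H (regularSet Λ)) {w : Phase}
    (hw : w.1 ∈ sideDomain Λ H b) : ContDiffAt ℝ ∞ (sideField Λ H b) w :=
  (isProfile_side hH b).contDiffAt_geodesicField hw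

end Side

/-! ### Smooth solutions -/

/-- Picard-Lindelöf for the smooth field. The neighbourhood `O` is at disposal for local bounds,
such as a Lipschitz constant. -/
theorem IsProfile.exists_solution {Λ : ℝ} {H : (Fin 2 → ℝ) → ℝ} {R : Set (Fin 2 → ℝ)}
    (hH : IsProfile H R) {y : Phase} (hy : y.1 ∈ plusDomain Λ H R) (τ : ℝ) {O : Set Phase}
    (hO : O ∈ 𝓝 y) : ∃ (W : ℝ → Phase) (ε : ℝ), 0 < ε ∧ W τ = y ∧
      ∀ t ∈ Ioo (τ - ε) (τ + ε), W t ∈ O ∧ (W t).1 ∈ plusDomain Λ H R ∧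
        HasDerivAt W (geodesicField (plusMetric Λ H) (W t)) t := by
  have h := (hH.contDiffAt_geodesicField hy).of_le (m := 1) (by simp)
  obtain ⟨W, hW, ε, hε, hd⟩ :=
    h.exists_forall_mem_closedBall_exists_eq_forall_mem_Ioo_hasDerivAt₀ τ
  have hc : ContinuousAt W τ := (hd τ ⟨by linarith, by linarith⟩).continuousAt
  have hO' : ∀ᶠ z in 𝓝 (W τ), z ∈ O ∧ z.1 ∈ plusDomain Λ H R := by
    rw [hW]
    exact (eventually_mem_set.2 hO).and
      (continuous_fst.continuousAt.eventually (hH.isOpen_plusDomain.mem_nhds hy))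
  obtain ⟨δ, hδ, H⟩ := Metric.eventually_nhds_iff.1 (hc.eventually hO')
  refine ⟨W, min ε δ, lt_min hε hδ, hW, fun t ht => ?_⟩
  have h1 : |t - τ| < min ε δ := abs_lt.2 ⟨by linarith [ht.1], by linarith [ht.2]⟩
  have h2 := abs_lt.1 (h1.trans_le (min_le_left _ _))
  have h3 := H (show dist t τ < δ from h1.trans_le (min_le_right _ _))
  exact ⟨h3.1, h3.2, hd t ⟨by linarith, by linarith⟩⟩

theorem exists_lipschitzOnWith_of_hasDerivAt {E : Type*} [NormedAddCommGroup E] [NormedSpace ℝ E]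
    {W g : ℝ → E} {a b : ℝ} (h : ∀ t ∈ Icc a b, HasDerivAt W (g t) t)
    (hg : ContinuousOn g (Icc a b)) : ∃ K, LipschitzOnWith K W (Icc a b) := by
  obtain ⟨C, hC⟩ := isCompact_Icc.exists_bound_of_continuousOn hg
  refine ⟨C.toNNReal, (convex_Icc a b).lipschitzOnWith_of_nnnorm_hasDerivWithin_le
    (fun t ht => (h t ht).hasDerivWithinAt) fun t ht => ?_⟩
  rw [← NNReal.coe_le_coe, coe_nnnorm]
  exact (hC t ht).trans (Real.le_coe_toNNReal C)

/-- Joining two differentiable curves gives an absolutely continuous curve. -/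
theorem absolutelyContinuousOnInterval_glue {E : Type*} [NormedAddCommGroup E] [NormedSpace ℝ E]
    {W₁ W₂ g₁ g₂ : ℝ → E} {I : Set ℝ} (hI : I.OrdConnected) {τ : ℝ} (hτ : τ ∈ I)
    (h₁ : ∀ t ∈ I, HasDerivAt W₁ (g₁ t) t) (hg₁ : ContinuousOn g₁ I)
    (h₂ : ∀ t ∈ I, HasDerivAt W₂ (g₂ t) t) (hg₂ : ContinuousOn g₂ I) (h : W₁ τ = W₂ τ) {a b : ℝ}
    (ha : a ∈ I) (hb : b ∈ I) :
    AbsolutelyContinuousOnInterval (fun t => if t ≤ τ then W₁ t else W₂ t) a b := by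
  set a₀ := min (min a b) τ with ha₀
  set b₀ := max (max a b) τ with hb₀
  have ha₀I : a₀ ∈ I := by
    rcases min_choice (min a b) τ with h | h <;> rw [ha₀, h]
    · rcases min_choice a b with h | h <;> rwa [h]
    · exact hτ
  have hb₀I : b₀ ∈ I := by
    rcases max_choice (max a b) τ with h | h <;> rw [hb₀, h]
    · rcases max_choice a b with h | h <;> rwa [h]
    · exact hτ
  have hsub : Icc a₀ b₀ ⊆ I := hI.out ha₀I hb₀I
  have hτm : τ ∈ Icc a₀ b₀ := ⟨min_le_right _ _, le_max_right _ _⟩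
  have hab : uIcc a b ⊆ Icc a₀ b₀ := Icc_subset_Icc (min_le_left _ _) (le_max_left _ _)
  obtain ⟨K₁, hK₁⟩ := exists_lipschitzOnWith_of_hasDerivAt (fun t ht => h₁ t (hsub ht))
    (hg₁.mono hsub)
  obtain ⟨K₂, hK₂⟩ := exists_lipschitzOnWith_of_hasDerivAt (fun t ht => h₂ t (hsub ht))
    (hg₂.mono hsub)
  -- The glued curve is `W₁ (min t τ) + (W₂ (max t τ) - W₂ τ)`, a sum of Lipschitz curves.
  have m₁ : MapsTo (fun t => min t τ) (uIcc a b) (Icc a₀ b₀) := fun t ht =>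
    ⟨le_min (hab ht).1 hτm.1, (min_le_right _ _).trans hτm.2⟩
  have m₂ : MapsTo (fun t => max t τ) (uIcc a b) (Icc a₀ b₀) := fun t ht =>
    ⟨hτm.1.trans (le_max_right _ _), max_le (hab ht).2 hτm.2⟩
  have L₁ := (hK₁.comp (LipschitzWith.id.min_const τ).lipschitzOnWith
    m₁).absolutelyContinuousOnInterval
  have L₂ := (hK₂.comp (LipschitzWith.id.max_const τ).lipschitzOnWith
    m₂).absolutelyContinuousOnInterval
  have L₃ : AbsolutelyContinuousOnInterval (fun _ : ℝ => W₂ τ) a b :=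
    (LipschitzWith.const (W₂ τ)).lipschitzOnWith.absolutelyContinuousOnInterval
  refine (congrArg (fun f => AbsolutelyContinuousOnInterval f a b) (funext fun t => ?_)).mp
    (L₁.add (L₂.sub L₃))
  simp only [Pi.add_apply, Pi.sub_apply, Function.comp_apply]
  split_ifs with ht
  · simp [ht]
  · simp [(not_le.1 ht).le, h]

/-! ### The velocity of a Filippov solution of a geodesic equation -/

/-- `t` may be an endpoint of `J`, so the left and right parts are treated separately; a missing
side reduces to the single point `t`. -/
theorem hasDerivWithinAt_of_Icc {E : Type*} [NormedAddCommGroup E] [NormedSpace ℝ E] {f : ℝ → E}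
    {f' : E} {J : Set ℝ} {t : ℝ} (ht : t ∈ J)
    (h : ∀ a ∈ J, ∀ b ∈ J, a ≤ b → t ∈ Icc a b → HasDerivWithinAt f f' (Icc a b) t) :
    HasDerivWithinAt f f' J t := by
  have hr : HasDerivWithinAt f f' (J ∩ Ici t) t := by
    by_cases hb : ∃ b ∈ J, t < b
    · obtain ⟨b, hbJ, htb⟩ := hb
      refine (h t ht b hbJ htb.le ⟨le_rfl, htb.le⟩).mono_of_mem_nhdsWithin ?_
      exact mem_of_superset (inter_mem_nhdsWithin _ (Iio_mem_nhds htb))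
        fun s hs => ⟨hs.1.2, (mem_Iio.1 hs.2).le⟩
    · have hs : (J ∩ Ici t) ⊆ Icc t t :=
        fun s hs => ⟨hs.2, not_lt.1 fun h => hb ⟨s, hs.1, h⟩⟩
      exact (h t ht t ht le_rfl ⟨le_rfl, le_rfl⟩).mono hs
  have hl : HasDerivWithinAt f f' (J ∩ Iic t) t := by
    by_cases hb : ∃ b ∈ J, b < t
    · obtain ⟨b, hbJ, htb⟩ := hb
      refine (h b hbJ t ht htb.le ⟨htb.le, le_rfl⟩).mono_of_mem_nhdsWithin ?_
      exact mem_of_superset (inter_mem_nhdsWithin _ (Ioi_mem_nhds htb))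
        fun s hs => ⟨(mem_Ioi.1 hs.2).le, hs.1.2⟩
    · have hs : (J ∩ Iic t) ⊆ Icc t t :=
        fun s hs => ⟨not_lt.1 fun h => hb ⟨s, hs.1, h⟩, hs.2⟩
      exact (h t ht t ht le_rfl ⟨le_rfl, le_rfl⟩).mono hs
  refine (hl.union hr).mono fun s hs => ?_
  rcases le_total s t with h | h
  · exact .inl ⟨hs, h⟩
  · exact .inr ⟨hs, h⟩

/-- The position part of the field is the velocity, which is continuous everywhere, so the convex
hulls do not enlarge it. -/
theorem fst_eq_of_mem_filippovMap {g : Coord → Matrix (Fin 4) (Fin 4) ℝ} {w d : Phase}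
    (hd : d ∈ filippovMap (geodesicField g) w) : d.1 = w.2 := by
  refine dist_le_zero.1 (le_of_forall_pos_le_add fun ε hε => ?_)
  rw [zero_add]
  refine filippovMap_subset (S := ∅) (C := ContinuousLinearMap.fst ℝ Coord Coord ⁻¹'
    closedBall w.2 ε) measure_empty ((convex_closedBall _ _).linear_preimage _)
    (isClosed_closedBall.preimage continuous_fst) ?_ hd
  filter_upwards [continuous_snd.continuousAt.eventually (closedBall_mem_nhds w.2 hε)] with y hy _
  exact hy

/-- The derivative of the position equals the continuous velocity almost everywhere, hence
everywhere. Positions are thus `C¹` also at a discontinuity of the field. -/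
theorem IsFilippovSolution.hasDerivWithinAt_fst {g : Coord → Matrix (Fin 4) (Fin 4) ℝ}
    {D : Set Phase} {J : Set ℝ} {w : ℝ → Phase} (h : IsFilippovSolution (geodesicField g) D J w)
    (hJ : J.OrdConnected) {t : ℝ} (ht : t ∈ J) :
    HasDerivWithinAt (fun t => (w t).1) (w t).2 J t := by
  refine hasDerivWithinAt_of_Icc ht fun a ha b hb hab htab => ?_
  have hsub : Icc a b ⊆ J := hJ.out ha hb
  refine hasDerivWithinAt_of_ae (g := fun t => (w t).2) (absolutelyContinuousOnInterval_clm
    (ContinuousLinearMap.fst ℝ Coord Coord) (h.absCont a ha b hb)) hab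
    (continuous_snd.comp_continuousOn (h.continuousOn.mono hsub)) ?_ t htab
  filter_upwards [h.inclusion] with s hs hsI
  obtain ⟨d, hd, hd'⟩ := hs (hsub hsI)
  rw [← fst_eq_of_mem_filippovMap hd]
  exact hd'.fst

/-! ### Normal form of wave solutions off the degenerate states -/

/-- The states at which a solution is tangent to the wave surface. -/
def Degenerate (y : Phase) : Prop := y.1 0 = 0 ∧ y.2 0 = 0

/-- Near the time `τ`, the solution of the geodesic equation of the wave metric with the value `y`
at `τ` is given by the smooth solutions `W false` before and `W true` after `τ`. -/
structure IsNormalForm (Λ : ℝ) (H : (Fin 2 → ℝ) → ℝ) (τ : ℝ) (y : Phase) (ε : ℝ)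
    (side : Bool → Bool) (W : Bool → ℝ → Phase) : Prop where
  pos : 0 < ε
  eq : ∀ d, W d τ = y
  mem : ∀ d, ∀ t ∈ Ioo (τ - ε) (τ + ε), (W d t).1 ∈ sideDomain Λ H (side d)
  hasDerivAt : ∀ d, ∀ t ∈ Ioo (τ - ε) (τ + ε),
    HasDerivAt (W d) (sideField Λ H (side d) (W d t)) t
  onSide : ∀ d, ∀ t ∈ Ioo (τ - ε) (τ + ε), OnSide d (t - τ) → OnSide (side d) ((W d t).1 0)
  -- At a crossing with `U' > 0` the sides before and after have the signs of the time directions;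
  -- with `U' < 0` they are interchanged.
  side_eq : y.1 0 = 0 → ∀ d, OnSide (d == side d) (y.2 0)
  -- Local uniqueness. The time `τ` may be an endpoint of `J`, so one-sided solutions are covered.
  eventually_eq : ∀ (J : Set ℝ) (w : ℝ → Phase), J.OrdConnected → τ ∈ J →
    IsWaveSolution Λ H J w → w τ = y →
    ∀ d, ∀ᶠ t in 𝓝[J] τ, OnSide d (t - τ) → w t = W d t

/-- If `U = 0`, the difference quotient of `U` has the sign of `U' ≠ 0` near `τ`, which fixes the
sides before and after. The last clause is about arbitrary differentiable `u`, as it serves both for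
the smooth solutions that are constructed and for a given Filippov solution. -/
theorem exists_side {y : Phase} (hy : ¬ Degenerate y) :
    ∃ side : Bool → Bool, (y.1 0 ≠ 0 → ∀ d, OnSide (side d) (y.1 0)) ∧
      (y.1 0 = 0 → ∀ d, OnSide (d == side d) (y.2 0)) ∧
      ∀ (u : ℝ → ℝ) (J : Set ℝ) (τ : ℝ), u τ = y.1 0 → HasDerivWithinAt u (y.2 0) J τ →
        ∀ d, ∀ᶠ t in 𝓝[J] τ, OnSide d (t - τ) → OnSide (side d) (u t) := by
  by_cases h0 : y.1 0 = 0
  · have h1 : y.2 0 ≠ 0 := fun h => hy ⟨h0, h⟩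
    have key : ∀ (u : ℝ → ℝ) (J : Set ℝ) (τ : ℝ), u τ = y.1 0 → HasDerivWithinAt u (y.2 0) J τ →
        ∀ᶠ t in 𝓝[J \ {τ}] τ, 0 < (t - τ)⁻¹ * u t * y.2 0 := by
      intro u J τ hu hd
      have h2 := hasDerivWithinAt_iff_tendsto_slope.1 hd
      have h3 : ∀ᶠ s in 𝓝 (y.2 0), 0 < s * y.2 0 := by
        refine (continuous_id.mul continuous_const).continuousAt.eventually_const_lt ?_
        exact mul_self_pos.2 h1
      filter_upwards [h2.eventually h3] with t ht
      simpa [slope, hu, h0] using ht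
    rcases h1.lt_or_gt with h1 | h1
    · refine ⟨fun d => !d, fun h => absurd h0 h, fun _ d => by cases d <;> exact h1, fun u J τ hu hd d => ?_⟩
      have := key u J τ hu hd
      rw [sdiff_eq, nhdsWithin_inter', eventually_inf_principal] at this
      filter_upwards [this] with t ht hs
      have hne : t - τ ≠ 0 := hs.ne_zero
      have := ht (by simpa [sub_eq_zero] using hne)
      cases d
      · have hs : t - τ < 0 := hs
        have h4 : (t - τ)⁻¹ < 0 := inv_lt_zero.2 hs
        have h5 : (t - τ)⁻¹ * u t < 0 := by nlinarith
        show 0 < u t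
        nlinarith
      · have hs : 0 < t - τ := hs
        have h4 : 0 < (t - τ)⁻¹ := inv_pos.2 hs
        have h5 : (t - τ)⁻¹ * u t < 0 := by nlinarith
        show u t < 0
        nlinarith
    · refine ⟨fun d => d, fun h => absurd h0 h, fun _ d => by cases d <;> exact h1, fun u J τ hu hd d => ?_⟩
      have := key u J τ hu hd
      rw [sdiff_eq, nhdsWithin_inter', eventually_inf_principal] at this
      filter_upwards [this] with t ht hs
      have hne : t - τ ≠ 0 := hs.ne_zero
      have := ht (by simpa [sub_eq_zero] using hne)
      have h5 : 0 < (t - τ)⁻¹ * u t := by nlinarith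
      cases d
      · have hs : t - τ < 0 := hs
        have h4 : (t - τ)⁻¹ < 0 := inv_lt_zero.2 hs
        show u t < 0
        nlinarith
      · have hs : 0 < t - τ := hs
        have h4 : 0 < (t - τ)⁻¹ := inv_pos.2 hs
        show 0 < u t
        nlinarith
  · obtain ⟨b, hb⟩ := exists_onSide h0
    refine ⟨fun _ => b, fun _ _ => hb, fun h => absurd h h0, fun u J τ hu hd d => ?_⟩
    rw [← hu] at hb
    filter_upwards [hd.continuousWithinAt.eventually hb.eventually] with t ht _ using ht

theorem hasDerivAt_fst_zero {W : ℝ → Phase} {g : Coord → Matrix (Fin 4) (Fin 4) ℝ} {t : ℝ}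
    (h : HasDerivAt W (geodesicField g (W t)) t) :
    HasDerivAt (fun t => (W t).1 0) ((W t).2 0) t :=
  hasDerivAt_pi.1 (show HasDerivAt (fun t => (W t).1) (W t).2 t from h.fst) 0

/-- The smooth fields of the sides prescribed by `exists_side` are solved from the common state `y`.
Before and after `τ`, any Filippov solution through `y` lies on the prescribed side, where its
inclusion is the smooth equation; Lipschitz uniqueness up to the endpoint `τ` identifies the two. -/
theorem exists_normalForm {Λ : ℝ} {H : (Fin 2 → ℝ) → ℝ} (hH : IsProfile H (regularSet Λ))
    {y : Phase} (hy : y.1 ∈ waveDomain Λ H) (hne : ¬ Degenerate y) (τ : ℝ) :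
    ∃ ε side W, IsNormalForm Λ H τ y ε side W := by
  obtain ⟨side, hs0, hsf, hside⟩ := exists_side hne
  have hmem : ∀ d, y.1 ∈ sideDomain Λ H (side d) := fun d => by
    by_cases h0 : y.1 0 = 0
    · exact mem_sideDomain_of_eq_zero hy h0 _
    · exact mem_sideDomain_of_onSide hy (hs0 h0 d)
  have hlip : ∀ d, ∃ K, ∃ s ∈ 𝓝 y, LipschitzOnWith K (sideField Λ H (side d)) s := fun d =>
    ((contDiffAt_sideField hH (hmem d)).of_le (m := 1) (by simp)).exists_lipschitzOnWith
  choose K s hs hK using hlip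
  choose W ε hε hWτ hW using fun d =>
    (isProfile_side hH (side d)).exists_solution (hmem d) τ (hs d)
  have hsideW : ∀ d, ∃ δ > 0, ∀ t, |t - τ| < δ → OnSide d (t - τ) →
      OnSide (side d) ((W d t).1 0) := fun d => by
    have h1 : HasDerivWithinAt (fun t => (W d t).1 0) (y.2 0) univ τ := by
      have h2 := hasDerivAt_fst_zero (hW d τ ⟨by linarith [hε d], by linarith [hε d]⟩).2.2
      rw [hWτ] at h2
      exact h2.hasDerivWithinAt
    have h2 := hside _ univ τ (by simp [hWτ]) h1 d
    rw [nhdsWithin_univ] at h2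
    exact Metric.eventually_nhds_iff.1 h2
  choose δ hδ hWside using hsideW
  obtain ⟨r, hr, hrε⟩ : ∃ r > 0, ∀ d, r ≤ ε d ∧ r ≤ δ d := by
    refine ⟨min (min (ε false) (δ false)) (min (ε true) (δ true)), ?_, fun d => ?_⟩
    · exact lt_min (lt_min (hε _) (hδ _)) (lt_min (hε _) (hδ _))
    · cases d
      · exact ⟨(min_le_left _ _).trans (min_le_left _ _), (min_le_left _ _).trans (min_le_right _ _)⟩
      · exact ⟨(min_le_right _ _).trans (min_le_left _ _),
          (min_le_right _ _).trans (min_le_right _ _)⟩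
  have hsub : ∀ d, Ioo (τ - r) (τ + r) ⊆ Ioo (τ - ε d) (τ + ε d) := fun d =>
    Ioo_subset_Ioo (by linarith [(hrε d).1]) (by linarith [(hrε d).1])
  refine ⟨r, side, W, hr, hWτ, fun d t ht => (hW d t (hsub d ht)).2.1,
    fun d t ht => (hW d t (hsub d ht)).2.2, fun d t ht => hWside d t ?_, hsf, ?_⟩
  · exact (abs_lt.2 ⟨by linarith [ht.1], by linarith [ht.2]⟩ : |t - τ| < r).trans_le (hrε d).2
  intro J w hJ hτJ hw hwτ d
  have hxd : HasDerivWithinAt (fun t => (w t).1 0) (y.2 0) J τ := by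
    have := hasDerivWithinAt_pi.1 (hw.hasDerivWithinAt_fst hJ hτJ) 0
    rwa [hwτ] at this
  have e1 := hside _ J τ (by simp [hwτ]) hxd d
  have e2 : ∀ᶠ t in 𝓝[J] τ, w t ∈ s d ∧ (w t).1 ∈ sideDomain Λ H (side d) := by
    have h9 : ∀ᶠ z in 𝓝 (w τ), z ∈ s d ∧ z.1 ∈ sideDomain Λ H (side d) := by
      rw [hwτ]
      exact (eventually_mem_set.2 (hs d)).and
        (continuous_fst.continuousAt.eventually ((isOpen_sideDomain hH _).mem_nhds (hmem d)))
    exact (hw.continuousOn τ hτJ).eventually h9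
  have e3 : ∀ᶠ t in 𝓝[J] τ, t ∈ Ioo (τ - r) (τ + r) :=
    mem_nhdsWithin_of_mem_nhds (Ioo_mem_nhds (by linarith) (by linarith))
  obtain ⟨η, hη, hball⟩ := Metric.mem_nhdsWithin_iff.1 (e1.and (e2.and e3))
  refine Metric.mem_nhdsWithin_iff.2 ⟨η, hη, fun t ht hst => ?_⟩
  -- Only interior times need to be on the side `side d`. The endpoint `τ` may lie on the
  -- discontinuity, as the smooth field is continuous there.
  have core : ∀ a ∈ J, ∀ b ∈ J, a ≤ b → τ ∈ Icc a b → (∀ q ∈ Icc a b, |q - τ| < η) →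
      (∀ q ∈ Ioo a b, OnSide d (q - τ)) → EqOn w (W d) (Icc a b) := by
    intro a ha b hb hab hτab hq hq'
    have hI : ∀ q ∈ Icc a b, q ∈ J := fun q hq => hJ.out ha hb hq
    have hall : ∀ q ∈ Icc a b, _ := fun q hqI => hball ⟨hq q hqI, hI q hqI⟩
    have hcl := hw.hasDerivWithinAt (g := sideField Λ H (side d)) hab ha hb hJ
      (fun q hqI => geodesicField_waveMetric
        ((hall q (Ioo_subset_Icc_self hqI)).1 (hq' q hqI)))
      (fun q hqI => (contDiffAt_sideField hH (hall q hqI).2.1.2).continuousAt)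
    refine eqOn_of_hasDerivWithinAt_Icc (hK d) hτab
      (fun q hqI => ⟨(hall q hqI).2.1.1, hcl q hqI⟩) (fun q hqI => ?_) (by rw [hwτ, hWτ])
    have := hW d q (hsub d (hall q hqI).2.2)
    exact ⟨this.1, this.2.2.hasDerivWithinAt⟩
  have htη : |t - τ| < η := ht.1
  have htη' := abs_lt.1 htη
  cases d
  · have hst' : t < τ := sub_neg.1 hst
    refine core t ht.2 τ hτJ hst'.le ⟨hst'.le, le_rfl⟩ (fun q hq => ?_) (fun q hq => ?_)
      ⟨le_rfl, hst'.le⟩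
    · exact abs_lt.2 ⟨by linarith [hq.1], by linarith [hq.2]⟩
    · exact sub_neg.2 hq.2
  · have hst' : τ < t := sub_pos.1 hst
    refine core τ hτJ t ht.2 hst'.le ⟨le_rfl, hst'.le⟩ (fun q hq => ?_) (fun q hq => ?_)
      ⟨hst'.le, le_rfl⟩
    · exact abs_lt.2 ⟨by linarith [hq.1], by linarith [hq.2]⟩
    · exact sub_pos.2 hq.1

instance : (volume : Measure Phase).IsAddHaarMeasure :=
  Measure.prod.instIsAddHaarMeasure _ _

namespace IsNormalForm

variable {Λ : ℝ} {H : (Fin 2 → ℝ) → ℝ} {τ ε : ℝ} {y : Phase} {side : Bool → Bool}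
  {W : Bool → ℝ → Phase}

/-- The solution with the given normal form. -/
def _root_.ImpulsiveWave.glue (τ : ℝ) (W : Bool → ℝ → Phase) (t : ℝ) : Phase :=
  if t ≤ τ then W false t else W true t

theorem glue_of_onSide {d : Bool} {t : ℝ} (h : OnSide d (t - τ)) : glue τ W t = W d t := by
  cases d
  · exact if_pos (sub_neg.1 h).le
  · exact if_neg (not_le.2 (sub_pos.1 h))

theorem glue_eventuallyEq {d : Bool} {t : ℝ} (h : OnSide d (t - τ)) : glue τ W =ᶠ[𝓝 t] W d := by
  have : ContinuousAt (fun t : ℝ => t - τ) t := by fun_prop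
  filter_upwards [this.eventually h.eventually] with s hs using glue_of_onSide hs

theorem mono {δ : ℝ} (h : IsNormalForm Λ H τ y ε side W) (hδ : 0 < δ) (hδε : δ ≤ ε) :
    IsNormalForm Λ H τ y δ side W := by
  have hsub : Ioo (τ - δ) (τ + δ) ⊆ Ioo (τ - ε) (τ + ε) :=
    Ioo_subset_Ioo (by linarith) (by linarith)
  exact ⟨hδ, h.eq, fun d t ht => h.mem d t (hsub ht), fun d t ht => h.hasDerivAt d t (hsub ht),
    fun d t ht => h.onSide d t (hsub ht), h.side_eq, h.eventually_eq⟩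

theorem glue_self (h : IsNormalForm Λ H τ y ε side W) : glue τ W τ = y := by
  rw [glue, if_pos le_rfl, h.eq]

theorem isWaveSolution_glue (hH : IsProfile H (regularSet Λ)) (hy : y.1 ∈ waveDomain Λ H)
    (h : IsNormalForm Λ H τ y ε side W) :
    IsWaveSolution Λ H (Ioo (τ - ε) (τ + ε)) (glue τ W) := by
  have hc : ∀ d, ContinuousOn (fun t => sideField Λ H (side d) (W d t))
      (Ioo (τ - ε) (τ + ε)) := fun d t ht =>
    ((contDiffAt_sideField hH (h.mem d t ht)).continuousAt.comp
      (h.hasDerivAt d t ht).continuousAt).continuousWithinAt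
  have hτ : τ ∈ Ioo (τ - ε) (τ + ε) := ⟨by linarith [h.pos], by linarith [h.pos]⟩
  refine IsFilippovSolution.of_hasDerivAt τ (fun t ht => ⟨?_, trivial⟩) (fun a ha b hb => ?_)
    (fun t ht htτ => ?_)
  · by_cases htτ : t = τ
    · rw [htτ, h.glue_self]; exact hy
    · obtain ⟨d, hd⟩ := exists_onSide (sub_ne_zero.2 htτ)
      rw [glue_of_onSide hd]
      exact mem_waveDomain_of_onSide (h.mem d t ht) (h.onSide d t ht hd)
  · exact absolutelyContinuousOnInterval_glue ordConnected_Ioo hτ (h.hasDerivAt false) (hc false)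
      (h.hasDerivAt true) (hc true) (by rw [h.eq, h.eq]) ha hb
  · obtain ⟨d, hd⟩ := exists_onSide (sub_ne_zero.2 htτ)
    have h1 := geodesicField_waveMetric (Λ := Λ) (H := H) (h.onSide d t ht hd)
    rw [glue_of_onSide hd]
    refine ⟨(contDiffAt_sideField hH (h.mem d t ht)).continuousAt.congr h1.symm, ?_⟩
    rw [h1.self_of_nhds]
    exact (h.hasDerivAt d t ht).congr_of_eventuallyEq (glue_eventuallyEq hd)

end IsNormalForm

theorem IsWaveSolution.eventually_eq {Λ : ℝ} {H : (Fin 2 → ℝ) → ℝ}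
    (hH : IsProfile H (regularSet Λ)) {J J' : Set ℝ} {w w' : ℝ → Phase} (hJ : J.OrdConnected)
    (hJ' : J'.OrdConnected) {τ : ℝ} (hτ : τ ∈ J) (hτ' : τ ∈ J') (hw : IsWaveSolution Λ H J w)
    (hw' : IsWaveSolution Λ H J' w') (h : w τ = w' τ) (hne : ¬ Degenerate (w τ)) :
    ∀ᶠ t in 𝓝[J ∩ J'] τ, w t = w' t := by
  obtain ⟨ε, side, W, hW⟩ := exists_normalForm hH (hw.mem τ hτ).1 hne τ
  have h1 := fun d => (hW.eventually_eq J w hJ hτ hw rfl d).filter_mono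
    (nhdsWithin_mono τ (inter_subset_left : J ∩ J' ⊆ J))
  have h2 := fun d => (hW.eventually_eq J' w' hJ' hτ' hw' h.symm d).filter_mono
    (nhdsWithin_mono τ (inter_subset_right : J ∩ J' ⊆ J'))
  filter_upwards [h1 false, h1 true, h2 false, h2 true] with t a1 a2 b1 b2
  by_cases htτ : t = τ
  · rw [htτ, h]
  · obtain ⟨d, hd⟩ := exists_onSide (sub_ne_zero.2 htτ)
    cases d
    · rw [a1 hd, b1 hd]
    · rw [a2 hd, b2 hd]

/-! ### Degenerate solutions stay in the wave surface -/

theorem continuousAt_lorentz {E : Type*} [TopologicalSpace E] {f g : E → Coord} {x : E}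
    (hf : ContinuousAt f x) (hg : ContinuousAt g x) :
    ContinuousAt (fun z => lorentz (f z) (g z)) x := by
  have hf' := fun i => continuousAt_pi.1 hf i
  have hg' := fun i => continuousAt_pi.1 hg i
  exact ((((hf' 2).mul (hg' 2)).add ((hf' 3).mul (hg' 3))).sub ((hf' 0).mul (hg' 1))).sub
    ((hf' 1).mul (hg' 0))

/-- As `plusMap` preserves `U`, the `U`-component of the equation is the one of the background: `U''
= A U' - B U` with `A`, `B` continuous. -/
theorem IsProfile.exists_abs_geodesicField_le {Λ : ℝ} {H : (Fin 2 → ℝ) → ℝ} {R : Set (Fin 2 → ℝ)}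
    (hH : IsProfile H R) {y : Phase} (hy : y.1 ∈ plusDomain Λ H R) :
    ∃ K, 0 ≤ K ∧ ∀ᶠ z in 𝓝 y,
      |(geodesicField (plusMetric Λ H) z).2 0| ≤ K * (|z.1 0| + |z.2 0|) := by
  set A : Phase → ℝ := fun z => 2 * (Λ / 6 * lorentz (plusMap H z.1)
    (fderiv ℝ (plusMap H) z.1 z.2)) / bigOmega Λ (plusMap H z.1) with hA
  set B : Phase → ℝ := fun z => Λ / 6 * lorentz (fderiv ℝ (plusMap H) z.1 z.2)
    (fderiv ℝ (plusMap H) z.1 z.2) / bigOmega Λ (plusMap H z.1) with hB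
  have hs := hH.contDiffAt_plusMap hy.2.2
  have c1 : ContinuousAt (fun z : Phase => plusMap H z.1) y :=
    ContinuousAt.comp (f := Prod.fst) (x := y) hs.continuousAt continuousAt_fst
  have c2 : ContinuousAt (fun z : Phase => fderiv ℝ (plusMap H) z.1 z.2) y :=
    ContinuousAt.clm_apply (ContinuousAt.comp (f := Prod.fst) (x := y)
      (hs.fderiv_right (m := 1) two_le_infty).continuousAt continuousAt_fst) continuousAt_snd
  have hb : Continuous (bigOmega Λ) := by unfold bigOmega; fun_prop
  have c3 : ContinuousAt (fun z : Phase => bigOmega Λ (plusMap H z.1)) y :=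
    ContinuousAt.comp (x := y) (g := bigOmega Λ) hb.continuousAt c1
  have cA : ContinuousAt A y := by
    exact ContinuousAt.div₀ (continuousAt_const.mul (continuousAt_const.mul
      (continuousAt_lorentz c1 c2))) c3 (bigOmega_plusMap_ne_zero hy)
  have cB : ContinuousAt B y := by
    exact ContinuousAt.div₀ (continuousAt_const.mul (continuousAt_lorentz c2 c2)) c3
      (bigOmega_plusMap_ne_zero hy)
  refine ⟨|A y| + |B y| + 1, by positivity, ?_⟩
  filter_upwards [continuous_fst.continuousAt.eventually (hH.isOpen_plusDomain.mem_nhds hy),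
    cA.abs.eventually_lt_const (lt_add_one _), cB.abs.eventually_lt_const (lt_add_one _)]
    with z hz h1 h2
  have hz' : z.1 ∈ plusDomain Λ H R := hz
  have e1 := congrFun (hH.fderiv_plusMap_geodesicField hz' z.2) 0
  -- The `U`-component of the Jacobian of `plusMap` is constant, so it has no second derivative.
  have e2 : fderiv ℝ (fderiv ℝ (plusMap H)) z.1 z.2 z.2 0 = 0 := by
    have hφ2 : DifferentiableAt ℝ (fderiv ℝ (plusMap H)) z.1 :=
      ((hH.contDiffAt_plusMap hz'.2.2).fderiv_right (m := 1) two_le_infty).differentiableAt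
        (by norm_num)
    have hd := hφ2.hasFDerivAt.clm_apply (hasFDerivAt_const z.2 z.1)
    have hd0 := hasFDerivAt_pi'.1 hd 0
    have hc : HasFDerivAt (fun x => fderiv ℝ (plusMap H) x z.2 0) (0 : Coord →L[ℝ] ℝ) z.1 := by
      refine (hasFDerivAt_const (z.2 0) z.1).congr_of_eventuallyEq ?_
      filter_upwards [hH.isOpen_plusDomain.mem_nhds hz'] with x hx
      rw [hH.fderiv_plusMap hx.2.2]
      rfl
    have := congrArg (fun l => l z.2) (hd0.unique hc)
    simpa using this
  rw [geodesicField_backgroundMetric (bigOmega_plusMap_ne_zero hz')] at e1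
  simp only [Pi.add_apply, e2, Pi.sub_apply, Pi.smul_apply, smul_eq_mul, add_zero] at e1
  have e3 : (geodesicField (plusMetric Λ H) z).2 0 = A z * z.2 0 - B z * z.1 0 := by
    have h3 : fderiv ℝ (plusMap H) z.1 (geodesicField (plusMetric Λ H) (z.1, z.2)).2 0 =
        (geodesicField (plusMetric Λ H) z).2 0 := by rw [hH.fderiv_plusMap hz'.2.2]; rfl
    have h4 : fderiv ℝ (plusMap H) z.1 z.2 0 = z.2 0 := by rw [hH.fderiv_plusMap hz'.2.2]; rfl
    rw [← h3, e1, h4]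
    rfl
  rw [e3]
  have t1 : |A z * z.2 0 - B z * z.1 0| ≤ |A z| * |z.2 0| + |B z| * |z.1 0| := by
    rw [← abs_mul, ← abs_mul]; exact abs_sub _ _
  have n1 := abs_nonneg (A y)
  have n2 := abs_nonneg (B y)
  have t2 : |A z| * |z.2 0| ≤ (|A y| + |B y| + 1) * |z.2 0| := by gcongr; linarith
  have t3 : |B z| * |z.1 0| ≤ (|A y| + |B y| + 1) * |z.1 0| := by gcongr; linarith
  linarith

/-- At points of `U = 0` the metric need not be differentiable and the value of the field carries no
information; they are excluded, being a null set of states. -/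
theorem exists_abs_waveField_le {Λ : ℝ} {H : (Fin 2 → ℝ) → ℝ} (hH : IsProfile H (regularSet Λ))
    {y : Phase} (hy : y.1 ∈ waveDomain Λ H) : ∃ K, 0 ≤ K ∧ ∀ᶠ z in 𝓝 y, z.1 0 ≠ 0 →
      |(geodesicField (waveMetric Λ H) z).2 0| ≤ K * (|z.1 0| + |z.2 0|) := by
  have key : ∀ b, y.1 ∈ sideDomain Λ H b → ∃ K, 0 ≤ K ∧ ∀ᶠ z in 𝓝 y, OnSide b (z.1 0) →
      |(geodesicField (waveMetric Λ H) z).2 0| ≤ K * (|z.1 0| + |z.2 0|) := fun b hb => by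
    obtain ⟨K, hK, h⟩ := (isProfile_side hH b).exists_abs_geodesicField_le hb
    refine ⟨K, hK, h.mono fun z hz hzb => ?_⟩
    rw [(geodesicField_waveMetric hzb).self_of_nhds]
    exact hz
  by_cases h0 : y.1 0 = 0
  · obtain ⟨K₁, hK₁, h₁⟩ := key false (mem_sideDomain_of_eq_zero hy h0 _)
    obtain ⟨K₂, hK₂, h₂⟩ := key true (mem_sideDomain_of_eq_zero hy h0 _)
    refine ⟨max K₁ K₂, hK₁.trans (le_max_left _ _), ?_⟩
    filter_upwards [h₁, h₂] with z hz₁ hz₂ hz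
    obtain ⟨b, hb⟩ := exists_onSide hz
    cases b
    · refine (hz₁ hb).trans ?_
      gcongr; exact le_max_left _ _
    · refine (hz₂ hb).trans ?_
      gcongr; exact le_max_right _ _
  · obtain ⟨b, hb⟩ := exists_onSide h0
    obtain ⟨K, hK, h⟩ := key b (mem_sideDomain_of_onSide hy hb)
    refine ⟨K, hK, ?_⟩
    filter_upwards [h, continuous_fst.continuousAt.eventually (eventually_onSide hb)]
      with z hz hzb _ using hz hzb

theorem volume_fst_zero : volume {z : Phase | z.1 0 = 0} = 0 := by
  set l : Phase →ₗ[ℝ] ℝ := (LinearMap.proj 0).comp (LinearMap.fst ℝ Coord Coord) with hl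
  have h : ({z : Phase | z.1 0 = 0} : Set Phase) = (LinearMap.ker l : Submodule ℝ Phase) := by
    ext z; simp [hl]
  rw [h]
  refine Measure.addHaar_submodule _ _ fun h => ?_
  have : ((fun _ => 1, 0) : Phase) ∈ LinearMap.ker l := by rw [h]; trivial
  simp [hl] at this

/-- The bound of `exists_abs_waveField_le` is a closed convex condition on the acceleration that
holds off a null set, so the Filippov inclusion inherits it, and Gronwall applies in both time
directions. -/
theorem IsWaveSolution.degenerate {Λ : ℝ} {H : (Fin 2 → ℝ) → ℝ} (hH : IsProfile H (regularSet Λ))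
    {J : Set ℝ} {w : ℝ → Phase} (hJ : J.OrdConnected) (hw : IsWaveSolution Λ H J w) {t₀ : ℝ}
    (ht₀ : t₀ ∈ J) (h₀ : Degenerate (w t₀)) : ∀ t ∈ J, Degenerate (w t) := by
  refine forall_of_locally_all_or_none hJ ht₀ h₀ fun τ hτ => ?_
  obtain ⟨K, hK, hbound⟩ := exists_abs_waveField_le hH (hw.mem τ hτ).1
  obtain ⟨ε, hε, hball⟩ := Metric.mem_nhdsWithin_iff.1
    ((hw.continuousOn τ hτ).eventually hbound.eventually_nhds)
  refine ⟨ε, hε, fun a ha haε hPa b hb hbε => ?_⟩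
  have haε' := abs_lt.1 haε
  have hbε' := abs_lt.1 hbε
  set m := min a b with hm
  set M := max a b with hM
  have hmJ : m ∈ J := by rcases min_choice a b with h | h <;> rw [hm, h] <;> assumption
  have hMJ : M ∈ J := by rcases max_choice a b with h | h <;> rw [hM, h] <;> assumption
  have hmε : -ε < m - τ := by rcases min_choice a b with h | h <;> rw [hm, h] <;> linarith
  have hMε : M - τ < ε := by rcases max_choice a b with h | h <;> rw [hM, h] <;> linarith
  have hac := hw.absCont m hmJ M hMJ
  have hu := absolutelyContinuousOnInterval_clm ((ContinuousLinearMap.proj (R := ℝ)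
    (φ := fun _ : Fin 4 => ℝ) 0).comp (ContinuousLinearMap.fst ℝ Coord Coord)) hac
  have hp := absolutelyContinuousOnInterval_clm ((ContinuousLinearMap.proj (R := ℝ)
    (φ := fun _ : Fin 4 => ℝ) 0).comp (ContinuousLinearMap.snd ℝ Coord Coord)) hac
  refine eq_zero_of_ae_abs_le (u := fun t => (w t).1 0) (p := fun t => (w t).2 0)
    (c := a) (K := K) ⟨min_le_left _ _, le_max_left _ _⟩ hK hu hp ?_ hPa.1 hPa.2 b
    ⟨min_le_right _ _, le_max_right _ _⟩
  filter_upwards [hw.inclusion] with t ht htI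
  have htJ : t ∈ J := hJ.out hmJ hMJ htI
  have htε : |t - τ| < ε := abs_lt.2 ⟨by linarith [htI.1], by linarith [htI.2]⟩
  have hbt := hball ⟨htε, htJ⟩
  obtain ⟨d, hd, hd'⟩ := ht htJ
  have h1 : HasDerivAt (fun t => (w t).1) d.1 t := hd'.fst
  have h2 : HasDerivAt (fun t => (w t).2) d.2 t := hd'.snd
  rw [fst_eq_of_mem_filippovMap hd] at h1
  refine ⟨hasDerivAt_pi.1 h1 0, d.2 0, hasDerivAt_pi.1 h2 0, ?_⟩
  -- The bound varies continuously with the state; the slack `η` replaces it by one constant in a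
  -- neighbourhood.
  refine le_of_forall_pos_le_add fun η hη => ?_
  set l : Phase →L[ℝ] ℝ := (ContinuousLinearMap.proj (R := ℝ)
    (φ := fun _ : Fin 4 => ℝ) 0).comp (ContinuousLinearMap.snd ℝ Coord Coord) with hl
  have hd2 : d ∈ l ⁻¹' closedBall 0 (K * (|(w t).1 0| + |(w t).2 0|) + η) := by
    refine filippovMap_subset volume_fst_zero ((convex_closedBall _ _).linear_preimage l.toLinearMap)
      (isClosed_closedBall.preimage l.continuous) ?_ hd
    have hcont : Continuous fun z : Phase => K * (|z.1 0| + |z.2 0|) := by fun_prop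
    filter_upwards [hbt, hcont.continuousAt.eventually_lt_const (lt_add_of_pos_right _ hη)]
      with z hz hz' hz0
    rw [mem_preimage, mem_closedBall_zero_iff, Real.norm_eq_abs]
    exact (hz hz0).trans hz'.le
  rw [mem_preimage, mem_closedBall_zero_iff, Real.norm_eq_abs] at hd2
  exact hd2

/-! ### Coordinate systems away from the wave surface -/

theorem IsFilippovSolution.hasDerivAt {E : Type*} [NormedAddCommGroup E] [NormedSpace ℝ E]
    [MeasureSpace E] [CompleteSpace E] {f g : E → E} {D : Set E} {I J : Set ℝ} {w : ℝ → E}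
    (h : IsFilippovSolution f D I w) (hI : I.OrdConnected) (hJ : IsOpen J) (hJI : J ⊆ I)
    (hfg : ∀ t ∈ J, f =ᶠ[𝓝 (w t)] g ∧ ContinuousAt g (w t)) :
    ∀ t ∈ J, HasDerivAt w (g (w t)) t := by
  intro t ht
  obtain ⟨r, hr, hrJ⟩ := Metric.nhds_basis_closedBall.mem_iff.1 (hJ.mem_nhds ht)
  rw [Real.closedBall_eq_Icc] at hrJ
  have h1 := h.hasDerivWithinAt (a := t - r) (b := t + r) (by linarith)
    (hJI (hrJ ⟨le_rfl, by linarith⟩)) (hJI (hrJ ⟨by linarith, le_rfl⟩)) hI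
    (fun s hs => (hfg s (hrJ (Ioo_subset_Icc_self hs))).1) (fun s hs => (hfg s (hrJ hs)).2)
    t ⟨by linarith, by linarith⟩
  exact h1.hasDerivAt (Icc_mem_nhds (by linarith) (by linarith))

theorem bigOmega_toConformal (Λ : ℝ) (H : (Fin 2 → ℝ) → ℝ) (x : Coord) :
    bigOmega Λ (toConformal H x) = omega Λ H x := by
  rcases le_or_gt (x 0) 0 with h | h
  · rw [toConformal_of_nonpos H h, plusMap_zero, omega_of_nonpos Λ H h]
  · rw [toConformal_of_pos H h, bigOmega_plusMap, omega_of_nonneg Λ H h.le]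

theorem toConformal_apply_zero (H : (Fin 2 → ℝ) → ℝ) (x : Coord) : toConformal H x 0 = x 0 := rfl

section Charts

variable {Λ : ℝ} {H : (Fin 2 → ℝ) → ℝ} {k : Chart} {x : Coord}

theorem Chart.point_eq_zero_iff (hx : x ∈ k.dom Λ H) : k.point Λ H x 0 = 0 ↔ x 0 = 0 := by
  cases k
  · have h : bigOmega Λ x ≠ 0 := hx.1
    simp [Chart.point, stereo, h]
  · have h : bigOmega Λ x ≠ 0 := hx.1
    simp [Chart.point, stereoReflected, h]
  · have h : omega Λ H x ≠ 0 := hx.1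
    simp [Chart.point, stereo, bigOmega_toConformal, h, toConformal_apply_zero]

theorem Chart.eq_wave (hx : x ∈ k.dom Λ H) (h : x 0 = 0) : k = .wave := by
  cases k
  · exact absurd h hx.2
  · exact absurd h hx.2.1
  · rfl

/-- Away from the wave surface, every coordinate system is given by a smooth profile. -/
theorem Chart.exists_profile (hH : IsProfile H (regularSet Λ)) (hx : x ∈ k.dom Λ H)
    (h0 : x 0 ≠ 0) : ∃ (H' : (Fin 2 → ℝ) → ℝ) (R : Set (Fin 2 → ℝ)), IsProfile H' R ∧
      x ∈ plusDomain Λ H' R ∧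
      (∀ᶠ y in 𝓝 x, y ∈ k.dom Λ H ∧ k.metric Λ H y = plusMetric Λ H' y) ∧
      ((∀ᶠ y in 𝓝 x, k.point Λ H y = stereo Λ (plusMap H' y)) ∨
        (Λ ≠ 0 ∧ ∀ᶠ y in 𝓝 x, k.point Λ H y = reflect (stereo Λ (plusMap H' y)))) := by
  have hO : IsOpen {y : Coord | bigOmega Λ y ≠ 0} := by
    rw [← plusDomain_zero]; exact isProfile_zero.isOpen_plusDomain
  have hO0 : IsOpen {y : Coord | y 0 ≠ 0} := isOpen_ne_fun (continuous_apply 0) continuous_const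
  have hop : bigOmega Λ x ≠ 0 → ∀ᶠ y : Coord in 𝓝 x, bigOmega Λ y ≠ 0 ∧ y 0 ≠ 0 :=
    fun h => (hO.eventually_mem h).and (hO0.eventually_mem h0)
  cases k
  · refine ⟨0, univ, isProfile_zero, by rw [plusDomain_zero]; exact hx.1, ?_, .inl ?_⟩
    · filter_upwards [hop hx.1] with y hy using ⟨hy, by rw [plusMetric_zero]; rfl⟩
    · exact Eventually.of_forall fun y => by rw [plusMap_zero]; rfl
  · refine ⟨0, univ, isProfile_zero, by rw [plusDomain_zero]; exact hx.1, ?_, .inr ⟨hx.2.2, ?_⟩⟩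
    · filter_upwards [hop hx.1] with y hy using
        ⟨⟨hy.1, hy.2, hx.2.2⟩, by rw [plusMetric_zero]; rfl⟩
    · filter_upwards [hop hx.1] with y hy
      rw [plusMap_zero, ← stereoReflected_eq hy.1]
      rfl
  · obtain ⟨b, hb⟩ := exists_onSide h0
    have hx' := mem_sideDomain_of_onSide hx hb
    refine ⟨sideProfile H b, sideSet Λ b, isProfile_side hH b, hx', ?_, .inl ?_⟩
    · filter_upwards [(isOpen_sideDomain hH b).mem_nhds hx', eventually_onSide hb,
        waveMetric_eventuallyEq (Λ := Λ) (H := H) hb] with y h1 h2 h3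
      exact ⟨mem_waveDomain_of_onSide h1 h2, h3⟩
    · filter_upwards [eventually_onSide hb] with y hy
      rw [← toConformal_eq hy]
      rfl

end Charts

/-! ### Geodesics of the impulsive wave spacetime -/

namespace IsGeodesic

variable {Λ : ℝ} {H : (Fin 2 → ℝ) → ℝ} {I : Set ℝ} {γ : ℝ → Ambient}

/-- Off the wave surface, a geodesic is a geodesic of the background. -/
theorem exists_isBackgroundGeodesic (hH : IsProfile H (regularSet Λ)) (h : IsGeodesic Λ H I γ)
    {t₀ : ℝ} (ht₀ : t₀ ∈ I) (h0 : γ t₀ 0 ≠ 0) :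
    ∃ ε > 0, Ioo (t₀ - ε) (t₀ + ε) ⊆ I ∧
      IsBackgroundGeodesic Λ (Ioo (t₀ - ε) (t₀ + ε)) γ (deriv γ) := by
  obtain ⟨k, ε, w, hε, hεI, hw, hγ⟩ := h.locally_solution t₀ ht₀
  have ht₀ε : t₀ ∈ Ioo (t₀ - ε) (t₀ + ε) := ⟨by linarith, by linarith⟩
  have hx := (hw.mem t₀ ht₀ε).1
  have hx0 : (w t₀).1 0 ≠ 0 := by
    rwa [hγ t₀ ht₀ε, Ne, Chart.point_eq_zero_iff hx] at h0
  obtain ⟨H', R, hH', hxR, hk, hp⟩ := Chart.exists_profile hH hx hx0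
  have hc : ContinuousAt (fun t => (w t).1) t₀ := continuous_fst.continuousAt.comp
    ((hw.continuousOn).continuousAt (Ioo_mem_nhds ht₀ε.1 ht₀ε.2))
  obtain ⟨δ, hδ, hball⟩ := Metric.eventually_nhds_iff.1 <| hc.eventually <|
    hk.eventually_nhds.and (hH'.isOpen_plusDomain.mem_nhds hxR)
  have main : ∀ η, 0 < η → η ≤ ε → η ≤ δ →
      IsBackgroundGeodesic Λ (Ioo (t₀ - η) (t₀ + η)) (fun t => stereo Λ (plusMap H' (w t).1))
        (fun t => stereoVel Λ (plusMap H' (w t).1) (fderiv ℝ (plusMap H') (w t).1 (w t).2)) := by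
    intro η hη hηε hηδ
    have hall : ∀ t ∈ Ioo (t₀ - η) (t₀ + η), _ := fun t ht =>
      hball (y := t) (lt_of_lt_of_le (abs_lt.2 ⟨by linarith [ht.1], by linarith [ht.2]⟩) hηδ)
    refine hH'.isBackgroundGeodesic fun t ht => ⟨(hall t ht).2, ?_⟩
    refine hw.hasDerivAt ordConnected_Ioo isOpen_Ioo
      (Ioo_subset_Ioo (by linarith) (by linarith)) (fun s hs => ⟨?_, ?_⟩) t ht
    · exact geodesicField_eventuallyEq ((hall s hs).1.mono fun y hy => hy.2)
    · exact (hH'.contDiffAt_geodesicField (hall s hs).2).continuousAt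
  have finish : ∀ η Z Z', 0 < η → η ≤ ε → IsBackgroundGeodesic Λ (Ioo (t₀ - η) (t₀ + η)) Z Z' →
      EqOn γ Z (Ioo (t₀ - η) (t₀ + η)) → ∃ ε > 0, Ioo (t₀ - ε) (t₀ + ε) ⊆ I ∧
      IsBackgroundGeodesic Λ (Ioo (t₀ - ε) (t₀ + ε)) γ (deriv γ) := by
    intro η Z Z' hη hηε hZ hγZ
    refine ⟨η, hη, (Ioo_subset_Ioo (by linarith) (by linarith)).trans hεI,
      hZ.congr isOpen_Ioo hγZ fun t ht => ?_⟩
    exact ((hZ t ht).2.2.1.congr_of_eventuallyEq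
      (hγZ.eventuallyEq_of_mem (isOpen_Ioo.mem_nhds ht))).deriv
  rcases hp with hp | ⟨hΛ, hp⟩
  · obtain ⟨δ', hδ', hball'⟩ := Metric.eventually_nhds_iff.1 (hc.eventually hp)
    have hη : 0 < min (min ε δ) δ' := lt_min (lt_min hε hδ) hδ'
    refine finish _ _ _ hη ((min_le_left _ _).trans (min_le_left _ _))
      (main _ hη ((min_le_left _ _).trans (min_le_left _ _))
        ((min_le_left _ _).trans (min_le_right _ _))) fun t ht => ?_
    have ht' : |t - t₀| < min (min ε δ) δ' := abs_lt.2 ⟨by linarith [ht.1], by linarith [ht.2]⟩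
    have h1 := abs_lt.1 (ht'.trans_le ((min_le_left _ _).trans (min_le_left _ _)))
    rw [hγ t ⟨by linarith, by linarith⟩]
    exact hball' (ht'.trans_le (min_le_right _ _))
  · obtain ⟨δ', hδ', hball'⟩ := Metric.eventually_nhds_iff.1 (hc.eventually hp)
    have hη : 0 < min (min ε δ) δ' := lt_min (lt_min hε hδ) hδ'
    refine finish _ _ _ hη ((min_le_left _ _).trans (min_le_left _ _))
      ((main _ hη ((min_le_left _ _).trans (min_le_left _ _))
        ((min_le_left _ _).trans (min_le_right _ _))).reflect hΛ) fun t ht => ?_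
    have ht' : |t - t₀| < min (min ε δ) δ' := abs_lt.2 ⟨by linarith [ht.1], by linarith [ht.2]⟩
    have h1 := abs_lt.1 (ht'.trans_le ((min_le_left _ _).trans (min_le_left _ _)))
    rw [hγ t ⟨by linarith, by linarith⟩]
    exact hball' (ht'.trans_le (min_le_right _ _))

theorem _root_.ImpulsiveWave.continuousAt_omega (hH : IsProfile H (regularSet Λ)) {x : Coord}
    (hx : spatial x ∈ regularSet Λ) : ContinuousAt (omega Λ H) x := by
  have hG : ContinuousAt (fun y => funG H (spatial y)) x := by
    have h := hH.contDiffAt hx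
    have h0 := (contDiffAt_comp_spatial h).continuousAt
    have h1 := fun i => (contDiffAt_comp_spatial (contDiffAt_pd h i)).continuousAt
    have h2 : ∀ i, ContinuousAt (fun y : Coord => spatial y i) x := fun i =>
      (continuous_pi_iff.1 continuous_spatial i).continuousAt
    simp only [funG, Fin.sum_univ_two]
    exact h0.sub (((h2 0).mul (h1 0)).add ((h2 1).mul (h1 1)))
  have hk : Continuous kink := by unfold kink; fun_prop
  have hk' : ContinuousAt (fun y : Coord => kink (y 0)) x :=
    (hk.comp (continuous_apply 0)).continuousAt
  have hq : Continuous fun y : Coord => y 2 ^ 2 + y 3 ^ 2 - 2 * y 0 * y 1 := by fun_prop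
  exact continuousAt_const.add (continuousAt_const.mul
    (hq.continuousAt.sub ((continuousAt_const.mul hk').mul hG)))

/-- The place in the background may jump by a shift of `Ṽ` at the impulse, but `Ũ = U/ω` is
continuous. This is the continuity available for the propagation arguments. -/
theorem continuousAt_zero (hH : IsProfile H (regularSet Λ)) (h : IsGeodesic Λ H I γ)
    {t₀ : ℝ} (ht₀ : t₀ ∈ I) : ContinuousAt (fun t => γ t 0) t₀ := by
  by_cases h0 : γ t₀ 0 = 0
  swap
  · obtain ⟨ε, hε, -, hB⟩ := h.exists_isBackgroundGeodesic hH ht₀ h0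
    exact (continuousAt_pi.1 (hB t₀ ⟨by linarith, by linarith⟩).2.2.1.continuousAt 0)
  obtain ⟨k, ε, w, hε, hεI, hw, hγ⟩ := h.locally_solution t₀ ht₀
  have ht₀ε : t₀ ∈ Ioo (t₀ - ε) (t₀ + ε) := ⟨by linarith, by linarith⟩
  have hx := (hw.mem t₀ ht₀ε).1
  have hx0 : (w t₀).1 0 = 0 := by rwa [hγ t₀ ht₀ε, Chart.point_eq_zero_iff hx] at h0
  obtain rfl := Chart.eq_wave hx hx0
  have hc : ContinuousAt (fun t => (w t).1) t₀ := continuous_fst.continuousAt.comp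
    ((hw.continuousOn).continuousAt (Ioo_mem_nhds ht₀ε.1 ht₀ε.2))
  have hom : ContinuousAt (fun t => omega Λ H (w t).1) t₀ :=
    ContinuousAt.comp (f := fun t => (w t).1) (x := t₀)
      (continuousAt_omega hH (hx.2.2.resolve_left hx0.not_lt)) hc
  refine ((hom.inv₀ hx.1).mul (continuousAt_pi.1 hc 0)).congr ?_
  filter_upwards [Ioo_mem_nhds ht₀ε.1 ht₀ε.2] with t ht
  rw [hγ t ht]
  simp [Chart.point, stereo, bigOmega_toConformal, toConformal_apply_zero]

theorem eventually_ne_zero (hH : IsProfile H (regularSet Λ)) (h : IsGeodesic Λ H I γ)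
    {t₀ : ℝ} (ht₀ : t₀ ∈ I) (h0 : γ t₀ 0 ≠ 0) : ∀ᶠ t in 𝓝 t₀, γ t 0 ≠ 0 :=
  (h.continuousAt_zero hH ht₀).eventually_ne h0

theorem mem_of_abs_lt {a ε t : ℝ} (h : |t - a| < ε) : t ∈ Ioo (a - ε) (a + ε) := by
  have := abs_lt.1 h
  exact ⟨by linarith, by linarith⟩

/-- Degeneracy propagates inside a chart by `IsWaveSolution.degenerate` and from chart to chart in
the invariant form below. It would confine `γ` to the wave surface, against `h0`. -/
theorem not_degenerate (hH : IsProfile H (regularSet Λ)) (h : IsGeodesic Λ H I γ)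
    {t₀ : ℝ} (ht₀ : t₀ ∈ I) (h0 : γ t₀ 0 ≠ 0) {J : Set ℝ} {w : ℝ → Phase} (hJ : IsOpen J)
    (hJ' : J.OrdConnected) (hJI : J ⊆ I) (hw : IsWaveSolution Λ H J w)
    (hγ : ∀ t ∈ J, γ t = Chart.wave.point Λ H (w t).1) : ∀ t ∈ J, ¬ Degenerate (w t) := by
  intro a ha hdeg
  have key : ∀ (J : Set ℝ) (w : ℝ → Phase), IsOpen J → J.OrdConnected → IsWaveSolution Λ H J w →
      (∀ t ∈ J, γ t = Chart.wave.point Λ H (w t).1) → ∀ a ∈ J, Degenerate (w a) →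
      ∀ b ∈ J, ∀ᶠ s in 𝓝 b, γ s 0 = 0 := by
    intro J w hJ hJ' hw hγ a ha hdeg b hb
    filter_upwards [hJ.mem_nhds hb] with s hs
    rw [hγ s hs, Chart.point_eq_zero_iff (k := .wave) (hw.mem s hs).1]
    exact (hw.degenerate hH hJ' ha hdeg s hs).1
  -- The chart-independent form of degeneracy: `Ũ` vanishes in a neighbourhood of the time. In any
  -- chart this gives both `U = 0` and `U' = 0`.
  refine h0 (forall_of_locally_all_or_none (P := fun t => ∀ᶠ s in 𝓝 t, γ s 0 = 0) h.ordConnected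
    (hJI ha) (key J w hJ hJ' hw hγ a ha hdeg a ha) (fun τ hτ => ?_) t₀ ht₀).self_of_nhds
  obtain ⟨k, ε, w, hε, hεI, hw, hγ⟩ := h.locally_solution τ hτ
  refine ⟨ε, hε, fun a _ haε hPa b _ hbε => ?_⟩
  have ha := mem_of_abs_lt haε
  have hx0 : (w a).1 0 = 0 := by
    have := hPa.self_of_nhds
    rwa [hγ a ha, Chart.point_eq_zero_iff (hw.mem a ha).1] at this
  obtain rfl := Chart.eq_wave (hw.mem a ha).1 hx0
  refine key _ w isOpen_Ioo ordConnected_Ioo hw hγ a ha ⟨hx0, ?_⟩ b (mem_of_abs_lt hbε)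
  have hd : HasDerivAt (fun t => (w t).1 0) ((w a).2 0) a := hasDerivAt_pi.1
    ((hw.hasDerivWithinAt_fst ordConnected_Ioo ha).hasDerivAt (isOpen_Ioo.mem_nhds ha)) 0
  refine hd.unique ((hasDerivAt_const a 0).congr_of_eventuallyEq ?_)
  filter_upwards [hPa, isOpen_Ioo.mem_nhds ha] with s hs hs'
  rwa [hγ s hs', Chart.point_eq_zero_iff (hw.mem s hs').1] at hs

end IsGeodesic

/-! ### Crossing the wave surface -/

/-- The point of the background with given coordinates on one side of the impulse. -/
def sidePoint (Λ : ℝ) (H : (Fin 2 → ℝ) → ℝ) (b : Bool) (w : Phase) : Ambient :=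
  stereo Λ (plusMap (sideProfile H b) w.1)

/-- The velocity in the background with given coordinates on one side of the impulse. -/
def sideVel (Λ : ℝ) (H : (Fin 2 → ℝ) → ℝ) (b : Bool) (w : Phase) : Ambient :=
  stereoVel Λ (plusMap (sideProfile H b) w.1) (fderiv ℝ (plusMap (sideProfile H b)) w.1 w.2)

section Side

variable {Λ : ℝ} {H : (Fin 2 → ℝ) → ℝ}

theorem IsProfile.fderiv_plusMap_zero {R : Set (Fin 2 → ℝ)} (hH : IsProfile H R) {x : Coord}
    (hx : spatial x ∈ R) (u : Coord) : fderiv ℝ (plusMap H) x u 0 = u 0 := by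
  rw [hH.fderiv_plusMap hx]; rfl

theorem plusMap_apply_zero (H : (Fin 2 → ℝ) → ℝ) (x : Coord) : plusMap H x 0 = x 0 := rfl

theorem sidePoint_apply_zero {b : Bool} {w : Phase} (hw : w.1 ∈ sideDomain Λ H b) :
    sidePoint Λ H b w 0 = 0 ↔ w.1 0 = 0 := by
  have h := bigOmega_plusMap_ne_zero hw
  simp [sidePoint, stereo, h, plusMap_apply_zero]

theorem sideVel_apply_zero (hH : IsProfile H (regularSet Λ)) {b : Bool} {w : Phase}
    (hw : w.1 ∈ sideDomain Λ H b) (h0 : w.1 0 = 0) : sideVel Λ H b w 0 =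
      (bigOmega Λ (plusMap (sideProfile H b) w.1))⁻¹ * w.2 0 := by
  simp [sideVel, stereoVel, plusMap_apply_zero, h0,
    (isProfile_side hH b).fderiv_plusMap_zero hw.2.2]

/-- On `U = 0` the map is the shear `V ↦ V + H(X, Y)`. -/
theorem plusMap_injOn_zero {H : (Fin 2 → ℝ) → ℝ} {x x' : Coord} (h0 : x 0 = 0) (h0' : x' 0 = 0)
    (h : plusMap H x = plusMap H x') : x = x' := by
  have h2 : x 2 = x' 2 := by simpa [plusMap, h0, h0'] using congrFun h 2
  have h3 : x 3 = x' 3 := by simpa [plusMap, h0, h0'] using congrFun h 3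
  have hs : spatial x = spatial x' := by simp [spatial, h2, h3]
  have h1 : x 1 = x' 1 := by simpa [plusMap, h0, h0', hs] using congrFun h 1
  funext i
  fin_cases i
  · exact h0.trans h0'.symm
  · exact h1
  · exact h2
  · exact h3

/-- At `U = 0` the Jacobian is unipotent triangular in the order `U`, `X`, `Y`, `V`. -/
theorem IsProfile.fderiv_plusMap_injective {R : Set (Fin 2 → ℝ)} (hH : IsProfile H R) {x : Coord}
    (hx : spatial x ∈ R) (h0 : x 0 = 0) {u u' : Coord}
    (h : fderiv ℝ (plusMap H) x u = fderiv ℝ (plusMap H) x u') : u = u' := by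
  rw [hH.fderiv_plusMap hx, hH.fderiv_plusMap hx] at h
  have g0 : u 0 = u' 0 := congrFun h 0
  have g2 : u 2 = u' 2 := by simpa [h0, g0] using congrFun h 2
  have g3 : u 3 = u' 3 := by simpa [h0, g0] using congrFun h 3
  have g1 : u 1 = u' 1 := by simpa [h0, g0, g2, g3] using congrFun h 1
  funext i
  fin_cases i
  · exact g0
  · exact g1
  · exact g2
  · exact g3

theorem eq_of_sidePoint_eq (hH : IsProfile H (regularSet Λ)) {b : Bool} {w w' : Phase}
    (hw : w.1 ∈ sideDomain Λ H b) (h0 : w.1 0 = 0) (h0' : w'.1 0 = 0)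
    (hP : sidePoint Λ H b w = sidePoint Λ H b w') (hV : sideVel Λ H b w = sideVel Λ H b w') :
    w = w' := by
  have hO := bigOmega_plusMap_ne_zero hw
  have h1 := plusMap_injOn_zero h0 h0' (stereo_injOn hO hP)
  refine Prod.ext h1 ?_
  rw [sideVel, sideVel, ← h1] at hV
  exact (isProfile_side hH b).fderiv_plusMap_injective hw.2.2 h0 (stereoVel_injective hO hV)

/-- The right-hand side does not involve `b`: the metric is continuous, so `κ` is the same on both
sides although the background velocity may jump. -/
theorem curvature_sideVel (hH : IsProfile H (regularSet Λ)) {w : Phase}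
    (hw : w.1 ∈ waveDomain Λ H) (h0 : w.1 0 = 0) (b : Bool) : curvature Λ (sideVel Λ H b w) =
      Λ / 3 * metricForm (waveMetric Λ H) w.1 w.2 w.2 := by
  have hm := mem_sideDomain_of_eq_zero hw h0 b
  rw [sideVel, curvature_stereoVel (bigOmega_plusMap_ne_zero hm),
    ← (isProfile_side hH b).metricForm_plusMetric hm.2.2]
  have : plusMetric Λ (sideProfile H b) w.1 = waveMetric Λ H w.1 := by
    cases b
    · exact (waveMetric_of_nonpos Λ H h0.le).symm
    · exact (waveMetric_of_nonneg Λ H h0.ge).symm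
  simp only [metricForm, this]

theorem IsNormalForm.isBackgroundGeodesic (hH : IsProfile H (regularSet Λ)) {τ ε : ℝ} {y : Phase}
    {side : Bool → Bool} {W : Bool → ℝ → Phase} (h : IsNormalForm Λ H τ y ε side W) (d : Bool) :
    IsBackgroundGeodesic Λ (Ioo (τ - ε) (τ + ε)) (fun t => sidePoint Λ H (side d) (W d t))
      (fun t => sideVel Λ H (side d) (W d t)) :=
  (isProfile_side hH (side d)).isBackgroundGeodesic fun t ht => ⟨h.mem d t ht, h.hasDerivAt d t ht⟩

theorem IsNormalForm.point_glue {τ ε : ℝ} {y : Phase} {side : Bool → Bool} {W : Bool → ℝ → Phase}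
    (h : IsNormalForm Λ H τ y ε side W) {d : Bool} {t : ℝ} (ht : t ∈ Ioo (τ - ε) (τ + ε))
    (hd : OnSide d (t - τ)) :
    Chart.wave.point Λ H (glue τ W t).1 = sidePoint Λ H (side d) (W d t) := by
  rw [IsNormalForm.glue_of_onSide hd, sidePoint, ← toConformal_eq (h.onSide d t ht hd)]
  rfl

/-- The geodesic `γ` crosses the wave surface at the time `τ`. -/
structure IsCrossing (Λ : ℝ) (H : (Fin 2 → ℝ) → ℝ) (I : Set ℝ) (γ : ℝ → Ambient) (τ δ : ℝ)
    (y : Phase) (side : Bool → Bool) (W : Bool → ℝ → Phase) : Prop where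
  normalForm : IsNormalForm Λ H τ y δ side W
  subset : Ioo (τ - δ) (τ + δ) ⊆ I
  mem : y.1 ∈ waveDomain Λ H
  zero : y.1 0 = 0
  vel : y.2 0 ≠ 0
  eq : ∀ t ∈ Ioo (τ - δ) (τ + δ), γ t = Chart.wave.point Λ H (glue τ W t).1

namespace IsCrossing

variable {I : Set ℝ} {γ : ℝ → Ambient} {τ δ : ℝ} {y : Phase} {side : Bool → Bool}
  {W : Bool → ℝ → Phase}

theorem mono (h : IsCrossing Λ H I γ τ δ y side W) {δ' : ℝ} (hδ : 0 < δ') (hδδ : δ' ≤ δ) :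
    IsCrossing Λ H I γ τ δ' y side W := by
  have hsub : Ioo (τ - δ') (τ + δ') ⊆ Ioo (τ - δ) (τ + δ) :=
    Ioo_subset_Ioo (by linarith) (by linarith)
  exact ⟨h.normalForm.mono hδ hδδ, hsub.trans h.subset, h.mem, h.zero, h.vel,
    fun t ht => h.eq t (hsub ht)⟩

theorem mem_Ioo (h : IsCrossing Λ H I γ τ δ y side W) : τ ∈ Ioo (τ - δ) (τ + δ) := by
  have := h.normalForm.pos
  exact ⟨by linarith, by linarith⟩

theorem not_degenerate (h : IsCrossing Λ H I γ τ δ y side W) : ¬ Degenerate y :=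
  fun hy => h.vel hy.2

theorem eventually_eq (h : IsCrossing Λ H I γ τ δ y side W) {d : Bool} {t : ℝ}
    (ht : t ∈ Ioo (τ - δ) (τ + δ)) (hd : OnSide d (t - τ)) :
    ∀ᶠ s in 𝓝 t, γ s = sidePoint Λ H (side d) (W d s) := by
  have hc : ContinuousAt (fun t : ℝ => t - τ) t := by fun_prop
  filter_upwards [hc.eventually hd.eventually, isOpen_Ioo.mem_nhds ht] with s hs hs'
  rw [h.eq s hs', h.normalForm.point_glue hs' hs]

theorem ne_zero (h : IsCrossing Λ H I γ τ δ y side W) {t : ℝ} (ht : t ∈ Ioo (τ - δ) (τ + δ))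
    (hne : t ≠ τ) : γ t 0 ≠ 0 := by
  obtain ⟨d, hd⟩ := exists_onSide (sub_ne_zero.2 hne)
  rw [(h.eventually_eq ht hd).self_of_nhds, Ne, sidePoint_apply_zero (h.normalForm.mem d t ht)]
  exact (h.normalForm.onSide d t ht hd).ne_zero

theorem deriv_eq (hH : IsProfile H (regularSet Λ)) (h : IsCrossing Λ H I γ τ δ y side W) {d : Bool}
    {t : ℝ} (ht : t ∈ Ioo (τ - δ) (τ + δ)) (hd : OnSide d (t - τ)) :
    deriv γ t = sideVel Λ H (side d) (W d t) :=
  ((h.normalForm.isBackgroundGeodesic hH d t ht).2.2.1.congr_of_eventuallyEq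
    (h.eventually_eq ht hd)).deriv

theorem curvature_deriv (hH : IsProfile H (regularSet Λ)) (h : IsCrossing Λ H I γ τ δ y side W)
    {t : ℝ} (ht : t ∈ Ioo (τ - δ) (τ + δ)) (hne : t ≠ τ) : curvature Λ (deriv γ t) =
      Λ / 3 * metricForm (waveMetric Λ H) y.1 y.2 y.2 := by
  obtain ⟨d, hd⟩ := exists_onSide (sub_ne_zero.2 hne)
  rw [h.deriv_eq hH ht hd, (h.normalForm.isBackgroundGeodesic hH d).curvature_eq isOpen_Ioo
    ordConnected_Ioo h.mem_Ioo ht, h.normalForm.eq d, curvature_sideVel hH h.mem h.zero]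

end IsCrossing

end Side

theorem eventually_glue {τ : ℝ} {W : Bool → ℝ → Phase} {w : ℝ → Phase} {y : Phase}
    (hW : ∀ d, W d τ = y) (hw : w τ = y)
    (h : ∀ d, ∀ᶠ t in 𝓝 τ, OnSide d (t - τ) → w t = W d t) : ∀ᶠ t in 𝓝 τ, w t = glue τ W t := by
  filter_upwards [h false, h true] with t h1 h2
  by_cases hne : t = τ
  · rw [hne, glue, if_pos le_rfl, hW, hw]
  · obtain ⟨d, hd⟩ := exists_onSide (sub_ne_zero.2 hne)
    rw [IsNormalForm.glue_of_onSide hd]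
    cases d
    · exact h1 hd
    · exact h2 hd

/-! ### Conservation of the norm, spacing of the crossings, and uniqueness of geodesics -/

namespace IsGeodesic

variable {Λ : ℝ} {H : (Fin 2 → ℝ) → ℝ} {I : Set ℝ} {γ : ℝ → Ambient}

theorem exists_isCrossing (hH : IsProfile H (regularSet Λ)) (h : IsGeodesic Λ H I γ)
    {t₀ : ℝ} (ht₀ : t₀ ∈ I) (h0 : γ t₀ 0 ≠ 0) {τ : ℝ} (hτ : τ ∈ I) (hz : γ τ 0 = 0) :
    ∃ δ y side W, IsCrossing Λ H I γ τ δ y side W := by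
  obtain ⟨k, ε, w, hε, hεI, hw, hγ⟩ := h.locally_solution τ hτ
  have hτε : τ ∈ Ioo (τ - ε) (τ + ε) := ⟨by linarith, by linarith⟩
  have hx := (hw.mem τ hτε).1
  have hx0 : (w τ).1 0 = 0 := by rwa [hγ τ hτε, Chart.point_eq_zero_iff hx] at hz
  obtain rfl := Chart.eq_wave hx hx0
  have hnd := h.not_degenerate hH ht₀ h0 isOpen_Ioo ordConnected_Ioo hεI hw hγ τ hτε
  obtain ⟨r, side, W, hW⟩ := exists_normalForm hH hx hnd τ
  have hev := eventually_glue (w := w) hW.eq rfl fun d => by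
    have := hW.eventually_eq _ w ordConnected_Ioo hτε hw rfl d
    rwa [isOpen_Ioo.nhdsWithin_eq hτε] at this
  obtain ⟨δ, hδ, hball⟩ := Metric.eventually_nhds_iff.1 hev
  have hm : 0 < min (min r δ) ε := lt_min (lt_min hW.pos hδ) hε
  have hsub : Ioo (τ - min (min r δ) ε) (τ + min (min r δ) ε) ⊆ Ioo (τ - ε) (τ + ε) :=
    Ioo_subset_Ioo (by linarith [min_le_right (min r δ) ε]) (by linarith [min_le_right (min r δ) ε])
  refine ⟨min (min r δ) ε, w τ, side, W,
    hW.mono hm ((min_le_left _ _).trans (min_le_left _ _)), hsub.trans hεI, hx, hx0,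
    fun hv => hnd ⟨hx0, hv⟩, fun t ht => ?_⟩
  have ht' : |t - τ| < min (min r δ) ε := abs_lt.2 ⟨by linarith [ht.1], by linarith [ht.2]⟩
  rw [hγ t (hsub ht), hball (ht'.trans_le ((min_le_left _ _).trans (min_le_right _ _)))]

/-- The time `τ` is left out because the background position may jump there, and then `deriv γ τ`
has no meaning. -/
theorem exists_curvature_near (hH : IsProfile H (regularSet Λ)) (h : IsGeodesic Λ H I γ)
    {t₀ : ℝ} (ht₀ : t₀ ∈ I) (h0 : γ t₀ 0 ≠ 0) {τ : ℝ} (hτ : τ ∈ I) :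
    ∃ δ > 0, ∃ c, ∀ s ∈ Ioo (τ - δ) (τ + δ), s ≠ τ → γ s 0 ≠ 0 ∧ curvature Λ (deriv γ s) = c := by
  by_cases hz : γ τ 0 = 0
  · obtain ⟨δ, y, side, W, hc⟩ := h.exists_isCrossing hH ht₀ h0 hτ hz
    exact ⟨δ, hc.normalForm.pos, _, fun s hs hne => ⟨hc.ne_zero hs hne, hc.curvature_deriv hH hs hne⟩⟩
  · obtain ⟨ε, hε, hεI, hB⟩ := h.exists_isBackgroundGeodesic hH hτ hz
    obtain ⟨δ, hδ, hball⟩ := Metric.eventually_nhds_iff.1 (h.eventually_ne_zero hH hτ hz)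
    refine ⟨min ε δ, lt_min hε hδ, curvature Λ (deriv γ τ), fun s hs _ => ?_⟩
    have hs' : |s - τ| < min ε δ := abs_lt.2 ⟨by linarith [hs.1], by linarith [hs.2]⟩
    exact ⟨hball (hs'.trans_le (min_le_right _ _)), hB.curvature_eq isOpen_Ioo ordConnected_Ioo
      (mem_of_abs_lt (by simpa using hε)) (mem_of_abs_lt (hs'.trans_le (min_le_left _ _)))⟩

/-- The norm of the velocity is constant. -/
theorem curvature_eq (hH : IsProfile H (regularSet Λ)) (h : IsGeodesic Λ H I γ)
    {t₀ : ℝ} (ht₀ : t₀ ∈ I) (h0 : γ t₀ 0 ≠ 0) {t : ℝ} (ht : t ∈ I) (h1 : γ t 0 ≠ 0) :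
    curvature Λ (deriv γ t) = curvature Λ (deriv γ t₀) := by
  have near : ∀ t ∈ I, γ t 0 ≠ 0 →
      ∀ᶠ s in 𝓝 t, γ s 0 ≠ 0 ∧ curvature Λ (deriv γ s) = curvature Λ (deriv γ t) := by
    intro t ht h1
    obtain ⟨ε, hε, hεI, hB⟩ := h.exists_isBackgroundGeodesic hH ht h1
    filter_upwards [h.eventually_ne_zero hH ht h1,
      Ioo_mem_nhds (show t - ε < t by linarith) (show t < t + ε by linarith)] with s hs hs'
    exact ⟨hs, hB.curvature_eq isOpen_Ioo ordConnected_Ioo (mem_of_abs_lt (by simpa using hε)) hs'⟩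
  -- Punctured neighbourhoods avoid the crossing times, where the derivative of `γ` may not exist.
  have main := forall_of_locally_all_or_none
    (P := fun t => ∀ᶠ s in 𝓝[≠] t, curvature Λ (deriv γ s) = curvature Λ (deriv γ t₀))
    h.ordConnected ht₀ (((near t₀ ht₀ h0).mono fun s hs => hs.2).filter_mono nhdsWithin_le_nhds)
    (fun τ hτ => ?_) t ht
  · obtain ⟨s, h2, h3⟩ := (main.and
      ((near t ht h1).filter_mono nhdsWithin_le_nhds)).exists
    rw [← h3.2, h2]
  · obtain ⟨δ, hδ, c, hc⟩ := h.exists_curvature_near hH ht₀ h0 hτ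
    refine ⟨δ, hδ, fun a _ haδ hPa b _ hbδ => ?_⟩
    have hev : ∀ a, |a - τ| < δ → ∀ᶠ s in 𝓝[≠] a, curvature Λ (deriv γ s) = c := by
      intro a ha
      have e1 : ∀ᶠ s in 𝓝[≠] a, s ∈ Ioo (τ - δ) (τ + δ) :=
        mem_nhdsWithin_of_mem_nhds (isOpen_Ioo.mem_nhds (mem_of_abs_lt ha))
      have e2 : ∀ᶠ s in 𝓝[≠] a, s ≠ τ := by
        by_cases haτ : a = τ
        · rw [haτ]; exact self_mem_nhdsWithin
        · exact mem_nhdsWithin_of_mem_nhds (isOpen_ne.mem_nhds haτ)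
      filter_upwards [e1, e2] with s h1 h2 using (hc s h1 h2).2
    obtain ⟨s, h2, h3⟩ := (hPa.and (hev a haδ)).exists
    rw [← h2, h3]
    exact hev b hbδ

/-- Off the wave surface, a geodesic agrees with a geodesic of the background. -/
theorem eqOn_isBackgroundGeodesic (hH : IsProfile H (regularSet Λ)) (h : IsGeodesic Λ H I γ)
    {F F' : ℝ → Ambient} (hF : IsBackgroundGeodesic Λ univ F F') {J : Set ℝ}
    (hJ : J.OrdConnected) (hJI : J ⊆ I) (hne : ∀ t ∈ J, γ t 0 ≠ 0 ∨ F t 0 ≠ 0) {t₀ : ℝ}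
    (ht₀ : t₀ ∈ J) (h0 : ∀ᶠ s in 𝓝 t₀, γ s = F s) : EqOn γ F J := by
  refine fun t ht => (forall_of_locally_all_or_none (P := fun t => ∀ᶠ s in 𝓝 t, γ s = F s) hJ
    ht₀ h0 (fun τ hτ => ?_) t ht).self_of_nhds
  by_cases hz : γ τ 0 = 0
  -- Here `γ` and `F` have different `Ũ` at `τ`, hence by continuity near `τ`, so agreement holds
  -- nowhere near `τ`.
  · have hFz := (hne τ hτ).resolve_left (not_not.2 hz)
    have hFc : ContinuousAt (fun t => F t 0) τ :=
      continuousAt_pi.1 (hF τ trivial).2.2.1.continuousAt 0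
    have hev : ∀ᶠ s in 𝓝 τ, γ s 0 - F s 0 ≠ 0 :=
      ((h.continuousAt_zero hH (hJI hτ)).sub hFc).eventually_ne (by simpa [hz] using hFz)
    obtain ⟨ε, hε, hball⟩ := Metric.eventually_nhds_iff.1 hev
    refine ⟨ε, hε, fun a _ haε hPa => absurd ?_ (hball haε)⟩
    rw [hPa.self_of_nhds, sub_self]
  · obtain ⟨ε, hε, hεI, hB⟩ := h.exists_isBackgroundGeodesic hH (hJI hτ) hz
    refine ⟨ε, hε, fun a _ haε hPa b _ hbε => ?_⟩
    have ha := mem_of_abs_lt haε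
    have hd : deriv γ a = F' a :=
      ((hF a trivial).2.2.1.congr_of_eventuallyEq hPa).deriv
    exact ((hB.eqOn (hF.mono (subset_univ _)) isOpen_Ioo ordConnected_Ioo ha hPa.self_of_nhds
      hd).1).eventuallyEq_of_mem (isOpen_Ioo.mem_nhds (mem_of_abs_lt hbε))

theorem _root_.ImpulsiveWave.flow_apply_zero (κ : ℝ) {P : Ambient} (hP : P 0 = 0) (Q : Ambient)
    (t : ℝ) : flow κ P Q t 0 = gensin κ t * Q 0 := by
  show 0 + (gencos κ t * (P 0 - 0) + gensin κ t * Q 0) = _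
  rw [hP]
  ring

/-- The crossings of the wave surface do not accumulate. -/
theorem exists_ne_zero (hH : IsProfile H (regularSet Λ)) (h : IsGeodesic Λ H I γ)
    {t₀ : ℝ} (ht₀ : t₀ ∈ I) (h0 : γ t₀ 0 ≠ 0) :
    ∃ r > 0, ∀ τ ∈ I, γ τ 0 = 0 → ∀ t ∈ I, τ < t → t < τ + r → γ t 0 ≠ 0 := by
  -- One `r` serves for all crossings, since `κ` is the same along the whole geodesic.
  obtain ⟨r, hr, hsin⟩ := exists_gensin_ne_zero (curvature Λ (deriv γ t₀))
  refine ⟨r, hr, fun τ hτ hz t ht hτt htr => ?_⟩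
  obtain ⟨δ, y, side, W, hc⟩ := h.exists_isCrossing hH ht₀ h0 hτ hz
  have hδ := hc.normalForm.pos
  have hB := hc.normalForm.isBackgroundGeodesic hH true
  have hm := mem_sideDomain_of_eq_zero hc.mem hc.zero (side true)
  set P := sidePoint Λ H (side true) y with hP
  set Q := sideVel Λ H (side true) y with hQ
  obtain ⟨hP1, hQ1, -, -⟩ := hB τ hc.mem_Ioo
  simp only [hc.normalForm.eq, ← hP, ← hQ] at hP1 hQ1
  have hside : ∀ s, τ < s → OnSide true (s - τ) := fun s hs => sub_pos.2 hs
  have hκ : curvature Λ Q = curvature Λ (deriv γ t₀) := by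
    have hs : τ + δ / 2 ∈ Ioo (τ - δ) (τ + δ) := ⟨by linarith, by linarith⟩
    have hne : τ + δ / 2 ≠ τ := by linarith
    rw [← h.curvature_eq hH ht₀ h0 (hc.subset hs) (hc.ne_zero hs hne),
      hc.deriv_eq hH hs (hside _ (by linarith)),
      hB.curvature_eq isOpen_Ioo ordConnected_Ioo hc.mem_Ioo hs, hc.normalForm.eq]
  have hP0 : P 0 = 0 := (sidePoint_apply_zero hm).2 hc.zero
  have hQ0 : Q 0 ≠ 0 := by
    rw [hQ, sideVel_apply_zero hH hm hc.zero]
    exact mul_ne_zero (inv_ne_zero (bigOmega_plusMap_ne_zero hm)) hc.vel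
  have hF := isBackgroundGeodesic_flow hP1 hQ1 τ
  have hFne : ∀ s, τ < s → s < τ + r → flow (curvature Λ Q) P Q (s - τ) 0 ≠ 0 := fun s h1 h2 => by
    rw [flow_apply_zero _ hP0, hκ]
    exact mul_ne_zero (hsin _ (by linarith) (by linarith)) hQ0
  have hFW : ∀ s ∈ Ioo (τ - δ) (τ + δ),
      sidePoint Λ H (side true) (W true s) = flow (curvature Λ Q) P Q (s - τ) := fun s hs => by
    have := (hB.eq_flow isOpen_Ioo ordConnected_Ioo hc.mem_Ioo hs).1
    rwa [hc.normalForm.eq] at this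
  obtain ⟨a, ha1, ha2⟩ : ∃ a, τ < a ∧ a < min t (τ + δ) :=
    exists_between (lt_min hτt (by linarith))
  have ha3 : a ∈ Ioo (τ - δ) (τ + δ) :=
    ⟨by linarith, ha2.trans_le (min_le_right _ _)⟩
  have hat := ha2.trans_le (min_le_left _ _)
  -- The comparison starts at a time `a` just after the crossing. The flow issuing from the crossing
  -- has `Ũ ≠ 0` up to `τ + r`, so it cannot be left before.
  have heq := h.eqOn_isBackgroundGeodesic hH hF (J := Icc a t) ordConnected_Icc
    (h.ordConnected.out (hc.subset ha3) ht)
    (fun s hs => .inr (hFne s (by linarith [hs.1]) (by linarith [hs.2]))) ⟨le_rfl, hat.le⟩ ?_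
  · rw [heq ⟨hat.le, le_rfl⟩]
    exact hFne t hτt htr
  · filter_upwards [hc.eventually_eq ha3 (hside a ha1), isOpen_Ioo.mem_nhds ha3] with s hs hs'
    rw [hs, hFW s hs']

/-- Before the end of its interval, a geodesic is a geodesic of the background. -/
theorem exists_eqOn_flow (hH : IsProfile H (regularSet Λ)) (h : IsGeodesic Λ H I γ)
    {t₀ : ℝ} (ht₀ : t₀ ∈ I) (h0 : γ t₀ 0 ≠ 0) {β : ℝ} (hβ : IsLUB I β) :
    ∃ a < β, Ioo a β ⊆ I ∧ (∀ t ∈ Ioo a β, γ t 0 ≠ 0) ∧ ∃ F F' : ℝ → Ambient,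
      IsBackgroundGeodesic Λ univ F F' ∧ EqOn γ F (Ioo a β) := by
  have hlt : ∀ t ∈ I, t < β := fun t ht => by
    obtain ⟨ε, hε, hb⟩ := Metric.isOpen_iff.1 h.isOpen t ht
    have := hβ.1 (hb (show t + ε / 2 ∈ ball t ε by simp [abs_of_pos hε, hε]))
    linarith
  have hsub : ∀ t ∈ I, Ioo t β ⊆ I := fun t ht s hs => by
    obtain ⟨b, hb, hsb⟩ := (lt_isLUB_iff hβ).1 hs.2
    exact h.ordConnected.out ht hb ⟨hs.1.le, hsb.le⟩
  obtain ⟨r, hr, hzero⟩ := h.exists_ne_zero hH ht₀ h0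
  -- Either some crossing lies within `r` of `β`, and none follows it, or `a` is any time within `r`
  -- of `β`.
  obtain ⟨a, haI, haβ, hne⟩ : ∃ a ∈ I, a < β ∧ ∀ t ∈ Ioo a β, γ t 0 ≠ 0 := by
    by_cases hex : ∃ τ ∈ I, γ τ 0 = 0 ∧ β - r < τ
    · obtain ⟨τ, hτ, hz, hτβ⟩ := hex
      exact ⟨τ, hτ, hlt τ hτ, fun t ht => hzero τ hτ hz t (hsub τ hτ ht) ht.1
        (by linarith [ht.2])⟩
    · obtain ⟨a, ha, hra⟩ := (lt_isLUB_iff hβ).1 (show β - r < β by linarith)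
      exact ⟨a, ha, hlt a ha, fun t ht hz => hex ⟨t, hsub a ha ht, hz, by linarith [ht.1]⟩⟩
  obtain ⟨m, hm⟩ := exists_between haβ
  have hmI := hsub a haI hm
  obtain ⟨ε, hε, hεI, hB⟩ := h.exists_isBackgroundGeodesic hH hmI (hne m hm)
  have hmε : m ∈ Ioo (m - ε) (m + ε) := ⟨by linarith, by linarith⟩
  obtain ⟨hP, hQ, -, -⟩ := hB m hmε
  have hF := isBackgroundGeodesic_flow hP hQ m
  refine ⟨a, haβ, hsub a haI, hne, _, _, hF, h.eqOn_isBackgroundGeodesic hH hF ordConnected_Ioo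
    (hsub a haI) (fun t ht => .inl (hne t ht)) hm ?_⟩
  filter_upwards [isOpen_Ioo.mem_nhds hmε] with s hs
  exact (hB.eq_flow isOpen_Ioo ordConnected_Ioo hmε hs).1

theorem eventually_eq_of_ne_zero (hH : IsProfile H (regularSet Λ)) {I' : Set ℝ} {γ' : ℝ → Ambient}
    (h : IsGeodesic Λ H I γ) (h' : IsGeodesic Λ H I' γ') {τ : ℝ} (hτ : τ ∈ I) (hτ' : τ ∈ I')
    (h0 : γ τ 0 ≠ 0) (h0' : γ' τ 0 ≠ 0) : ∃ ε > 0, ∀ a, |a - τ| < ε → γ a = γ' a →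
      deriv γ a = deriv γ' a → ∀ b, |b - τ| < ε → ∀ᶠ s in 𝓝 b, γ s = γ' s := by
  obtain ⟨ε₁, hε₁, -, hB₁⟩ := h.exists_isBackgroundGeodesic hH hτ h0
  obtain ⟨ε₂, hε₂, -, hB₂⟩ := h'.exists_isBackgroundGeodesic hH hτ' h0'
  have m₁ := min_le_left ε₁ ε₂
  have m₂ := min_le_right ε₁ ε₂
  refine ⟨min ε₁ ε₂, lt_min hε₁ hε₂, fun a ha hv hd b hb => ?_⟩
  have s₁ : Ioo (τ - min ε₁ ε₂) (τ + min ε₁ ε₂) ⊆ Ioo (τ - ε₁) (τ + ε₁) :=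
    Ioo_subset_Ioo (by linarith) (by linarith)
  have s₂ : Ioo (τ - min ε₁ ε₂) (τ + min ε₁ ε₂) ⊆ Ioo (τ - ε₂) (τ + ε₂) :=
    Ioo_subset_Ioo (by linarith) (by linarith)
  exact (((hB₁.mono s₁).eqOn (hB₂.mono s₂) isOpen_Ioo ordConnected_Ioo (mem_of_abs_lt ha) hv
    hd).1).eventuallyEq_of_mem (isOpen_Ioo.mem_nhds (mem_of_abs_lt hb))

/-- With equal states at the crossing, local uniqueness gives agreement. With different states the
geodesics agree near no time close to `τ`: such agreement, followed to `τ` in the background on one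
side, would make the states equal. -/
theorem _root_.ImpulsiveWave.IsCrossing.eventually_eq_of_eq (hH : IsProfile H (regularSet Λ))
    {I' : Set ℝ} {γ' : ℝ → Ambient} {τ δ : ℝ} {y y' : Phase} {side side' : Bool → Bool}
    {W W' : Bool → ℝ → Phase} (h : IsCrossing Λ H I γ τ δ y side W)
    (h' : IsCrossing Λ H I' γ' τ δ y' side' W') : ∃ ε > 0, ∀ a, |a - τ| < ε →
      (∀ᶠ s in 𝓝 a, γ s = γ' s) → ∀ b, |b - τ| < ε → ∀ᶠ s in 𝓝 b, γ s = γ' s := by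
  have hτ := h.mem_Ioo
  by_cases hy : y = y'
  · subst hy
    have hw := h.normalForm.isWaveSolution_glue hH h.mem
    have hw' := h'.normalForm.isWaveSolution_glue hH h'.mem
    have hev := IsWaveSolution.eventually_eq hH ordConnected_Ioo ordConnected_Ioo hτ hτ hw hw'
      (by rw [h.normalForm.glue_self, h'.normalForm.glue_self])
      (by rw [h.normalForm.glue_self]; exact h.not_degenerate)
    rw [inter_self, isOpen_Ioo.nhdsWithin_eq hτ] at hev
    have hev' : ∀ᶠ s in 𝓝 τ, γ s = γ' s := by
      filter_upwards [hev, isOpen_Ioo.mem_nhds hτ] with s hs hs'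
      rw [h.eq s hs', h'.eq s hs', hs]
    obtain ⟨ε, hε, hball⟩ := Metric.eventually_nhds_iff.1 hev'.eventually_nhds
    exact ⟨ε, hε, fun _ _ _ b hb => hball hb⟩
  · refine ⟨δ, h.normalForm.pos, fun a ha hPa => absurd ?_ hy⟩
    have haI := mem_of_abs_lt ha
    obtain ⟨s, hPs, hs, hne⟩ : ∃ s, (∀ᶠ q in 𝓝 s, γ q = γ' q) ∧ s ∈ Ioo (τ - δ) (τ + δ) ∧
        s ≠ τ := by
      -- Agreement near `τ` includes agreement near some other time, at which `γ` is off the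
      -- surface.
      by_cases haτ : a = τ
      · have e1 := (hPa.eventually_nhds.and (isOpen_Ioo.eventually_mem haI)).filter_mono
          (nhdsWithin_le_nhds (s := {a}ᶜ))
        obtain ⟨s, hs, hne⟩ := (e1.and self_mem_nhdsWithin).exists
        exact ⟨s, hs.1, hs.2, fun h => hne (h.trans haτ.symm)⟩
      · exact ⟨a, hPa, haI, haτ⟩
    obtain ⟨d, hd⟩ := exists_onSide (sub_ne_zero.2 hne)
    have hB := h.normalForm.isBackgroundGeodesic hH d
    have hB' := h'.normalForm.isBackgroundGeodesic hH d
    have hv : sidePoint Λ H (side d) (W d s) = sidePoint Λ H (side' d) (W' d s) := by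
      rw [← (h.eventually_eq hs hd).self_of_nhds, ← (h'.eventually_eq hs hd).self_of_nhds]
      exact hPs.self_of_nhds
    have hv' : sideVel Λ H (side d) (W d s) = sideVel Λ H (side' d) (W' d s) := by
      rw [← h.deriv_eq hH hs hd, ← h'.deriv_eq hH hs hd]
      exact EventuallyEq.deriv_eq hPs
    obtain ⟨e1, e2⟩ := hB.eqOn hB' isOpen_Ioo ordConnected_Ioo hs hv hv'
    have e1 := e1 hτ
    have e2 := e2 hτ
    simp only [h.normalForm.eq, h'.normalForm.eq] at e1 e2
    have hm := mem_sideDomain_of_eq_zero h.mem h.zero (side d)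
    have hm' := mem_sideDomain_of_eq_zero h'.mem h'.zero (side' d)
    -- Equal background velocities have the same `U'`, and its sign determines the side.
    have hside : side d = side' d := by
      have hO := bigOmega_plusMap_ne_zero hm
      have hp := stereo_injOn hO e1
      rw [sideVel, sideVel, ← hp] at e2
      have h0 := congrFun (stereoVel_injective hO e2) 0
      rw [(isProfile_side hH _).fderiv_plusMap_zero hm.2.2,
        (isProfile_side hH _).fderiv_plusMap_zero hm'.2.2] at h0
      have k1 := h.normalForm.side_eq h.zero d
      have k2 := h'.normalForm.side_eq h'.zero d
      rw [h0] at k1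
      have := k1.unique k2
      generalize side d = p at this
      generalize side' d = q at this
      revert this
      cases d <;> cases p <;> cases q <;> simp
    rw [← hside] at e1 e2
    exact eq_of_sidePoint_eq hH hm h.zero h'.zero e1 e2

/-- Geodesics are determined by their position and velocity off the wave surface. -/
theorem eqOn (hH : IsProfile H (regularSet Λ)) {I' : Set ℝ} {γ' : ℝ → Ambient}
    (h : IsGeodesic Λ H I γ) (h' : IsGeodesic Λ H I' γ') {t₀ : ℝ} (ht₀ : t₀ ∈ I) (ht₀' : t₀ ∈ I')
    (h0 : γ t₀ 0 ≠ 0) (hp : γ t₀ = γ' t₀) (hv : deriv γ t₀ = deriv γ' t₀) :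
    EqOn γ γ' (I ∩ I') := by
  have h0' : γ' t₀ 0 ≠ 0 := hp ▸ h0
  intro t ht
  refine (forall_of_locally_all_or_none (P := fun t => ∀ᶠ s in 𝓝 t, γ s = γ' s)
    (h.ordConnected.inter h'.ordConnected) ⟨ht₀, ht₀'⟩ ?_ (fun τ hτ => ?_) t ht).self_of_nhds
  · obtain ⟨ε, hε, hall⟩ := h.eventually_eq_of_ne_zero hH h' ht₀ ht₀' h0 h0'
    exact hall t₀ (by simpa using hε) hp hv t₀ (by simpa using hε)
  · suffices hs : ∃ ε > 0, ∀ a, |a - τ| < ε → (∀ᶠ s in 𝓝 a, γ s = γ' s) →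
        ∀ b, |b - τ| < ε → ∀ᶠ s in 𝓝 b, γ s = γ' s by
      obtain ⟨ε, hε, hall⟩ := hs
      exact ⟨ε, hε, fun a _ ha hPa b _ hb => hall a ha hPa b hb⟩
    by_cases hne : γ τ 0 = γ' τ 0
    · by_cases hz : γ τ 0 = 0
      · obtain ⟨δ, y, side, W, hc⟩ := h.exists_isCrossing hH ht₀ h0 hτ.1 hz
        obtain ⟨δ', y', side', W', hc'⟩ := h'.exists_isCrossing hH ht₀' h0' hτ.2 (hne ▸ hz)
        have hm : 0 < min δ δ' := lt_min hc.normalForm.pos hc'.normalForm.pos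
        exact (hc.mono hm (min_le_left _ _)).eventually_eq_of_eq hH (hc'.mono hm (min_le_right _ _))
      · obtain ⟨ε, hε, hall⟩ := h.eventually_eq_of_ne_zero hH h' hτ.1 hτ.2 hz (hne ▸ hz)
        exact ⟨ε, hε, fun a ha hPa => hall a ha hPa.self_of_nhds (EventuallyEq.deriv_eq hPa)⟩
    -- Different values of `Ũ` at `τ` exclude agreement near `τ`.
    · have hev : ∀ᶠ s in 𝓝 τ, γ s 0 - γ' s 0 ≠ 0 :=
        ((h.continuousAt_zero hH hτ.1).sub (h'.continuousAt_zero hH hτ.2)).eventually_ne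
          (sub_ne_zero.2 hne)
      obtain ⟨ε, hε, hball⟩ := Metric.eventually_nhds_iff.1 hev
      refine ⟨ε, hε, fun a ha hPa => absurd ?_ (hball ha)⟩
      rw [hPa.self_of_nhds, sub_self]

end IsGeodesic

/-! ### Reversal of time -/

theorem absolutelyContinuousOnInterval_comp_neg {X : Type*} [PseudoMetricSpace X] {w : ℝ → X}
    {a b : ℝ} (h : AbsolutelyContinuousOnInterval w (-a) (-b)) :
    AbsolutelyContinuousOnInterval (fun t => w (-t)) a b := by
  rw [absolutelyContinuousOnInterval_iff] at h ⊢
  intro ε hε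
  obtain ⟨δ, hδ, H⟩ := h ε hε
  refine ⟨δ, hδ, fun E hE hs => H (E.1, fun i => (-(E.2 i).1, -(E.2 i).2)) ⟨fun i hi => ?_, ?_⟩ ?_⟩
  · have hneg : ∀ x ∈ uIcc a b, -x ∈ uIcc (-a) (-b) := fun x hx => by
      rw [mem_uIcc] at hx ⊢
      rcases hx with ⟨h1, h2⟩ | ⟨h1, h2⟩
      · exact .inr ⟨by linarith, by linarith⟩
      · exact .inl ⟨by linarith, by linarith⟩
    exact ⟨hneg _ (hE.1 i hi).1, hneg _ (hE.1 i hi).2⟩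
  · intro i hi j hj hij
    have := hE.2 hi hj hij
    simp only [Function.onFun, uIoc, Ioc_disjoint_Ioc, max_neg_neg, min_neg_neg, neg_le_neg_iff]
      at this ⊢
    exact this
  · simpa using hs

/-- The reversal of the velocity. -/
def reverse : Phase →L[ℝ] Phase :=
  (ContinuousLinearMap.fst ℝ Coord Coord).prod (-ContinuousLinearMap.snd ℝ Coord Coord)

theorem reverse_apply (w : Phase) : reverse w = (w.1, -w.2) := rfl

theorem geodesicField_reverse (g : Coord → Matrix (Fin 4) (Fin 4) ℝ) (w : Phase) :
    geodesicField g (reverse w) = -reverse (geodesicField g w) := by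
  simp [geodesicField, reverse_apply]

theorem measurePreserving_reverse : MeasurePreserving reverse (volume : Measure Phase) volume :=
  (MeasurePreserving.id (volume : Measure Coord)).prod (Measure.measurePreserving_neg volume)

theorem dist_reverse (w z : Phase) : dist (reverse w) (reverse z) = dist w z := by
  simp [reverse_apply, Prod.dist_eq, dist_neg_neg]

/-- The geodesic field changes sign under `reverse`, which is a linear measure-preserving isometry
and so respects balls, null sets and closed convex hulls. -/
theorem neg_reverse_mem_filippovMap {g : Coord → Matrix (Fin 4) (Fin 4) ℝ} {w d : Phase}
    (hd : d ∈ filippovMap (geodesicField g) w) :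
    -reverse d ∈ filippovMap (geodesicField g) (reverse w) := by
  simp only [filippovMap, mem_iInter] at hd ⊢
  intro δ hδ S hS
  have hS' := measurePreserving_reverse.quasiMeasurePreserving.preimage_null hS
  refine closedConvexHull_min (t := (-reverse) ⁻¹' closedConvexHull ℝ
    (geodesicField g '' (closedBall (reverse w) δ \ S))) ?_ ?_ ?_ (hd δ hδ _ hS')
  · rintro _ ⟨z, hz, rfl⟩
    refine subset_closedConvexHull ⟨reverse z, ⟨?_, hz.2⟩, geodesicField_reverse g z⟩
    rw [mem_closedBall, dist_reverse]
    exact hz.1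
  · exact convex_closedConvexHull.linear_preimage (-reverse).toLinearMap
  · exact isClosed_closedConvexHull.preimage (-reverse).continuous

theorem IsFilippovSolution.reverse {g : Coord → Matrix (Fin 4) (Fin 4) ℝ} {D : Set Coord}
    {I : Set ℝ} {w : ℝ → Phase} (h : IsFilippovSolution (geodesicField g) (D ×ˢ univ) I w) :
    IsFilippovSolution (geodesicField g) (D ×ˢ univ) (Neg.neg ⁻¹' I)
      (fun t => ImpulsiveWave.reverse (w (-t))) where
  mem t ht := ⟨(h.mem (-t) ht).1, trivial⟩
  absCont a ha b hb := absolutelyContinuousOnInterval_clm ImpulsiveWave.reverse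
    (absolutelyContinuousOnInterval_comp_neg (h.absCont (-a) ha (-b) hb))
  inclusion := by
    have h1 := (Measure.measurePreserving_neg (volume : Measure ℝ)).quasiMeasurePreserving.ae
      h.inclusion
    filter_upwards [h1] with t ht htI
    obtain ⟨d, hd, hd'⟩ := ht htI
    refine ⟨_, neg_reverse_mem_filippovMap hd, ?_⟩
    have h2 : HasDerivAt (fun t => w (-t)) (-d) t := by
      have := hd'.scomp t (hasDerivAt_neg t)
      simpa [Function.comp_def] using this
    have h3 := ImpulsiveWave.reverse.hasFDerivAt.comp_hasDerivAt t h2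
    rwa [map_neg] at h3

theorem IsGeodesic.comp_neg {Λ : ℝ} {H : (Fin 2 → ℝ) → ℝ} {I : Set ℝ} {γ : ℝ → Ambient}
    (h : IsGeodesic Λ H I γ) : IsGeodesic Λ H (Neg.neg ⁻¹' I) (fun t => γ (-t)) where
  isOpen := h.isOpen.preimage continuous_neg
  ordConnected := ⟨fun a ha b hb t ht =>
    h.ordConnected.out hb ha ⟨neg_le_neg ht.2, neg_le_neg ht.1⟩⟩
  locally_solution t ht := by
    obtain ⟨k, ε, w, hε, hεI, hw, hγ⟩ := h.locally_solution (-t) ht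
    have hsub : Ioo (t - ε) (t + ε) ⊆ Neg.neg ⁻¹' Ioo (-t - ε) (-t + ε) :=
      fun s hs => ⟨by linarith [hs.2], by linarith [hs.1]⟩
    exact ⟨k, ε, _, hε, hsub.trans (preimage_mono hεI), hw.reverse.mono hsub Subset.rfl,
      fun s hs => hγ (-s) (hsub hs)⟩

theorem neg_preimage_neg_preimage (I : Set ℝ) : Neg.neg ⁻¹' (Neg.neg ⁻¹' I) = I := by
  ext; simp

theorem IsMaximalGeodesic.comp_neg {Λ : ℝ} {H : (Fin 2 → ℝ) → ℝ} {I : Set ℝ} {γ : ℝ → Ambient}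
    (h : IsMaximalGeodesic Λ H I γ) :
    IsMaximalGeodesic Λ H (Neg.neg ⁻¹' I) (fun t => γ (-t)) := by
  refine ⟨h.1.comp_neg, fun J γ' hγ' hIJ heq => ?_⟩
  rw [← h.2 (Neg.neg ⁻¹' J) (fun t => γ' (-t)) hγ'.comp_neg ?_ ?_, neg_preimage_neg_preimage]
  · intro t ht
    exact hIJ (show - -t ∈ I by rwa [neg_neg])
  · intro t ht
    have := heq (show -t ∈ Neg.neg ⁻¹' I by simpa using ht)
    simpa using this

theorem RunsIntoSingularityInFuture.past {Λ : ℝ} {I : Set ℝ} {γ : ℝ → Ambient}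
    (h : RunsIntoSingularityInFuture Λ (Neg.neg ⁻¹' I) (fun t => γ (-t))) :
    RunsIntoSingularityInPast Λ I γ := by
  obtain ⟨b, hb, p, hp, ht⟩ := h
  refine ⟨-b, ⟨fun t ht => ?_, fun c hc => ?_⟩, p, hp, ?_⟩
  · have := hb.1 (show -t ∈ Neg.neg ⁻¹' I by simpa using ht)
    linarith
  · have : b ≤ -c := hb.2 fun t ht => by have := hc ht; linarith
    linarith
  · have h1 : Tendsto (fun t : ℝ => -t) (𝓝[>] (-b)) (𝓝[<] b) := by
      have := tendsto_neg_nhdsGT (a := -b)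
      rwa [neg_neg] at this
    have := ht.comp h1
    simpa [Function.comp_def] using this

/-! ### Construction of geodesics -/

section Construction

variable {Λ : ℝ} {H : (Fin 2 → ℝ) → ℝ} {I : Set ℝ} {γ : ℝ → Ambient}

theorem exists_Ioo_subset {J : Set ℝ} (hJ : IsOpen J) {t : ℝ} (ht : t ∈ J) :
    ∃ ε > 0, Ioo (t - ε) (t + ε) ⊆ J := by
  obtain ⟨ε, hε, h⟩ := Metric.isOpen_iff.1 hJ t ht
  exact ⟨ε, hε, by rwa [Real.ball_eq_Ioo] at h⟩

theorem isGeodesic_of_isFilippovSolution {J : Set ℝ} (hJ : IsOpen J) (hJ' : J.OrdConnected)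
    {k : Chart} {w : ℝ → Phase} (hw : IsFilippovSolution (geodesicField (k.metric Λ H))
      (k.dom Λ H ×ˢ univ) J w) : IsGeodesic Λ H J (fun t => k.point Λ H (w t).1) where
  isOpen := hJ
  ordConnected := hJ'
  locally_solution t ht := by
    obtain ⟨ε, hε, hsub⟩ := exists_Ioo_subset hJ ht
    exact ⟨k, ε, w, hε, hsub, hw.mono hsub Subset.rfl, fun _ _ => rfl⟩

theorem isGeodesic_of_local (hI : IsOpen I) (hI' : I.OrdConnected)
    (h : ∀ t ∈ I, ∃ J γ', t ∈ J ∧ IsGeodesic Λ H J γ' ∧ EqOn γ γ' (J ∩ I)) :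
    IsGeodesic Λ H I γ where
  isOpen := hI
  ordConnected := hI'
  locally_solution t ht := by
    obtain ⟨J, γ', htJ, hγ', heq⟩ := h t ht
    obtain ⟨k, ε, w, hε, hεJ, hw, hp⟩ := hγ'.locally_solution t htJ
    obtain ⟨δ, hδ, hδI⟩ := exists_Ioo_subset hI ht
    have m₁ := min_le_left ε δ
    have m₂ := min_le_right ε δ
    have s₁ : Ioo (t - min ε δ) (t + min ε δ) ⊆ Ioo (t - ε) (t + ε) :=
      Ioo_subset_Ioo (by linarith) (by linarith)
    have s₂ : Ioo (t - min ε δ) (t + min ε δ) ⊆ Ioo (t - δ) (t + δ) :=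
      Ioo_subset_Ioo (by linarith) (by linarith)
    exact ⟨k, min ε δ, w, lt_min hε hδ, s₂.trans hδI, hw.mono s₁ Subset.rfl, fun s hs =>
      (heq ⟨hεJ (s₁ hs), hδI (s₂ hs)⟩).trans (hp s (s₁ hs))⟩

theorem IsGeodesic.mono (h : IsGeodesic Λ H I γ) {J : Set ℝ} (hJ : IsOpen J)
    (hJ' : J.OrdConnected) (hJI : J ⊆ I) : IsGeodesic Λ H J γ :=
  isGeodesic_of_local hJ hJ' fun _ ht => ⟨I, γ, hJI ht, h, fun _ _ => rfl⟩

theorem Chart.exists_isGeodesic (hH : IsProfile H (regularSet Λ)) (k : Chart) {x : Coord}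
    (hx : x ∈ k.dom Λ H) (h0 : x 0 ≠ 0) (v : Coord) (t₀ : ℝ) : ∃ ε > 0, ∃ γ,
      IsGeodesic Λ H (Ioo (t₀ - ε) (t₀ + ε)) γ ∧ γ t₀ = k.point Λ H x ∧
        HasDerivAt γ (fderiv ℝ (k.point Λ H) x v) t₀ := by
  obtain ⟨H', R, hH', hxR, hk, hp⟩ := Chart.exists_profile hH hx h0
  have hO : ∀ᶠ z : Phase in 𝓝 (x, v), ∀ᶠ y in 𝓝 z.1,
      y ∈ k.dom Λ H ∧ k.metric Λ H y = plusMetric Λ H' y :=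
    (continuous_fst.tendsto (x, v)).eventually hk.eventually_nhds
  obtain ⟨W, ε, hε, hWt, hW⟩ := hH'.exists_solution (y := (x, v)) hxR t₀ hO
  have hmet : ∀ t ∈ Ioo (t₀ - ε) (t₀ + ε), geodesicField (k.metric Λ H) =ᶠ[𝓝 (W t)]
      geodesicField (plusMetric Λ H') := fun t ht =>
    geodesicField_eventuallyEq ((hW t ht).1.mono fun y hy => hy.2)
  have hcW : ∀ t ∈ Ioo (t₀ - ε) (t₀ + ε),
      ContinuousAt (geodesicField (plusMetric Λ H')) (W t) := fun t ht =>
    (hH'.contDiffAt_geodesicField (hW t ht).2.1).continuousAt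
  have ht₀ : t₀ ∈ Ioo (t₀ - ε) (t₀ + ε) := ⟨by linarith, by linarith⟩
  have hsol : IsFilippovSolution (geodesicField (k.metric Λ H)) (k.dom Λ H ×ˢ univ)
      (Ioo (t₀ - ε) (t₀ + ε)) W := by
    refine IsFilippovSolution.of_hasDerivAt t₀ (fun t ht => ⟨(hW t ht).1.self_of_nhds.1, trivial⟩)
      (fun a ha b hb => ?_) fun t ht _ => ⟨(hcW t ht).congr (hmet t ht).symm, ?_⟩
    · have hg : ContinuousOn (fun t => geodesicField (plusMetric Λ H') (W t))
          (Ioo (t₀ - ε) (t₀ + ε)) := fun t ht => (ContinuousAt.comp (x := t) (hcW t ht)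
        (hW t ht).2.2.continuousAt).continuousWithinAt
      simpa using absolutelyContinuousOnInterval_glue ordConnected_Ioo ht₀
        (fun t ht => (hW t ht).2.2) hg (fun t ht => (hW t ht).2.2) hg rfl ha hb
    · rw [(hmet t ht).self_of_nhds]
      exact (hW t ht).2.2
  refine ⟨ε, hε, _, isGeodesic_of_isFilippovSolution isOpen_Ioo ordConnected_Ioo hsol,
    by simp only [hWt], ?_⟩
  have hdiff : DifferentiableAt ℝ (k.point Λ H) x := by
    have h1 : DifferentiableAt ℝ (fun y => stereo Λ (plusMap H' y)) x := by
      obtain ⟨L, hL, -⟩ := hasFDerivAt_stereo (bigOmega_plusMap_ne_zero hxR)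
      exact hL.differentiableAt.comp x
        ((hH'.contDiffAt_plusMap hxR.2.2).differentiableAt (by simp))
    rcases hp with hp | ⟨-, hp⟩
    · exact h1.congr_of_eventuallyEq hp
    · refine DifferentiableAt.congr_of_eventuallyEq ?_ hp
      simp only [reflect_eq]
      exact (reflectVel.differentiableAt.comp x h1).add_const _
  have hd : HasDerivAt (fun t => (W t).1) (geodesicField (plusMetric Λ H') (W t₀)).1 t₀ :=
    (hW t₀ ht₀).2.2.fst
  have hd' : HasDerivAt (fun t => (W t).1) v t₀ := by
    have : (geodesicField (plusMetric Λ H') (W t₀)).1 = v := by rw [hWt]; rfl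
    rwa [this] at hd
  have hf : HasFDerivAt (k.point Λ H) (fderiv ℝ (k.point Λ H) x) (W t₀).1 := by
    rw [hWt]; exact hdiff.hasFDerivAt
  exact hf.comp_hasDerivAt t₀ hd'

/-- Every geodesic off the wave surface extends to a maximal one. -/
theorem IsGeodesic.exists_isMaximalGeodesic (hH : IsProfile H (regularSet Λ))
    (h : IsGeodesic Λ H I γ) {t₀ : ℝ} (ht₀ : t₀ ∈ I) (h0 : γ t₀ 0 ≠ 0) :
    ∃ J γ', I ⊆ J ∧ EqOn γ' γ I ∧ IsMaximalGeodesic Λ H J γ' := by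
  classical
  -- All geodesics with the data of `γ` at `t₀`. They agree pairwise by uniqueness, so they have a
  -- largest member on the union of the intervals, and any extension of it belongs to `𝒮` again.
  set 𝒮 : Set (Set ℝ × (ℝ → Ambient)) := {p | IsGeodesic Λ H p.1 p.2 ∧ t₀ ∈ p.1 ∧
    p.2 t₀ = γ t₀ ∧ deriv p.2 t₀ = deriv γ t₀} with h𝒮
  have hγ𝒮 : (I, γ) ∈ 𝒮 := ⟨h, ht₀, rfl, rfl⟩
  set J : Set ℝ := ⋃₀ (Prod.fst '' 𝒮) with hJ
  have hsub : ∀ p ∈ 𝒮, p.1 ⊆ J := fun p hp => subset_sUnion_of_mem ⟨p, hp, rfl⟩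
  have hex : ∀ t ∈ J, ∃ p ∈ 𝒮, t ∈ p.1 := by
    rintro t ⟨_, ⟨p, hp, rfl⟩, ht⟩
    exact ⟨p, hp, ht⟩
  set γ' : ℝ → Ambient := fun t => if ht : t ∈ J then (hex t ht).choose.2 t else 0 with hγ'
  have heq : ∀ p ∈ 𝒮, EqOn γ' p.2 p.1 := by
    intro p hp t ht
    have htJ := hsub p hp ht
    obtain ⟨hc, hct⟩ := (hex t htJ).choose_spec
    simp only [hγ', dif_pos htJ]
    refine hc.1.eqOn hH hp.1 hc.2.1 hp.2.1 ?_ ?_ ?_ ⟨hct, ht⟩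
    · rwa [hc.2.2.1]
    · rw [hc.2.2.1, hp.2.2.1]
    · rw [hc.2.2.2, hp.2.2.2]
  have hJo : IsOpen J := by
    refine isOpen_sUnion ?_
    rintro _ ⟨p, hp, rfl⟩
    exact hp.1.isOpen
  have hJc : J.OrdConnected := by
    refine (isPreconnected_sUnion t₀ _ ?_ ?_).ordConnected
    · rintro _ ⟨p, hp, rfl⟩
      exact hp.2.1
    · rintro _ ⟨p, hp, rfl⟩
      exact hp.1.ordConnected.isPreconnected
  have hgeo : IsGeodesic Λ H J γ' := isGeodesic_of_local hJo hJc fun t ht => by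
    obtain ⟨p, hp, htp⟩ := hex t ht
    exact ⟨p.1, p.2, htp, hp.1, (heq p hp).mono inter_subset_left⟩
  refine ⟨J, γ', hsub _ hγ𝒮, heq _ hγ𝒮, hgeo, fun K η hη hJK hηeq => ?_⟩
  have ht₀J : t₀ ∈ J := hsub _ hγ𝒮 ht₀
  have e1 : η =ᶠ[𝓝 t₀] γ := by
    filter_upwards [h.isOpen.mem_nhds ht₀] with s hs
    rw [← hηeq (hsub _ hγ𝒮 hs), heq _ hγ𝒮 hs]
  exact (hsub (K, η) ⟨hη, hJK ht₀J, e1.self_of_nhds, e1.deriv_eq⟩).antisymm hJK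

theorem IsFilippovSolution.contDiffOn_fst {g : Coord → Matrix (Fin 4) (Fin 4) ℝ}
    {D : Set Phase} {J : Set ℝ} {w : ℝ → Phase} (h : IsFilippovSolution (geodesicField g) D J w)
    (hJ : J.OrdConnected) (hJ' : UniqueDiffOn ℝ J) : ContDiffOn ℝ 1 (fun t => (w t).1) J := by
  rw [contDiffOn_one_iff_derivWithin hJ']
  refine ⟨fun t ht => (h.hasDerivWithinAt_fst hJ ht).differentiableWithinAt, ?_⟩
  refine (continuous_snd.comp_continuousOn h.continuousOn).congr fun t ht => ?_
  exact (h.hasDerivWithinAt_fst hJ ht).derivWithin (hJ' t ht)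

theorem IsGeodesic.isC1Curve (h : IsGeodesic Λ H I γ) : IsC1Curve Λ H I γ := by
  intro t₀ ht₀
  obtain ⟨k, ε, w, hε, hεI, hw, hγ⟩ := h.locally_solution t₀ ht₀
  exact ⟨k, ε, fun t => (w t).1, hε, hεI,
    hw.contDiffOn_fst ordConnected_Ioo (uniqueDiffOn_Ioo _ _),
    fun t ht => ⟨(hw.mem t ht).1, hγ t ht⟩⟩

end Construction

/-! ### Continuation of geodesics of the background in the impulsive wave spacetime -/

section Continuation

variable {Λ : ℝ} {H : (Fin 2 → ℝ) → ℝ}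

/-- The coordinates `stereo` miss exactly `s = 0`; there the reflected ones apply, and `Λ ≠ 0`
because `s = 1` for `Λ = 0`. -/
theorem exists_chart_eq {P Q : Ambient} (hP : P ∈ background Λ) (hQ : IsTangent Λ P Q)
    (h0 : P 0 ≠ 0) : ∃ (k : Chart) (x v : Coord), x ∈ k.dom Λ H ∧ x 0 ≠ 0 ∧
      k.point Λ H x = P ∧ fderiv ℝ (k.point Λ H) x v = Q := by
  have hne : ∀ {y : Coord}, bigOmega Λ y ≠ 0 → stereo Λ y 0 ≠ 0 → y 0 ≠ 0 := fun hy h h' =>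
    h (by simp [stereo, h'])
  by_cases h4 : P 4 = 0
  · have hΛ : Λ ≠ 0 := fun h => by simp [hP.2 h] at h4
    obtain ⟨y, v, hy, hyP, hvQ⟩ := exists_stereo_eq (reflect_mem_background hΛ hP)
      (hQ.reflect hΛ) (by simp [reflect, h4])
    have hy0 : y 0 ≠ 0 := hne hy (by rw [hyP]; exact h0)
    refine ⟨.reflected, y, v, ⟨hy, hy0, hΛ⟩, hy0, ?_, ?_⟩
    · rw [Chart.point, stereoReflected_eq hy, hyP, reflect_reflect]
    · obtain ⟨L, hL, hL'⟩ := hasFDerivAt_stereo hy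
      have hO : IsOpen {y : Coord | bigOmega Λ y ≠ 0} := by
        rw [← plusDomain_zero]; exact isProfile_zero.isOpen_plusDomain
      have hd : HasFDerivAt (stereoReflected Λ) (reflectVel.comp L) y := by
        refine HasFDerivAt.congr_of_eventuallyEq (f := fun y => reflect (stereo Λ y)) ?_
          ((hO.eventually_mem hy).mono fun z hz => stereoReflected_eq hz)
        simp only [reflect_eq]
        exact (reflectVel.hasFDerivAt.comp y hL).add_const _
      rw [Chart.point, hd.fderiv]
      simp only [ContinuousLinearMap.comp_apply]
      rw [hL', hvQ, reflectVel_reflectVel]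
  · obtain ⟨y, v, hy, hyP, hvQ⟩ := exists_stereo_eq hP hQ h4
    have hy0 : y 0 ≠ 0 := hne hy (by rwa [hyP])
    obtain ⟨L, hL, hL'⟩ := hasFDerivAt_stereo hy
    refine ⟨.conformal, y, v, ⟨hy, hy0⟩, hy0, hyP, ?_⟩
    rw [Chart.point, hL.fderiv, hL', hvQ]

theorem exists_isGeodesic_of_ne_zero (hH : IsProfile H (regularSet Λ)) {F F' : ℝ → Ambient}
    (hF : IsBackgroundGeodesic Λ univ F F') {β : ℝ} (h0 : F β 0 ≠ 0) : ∃ ε > 0, ∃ γ,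
      IsGeodesic Λ H (Ioo (β - ε) (β + ε)) γ ∧ EqOn γ F (Ioo (β - ε) β) := by
  obtain ⟨hP, hQ, -, -⟩ := hF β trivial
  obtain ⟨k, x, v, hx, hx0, hxP, hvQ⟩ := exists_chart_eq (H := H) hP hQ h0
  obtain ⟨ε, hε, γ, hγ, hγP, hγQ⟩ := k.exists_isGeodesic hH hx hx0 v β
  rw [hxP] at hγP
  rw [hvQ] at hγQ
  obtain ⟨δ, hδ, hδε, hB⟩ := hγ.exists_isBackgroundGeodesic hH ⟨by linarith, by linarith⟩
    (by rwa [hγP] : γ β 0 ≠ 0)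
  refine ⟨δ, hδ, γ, hγ.mono isOpen_Ioo ordConnected_Ioo hδε, ?_⟩
  exact ((hB.eqOn (hF.mono (subset_univ _)) isOpen_Ioo ordConnected_Ioo ⟨by linarith, by linarith⟩
    hγP hγQ.deriv).1).mono (Ioo_subset_Ioo_right (by linarith))

theorem mem_waveDomain_of_eq_zero {x : Coord} (h0 : x 0 = 0) (hO : bigOmega Λ x ≠ 0)
    (h : x 2 ≠ 0 ∨ x 3 ≠ 0) : x ∈ waveDomain Λ H := by
  refine ⟨by rwa [omega_of_nonpos Λ H h0.le], ?_, .inr ⟨fun hs => ?_, ?_⟩⟩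
  · rw [spatialMetric_of_nonpos H h0.le, plusSpatialMetric_zero]
    simp
  · have h2 := congrFun hs 0
    have h3 := congrFun hs 1
    simp only [spatial, Matrix.cons_val_zero, Matrix.cons_val_one, Pi.zero_apply] at h2 h3
    exact h.elim (fun h => h h2) fun h => h h3
  · simpa [bigOmega, h0, spatial] using hO

/-- The position is found by undoing the shear by the profile, the velocity by invertibility of the
Jacobian on `U = 0`. -/
theorem exists_phase_eq (hH : IsProfile H (regularSet Λ)) {y : Coord} (hy : bigOmega Λ y ≠ 0)
    (h0 : y 0 = 0) (h : y 2 ≠ 0 ∨ y 3 ≠ 0) (u : Coord) (b : Bool) : ∃ x v : Coord,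
      x ∈ waveDomain Λ H ∧ x 0 = 0 ∧ v 0 = u 0 ∧ plusMap (sideProfile H b) x = y ∧
        fderiv ℝ (plusMap (sideProfile H b)) x v = u := by
  generalize hK : sideProfile H b = K
  obtain ⟨x, hx0, hx1, hx2, hx3⟩ : ∃ x : Coord, x 0 = 0 ∧ x 1 = y 1 - K (spatial y) ∧
      x 2 = y 2 ∧ x 3 = y 3 := ⟨![0, y 1 - K (spatial y), y 2, y 3], rfl, rfl, rfl, rfl⟩
  have hsp : spatial x = spatial y := by simp [spatial, hx2, hx3]
  have hxy : plusMap K x = y := by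
    funext i
    fin_cases i
    · exact hx0.trans h0.symm
    · simp [plusMap, hx0, hx1, hsp]
    · simp [plusMap, hx0, hx2]
    · simp [plusMap, hx0, hx3]
  have hxO : bigOmega Λ x ≠ 0 := by
    rw [bigOmega, h0] at hy
    simpa [bigOmega, hx0, hx2, hx3] using hy
  have hxm : x ∈ waveDomain Λ H := mem_waveDomain_of_eq_zero hx0 hxO (by rwa [hx2, hx3])
  have hxs := (mem_sideDomain_of_eq_zero hxm hx0 b).2.2
  have hK' := isProfile_side hH b
  rw [hK] at hK'
  obtain ⟨v, hv⟩ : ∃ v, fderiv ℝ (plusMap K) x v = u :=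
    LinearMap.surjective_of_injective (f := (fderiv ℝ (plusMap K) x).toLinearMap)
      (fun _ _ h => hK'.fderiv_plusMap_injective hxs hx0 h) u
  exact ⟨x, v, hxm, hx0, by rw [← hv, hK'.fderiv_plusMap_zero hxs], hxy, hv⟩

/-- For `Λ ≠ 0`, `Ũ = 0` and `s = 0` in the equation of the quadric leave `Z₂² + Z₃² = 0`. Off the
singular generators the unreflected coordinates thus cover the wave surface. -/
theorem apply_four_ne_zero {P : Ambient} (hP : P ∈ background Λ) (h0 : P 0 = 0)
    (h : P 2 ≠ 0 ∨ P 3 ≠ 0) : P 4 ≠ 0 := fun h4 => by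
  by_cases hΛ : Λ = 0
  · simp [hP.2 hΛ] at h4
  · have h1 := hP.1
    rw [h4, h0] at h1
    have h2 : P 2 ^ 2 + P 3 ^ 2 = 0 := by
      have : Λ * (P 2 ^ 2 + P 3 ^ 2) = 0 := by linarith
      exact (mul_eq_zero.1 this).resolve_left hΛ
    rcases h with h | h
    · exact h (by nlinarith [sq_nonneg (P 2), sq_nonneg (P 3)])
    · exact h (by nlinarith [sq_nonneg (P 2), sq_nonneg (P 3)])

/-- The data of `F` at `β` are read in the continuous coordinates from the side on which `F`
arrives; the glued solution with this state follows `F` before `β` and crosses. -/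
theorem exists_isGeodesic_of_eq_zero (hH : IsProfile H (regularSet Λ)) {F F' : ℝ → Ambient}
    (hF : IsBackgroundGeodesic Λ univ F F') {β : ℝ} (h0 : F β 0 = 0) (h0' : F' β 0 ≠ 0)
    (h : F β 2 ≠ 0 ∨ F β 3 ≠ 0) : ∃ ε > 0, ∃ γ,
      IsGeodesic Λ H (Ioo (β - ε) (β + ε)) γ ∧ EqOn γ F (Ioo (β - ε) β) := by
  obtain ⟨hP, hQ, -, -⟩ := hF β trivial
  obtain ⟨y, u, hy, hyP, huQ⟩ := exists_stereo_eq hP hQ (apply_four_ne_zero hP h0 h)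
  have hy0 : y 0 = 0 := by
    have := congrFun hyP 0
    rw [h0] at this
    simpa [stereo, hy] using this
  have hu0 : u 0 ≠ 0 := fun hu => h0' (by rw [← huQ]; simp [stereoVel, hu, hy0])
  have hy23 : y 2 ≠ 0 ∨ y 3 ≠ 0 := by
    have h2 : F β 2 = (bigOmega Λ y)⁻¹ * y 2 := by rw [← hyP]; rfl
    have h3 : F β 3 = (bigOmega Λ y)⁻¹ * y 3 := by rw [← hyP]; rfl
    rw [h2, h3] at h
    exact h.imp right_ne_zero_of_mul right_ne_zero_of_mul
  obtain ⟨b, hb⟩ := exists_onSide hu0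
  -- `b` is the sign of `U'`, so the arrival is on the side `!b`.
  obtain ⟨x, v, hxm, hx0, hv0, hxy, hv⟩ := exists_phase_eq hH hy hy0 hy23 u (!b)
  have hnd : ¬ Degenerate (x, v) := fun hd => hu0 (hv0.symm.trans hd.2)
  obtain ⟨ε, side, W, hW⟩ := exists_normalForm hH (y := (x, v)) hxm hnd β
  have hside : side false = !b := by
    have h1 : OnSide (false == side false) (v 0) := hW.side_eq hx0 false
    rw [hv0] at h1
    have h2 := h1.unique hb
    revert h2
    cases side false <;> cases b <;> simp
  have hε := hW.pos
  have hβ : β ∈ Ioo (β - ε) (β + ε) := ⟨by linarith, by linarith⟩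
  have hsub : Ioo (β - ε) β ⊆ Ioo (β - ε) (β + ε) := Ioo_subset_Ioo_right (by linarith)
  have hgeo := isGeodesic_of_isFilippovSolution (k := .wave) isOpen_Ioo ordConnected_Ioo
    (hW.isWaveSolution_glue hH hxm)
  refine ⟨ε, hε, _, hgeo, fun t ht => ?_⟩
  have h1 : sidePoint Λ H (side false) (W false β) = F β := by
    rw [hW.eq, hside, sidePoint, hxy, hyP]
  have h2 : sideVel Λ H (side false) (W false β) = F' β := by
    rw [hW.eq, hside, sideVel, hxy, hv, huQ]
  exact (hW.point_glue (hsub ht) (d := false) (sub_neg.2 ht.2)).trans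
    (((hW.isBackgroundGeodesic hH false).eqOn (hF.mono (subset_univ _)) isOpen_Ioo
    ordConnected_Ioo hβ h1 h2).1 (hsub ht))

end Continuation

/-! ### Completeness -/

section Completeness

variable {Λ : ℝ} {H : (Fin 2 → ℝ) → ℝ} {I : Set ℝ} {γ : ℝ → Ambient}

theorem IsMaximalGeodesic.not_exists_continuation (h : IsMaximalGeodesic Λ H I γ) {β : ℝ}
    (hβ : IsLUB I β) {ε : ℝ} (hε : 0 < ε) (hεI : Ioo (β - ε) β ⊆ I) {η : ℝ → Ambient}
    (hη : IsGeodesic Λ H (Ioo (β - ε) (β + ε)) η) : ¬ EqOn γ η (Ioo (β - ε) β) := by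
  intro heq
  have hlt : ∀ t ∈ I, t < β := fun t ht => by
    obtain ⟨δ, hδ, hb⟩ := exists_Ioo_subset h.1.isOpen ht
    have := hβ.1 (hb (show t + δ / 2 ∈ Ioo (t - δ) (t + δ) from ⟨by linarith, by linarith⟩))
    linarith
  set J := I ∪ Ioo (β - ε) (β + ε) with hJ
  have hmid : β - ε / 2 ∈ Ioo (β - ε) β := ⟨by linarith, by linarith⟩
  have hJc : J.OrdConnected := (IsPreconnected.union (β - ε / 2) (hεI hmid)
    (show β - ε / 2 ∈ Ioo (β - ε) (β + ε) from ⟨by linarith, by linarith⟩) h.1.ordConnected.isPreconnected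
    ordConnected_Ioo.isPreconnected).ordConnected
  have hβJ : β ∈ J := mem_union_right I (show β ∈ Ioo (β - ε) (β + ε) from
    ⟨by linarith, by linarith⟩)
  have hgeo : IsGeodesic Λ H J (fun t => if t < β then γ t else η t) := by
    refine isGeodesic_of_local (h.1.isOpen.union isOpen_Ioo) hJc fun t ht => ?_
    rcases ht with ht | ht
    · exact ⟨I, γ, ht, h.1, fun s hs => if_pos (hlt s hs.1)⟩
    · refine ⟨_, η, ht, hη, fun s hs => ?_⟩
      by_cases hsβ : s < β
      · simp only [if_pos hsβ]
        exact heq ⟨hs.1.1, hsβ⟩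
      · exact if_neg hsβ
  have := h.2 J _ hgeo subset_union_left fun t ht => (if_pos (hlt t ht)).symm
  rw [this] at hβJ
  exact (hlt β hβJ).false

/-- Near the end `γ` equals a background geodesic `F` that exists beyond `β`. Every position of `F
β` other than a singular point admits a continuation, contradicting maximality. -/
theorem IsMaximalGeodesic.runsIntoSingularityInFuture (hH : IsProfile H (regularSet Λ))
    (h : IsMaximalGeodesic Λ H I γ) {t₀ : ℝ} (ht₀ : t₀ ∈ I) (h0 : γ t₀ 0 ≠ 0)
    (hb : BddAbove I) : RunsIntoSingularityInFuture Λ I γ := by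
  have hβ := isLUB_csSup ⟨t₀, ht₀⟩ hb
  set β := sSup I
  obtain ⟨a, haβ, haI, hne, F, F', hF, heq⟩ := h.1.exists_eqOn_flow hH ht₀ h0 hβ
  have hcont : ∀ ε > 0, ∀ η, IsGeodesic Λ H (Ioo (β - ε) (β + ε)) η →
      ¬ EqOn η F (Ioo (β - ε) β) := by
    intro ε hε η hη hηF
    have hm : 0 < min ε (β - a) := lt_min hε (sub_pos.2 haβ)
    have m₁ := min_le_left ε (β - a)
    have m₂ := min_le_right ε (β - a)
    refine h.not_exists_continuation hβ hm (fun t ht => haI ⟨by linarith [ht.1], ht.2⟩)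
      (hη.mono isOpen_Ioo ordConnected_Ioo (Ioo_subset_Ioo (by linarith) (by linarith)))
      fun t ht => ?_
    rw [heq ⟨by linarith [ht.1], ht.2⟩, hηF ⟨by linarith [ht.1], ht.2⟩]
  have hF0 : F β 0 = 0 := by
    by_contra hF0
    obtain ⟨ε, hε, η, hη, hηF⟩ := exists_isGeodesic_of_ne_zero hH hF hF0
    exact hcont ε hε η hη hηF
  -- Otherwise `Ũ` would vanish along all of `F`, while `γ` is off the surface just before `β`.
  have hF0' : F' β 0 ≠ 0 := fun hF0' => by
    obtain ⟨m, hm⟩ := exists_between haβ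
    refine hne m hm ?_
    rw [heq hm, (hF.eq_flow isOpen_univ ordConnected_univ (a := β) trivial trivial).1,
      flow_apply_zero _ hF0, hF0', mul_zero]
  obtain ⟨hF2, hF3⟩ : F β 2 = 0 ∧ F β 3 = 0 := by
    by_contra hF23
    obtain ⟨ε, hε, η, hη, hηF⟩ := exists_isGeodesic_of_eq_zero hH hF hF0 hF0'
      (by rwa [← not_and_or])
    exact hcont ε hε η hη hηF
  refine ⟨β, hβ, F β, ⟨(hF β trivial).1, hF0, hF2, hF3⟩, ?_⟩
  refine (((hF β trivial).2.2.1.continuousAt.tendsto).mono_left nhdsWithin_le_nhds).congr' ?_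
  filter_upwards [Ioo_mem_nhdsLT haβ] with t ht using (heq ht).symm

theorem IsMaximalGeodesic.runsIntoSingularityInPast (hH : IsProfile H (regularSet Λ))
    (h : IsMaximalGeodesic Λ H I γ) {t₀ : ℝ} (ht₀ : t₀ ∈ I) (h0 : γ t₀ 0 ≠ 0)
    (hb : BddBelow I) : RunsIntoSingularityInPast Λ I γ := by
  refine (h.comp_neg.runsIntoSingularityInFuture hH (t₀ := -t₀) (by simpa using ht₀)
    (by simpa using h0) ?_).past
  obtain ⟨c, hc⟩ := hb
  refine ⟨-c, fun t ht => ?_⟩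
  have := hc (show -t ∈ I from ht)
  linarith

end Completeness

/-! ### The initial value problem in the continuous coordinates -/

theorem IsWaveSolution.eqOn {Λ : ℝ} {H : (Fin 2 → ℝ) → ℝ} (hH : IsProfile H (regularSet Λ))
    {I₁ I₂ : Set ℝ} {w₁ w₂ : ℝ → Phase} (hI₁ : I₁.OrdConnected) (hI₂ : I₂.OrdConnected)
    (h₁ : IsWaveSolution Λ H I₁ w₁) (h₂ : IsWaveSolution Λ H I₂ w₂) {t₀ : ℝ} (ht₁ : t₀ ∈ I₁)
    (ht₂ : t₀ ∈ I₂) (h : w₁ t₀ = w₂ t₀) (hne : ¬ Degenerate (w₁ t₀)) : EqOn w₁ w₂ (I₁ ∩ I₂) := by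
  have hI := hI₁.inter hI₂
  -- A degenerate state at any time would propagate back to `t₀`.
  have hnd : ∀ t ∈ I₁, ¬ Degenerate (w₁ t) := fun t ht hd =>
    hne (h₁.degenerate hH hI₁ ht hd t₀ ht₁)
  refine fun t ht => forall_of_locally_all_or_none (P := fun t => w₁ t = w₂ t) hI ⟨ht₁, ht₂⟩ h
    (fun τ hτ => ?_) t ht
  by_cases hw : w₁ τ = w₂ τ
  · obtain ⟨ε, hε, hball⟩ := Metric.mem_nhdsWithin_iff.1
      (IsWaveSolution.eventually_eq hH hI₁ hI₂ hτ.1 hτ.2 h₁ h₂ hw (hnd τ hτ.1))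
    exact ⟨ε, hε, fun _ _ _ _ b hb hbε => hball ⟨hbε, hb⟩⟩
  · have hc : ContinuousWithinAt (fun t => w₁ t - w₂ t) (I₁ ∩ I₂) τ :=
      ((h₁.continuousOn τ hτ.1).mono inter_subset_left).sub
        ((h₂.continuousOn τ hτ.2).mono inter_subset_right)
    obtain ⟨ε, hε, hball⟩ := Metric.mem_nhdsWithin_iff.1
      (hc.eventually_ne (sub_ne_zero.2 hw))
    exact ⟨ε, hε, fun a ha haε hPa => absurd (sub_eq_zero.2 hPa) (hball ⟨haε, ha⟩)⟩

end ImpulsiveWave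

end

/-! ### The theorem -/

open ImpulsiveWave in
theorem theorem3p6 (Λ : ℝ) (H : (Fin 2 → ℝ) → ℝ)
    (hH : ContDiffOn ℝ ∞ H (ImpulsiveWave.regularSet Λ)) :
    -- local existence of C¹ solutions and uniqueness, in the continuous coordinates
    (∀ (t₀ : ℝ) (x v : ImpulsiveWave.Coord), x ∈ ImpulsiveWave.waveDomain Λ H → x 0 ≠ 0 →
      (∃ (ε : ℝ) (w : ℝ → ImpulsiveWave.Phase), 0 < ε ∧
        ImpulsiveWave.IsWaveSolution Λ H (Set.Icc (t₀ - ε) (t₀ + ε)) w ∧ w t₀ = (x, v) ∧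
        ContDiffOn ℝ 1 (fun t => (w t).1) (Set.Icc (t₀ - ε) (t₀ + ε)) ∧
        ∀ t ∈ Set.Icc (t₀ - ε) (t₀ + ε),
          HasDerivWithinAt (fun t => (w t).1) (w t).2 (Set.Icc (t₀ - ε) (t₀ + ε)) t) ∧
      (∀ (I₁ I₂ : Set ℝ) (w₁ w₂ : ℝ → ImpulsiveWave.Phase),
        I₁.OrdConnected → I₂.OrdConnected → t₀ ∈ I₁ → t₀ ∈ I₂ →
        ImpulsiveWave.IsWaveSolution Λ H I₁ w₁ → ImpulsiveWave.IsWaveSolution Λ H I₂ w₂ →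
        w₁ t₀ = (x, v) → w₂ t₀ = (x, v) → Set.EqOn w₁ w₂ (I₁ ∩ I₂))) ∧
    -- existence of a maximal geodesic of the spacetime for all initial data off the wave surface
    (∀ (t₀ : ℝ) (k : ImpulsiveWave.Chart) (x v : ImpulsiveWave.Coord),
      x ∈ k.dom Λ H → x 0 ≠ 0 →
      ∃ (I : Set ℝ) (γ : ℝ → ImpulsiveWave.Ambient), t₀ ∈ I ∧
        ImpulsiveWave.IsMaximalGeodesic Λ H I γ ∧ γ t₀ = k.point Λ H x ∧
        HasDerivAt γ (fderiv ℝ (k.point Λ H) x v) t₀) ∧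
    -- geodesics that start off the wave surface are C¹
    (∀ (t₀ : ℝ) (I : Set ℝ) (γ : ℝ → ImpulsiveWave.Ambient),
      ImpulsiveWave.IsGeodesic Λ H I γ → t₀ ∈ I → γ t₀ 0 ≠ 0 →
      ImpulsiveWave.IsC1Curve Λ H I γ) ∧
    -- and they are unique
    (∀ (t₀ : ℝ) (I₁ I₂ : Set ℝ) (γ₁ γ₂ : ℝ → ImpulsiveWave.Ambient) (ξ : ImpulsiveWave.Ambient),
      ImpulsiveWave.IsGeodesic Λ H I₁ γ₁ → ImpulsiveWave.IsGeodesic Λ H I₂ γ₂ →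
      t₀ ∈ I₁ → t₀ ∈ I₂ → γ₁ t₀ = γ₂ t₀ → γ₁ t₀ 0 ≠ 0 →
      HasDerivAt γ₁ ξ t₀ → HasDerivAt γ₂ ξ t₀ → Set.EqOn γ₁ γ₂ (I₁ ∩ I₂)) ∧
    -- completeness
    (∀ (t₀ : ℝ) (I : Set ℝ) (γ : ℝ → ImpulsiveWave.Ambient),
      ImpulsiveWave.IsMaximalGeodesic Λ H I γ → t₀ ∈ I → γ t₀ 0 ≠ 0 →
      (¬ ImpulsiveWave.RunsIntoSingularityInFuture Λ I γ → ¬ BddAbove I) ∧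
      (¬ ImpulsiveWave.RunsIntoSingularityInPast Λ I γ → ¬ BddBelow I) ∧
      (¬ ImpulsiveWave.RunsIntoSingularityInFuture Λ I γ →
        ¬ ImpulsiveWave.RunsIntoSingularityInPast Λ I γ → I = Set.univ)) := by
  have hH' : IsProfile H (regularSet Λ) := ⟨isOpen_regularSet Λ, hH⟩
  refine ⟨fun t₀ x v hx hx0 => ?_, fun t₀ k x v hx hx0 => ?_, fun t₀ I γ h _ _ => h.isC1Curve,
    fun t₀ I₁ I₂ γ₁ γ₂ ξ h₁ h₂ ht₁ ht₂ hp h0 hd₁ hd₂ =>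
      h₁.eqOn hH' h₂ ht₁ ht₂ h0 hp (hd₁.deriv.trans hd₂.deriv.symm), fun t₀ I γ h ht₀ h0 => ?_⟩
  · have hnd : ¬ Degenerate (x, v) := fun h => hx0 h.1
    refine ⟨?_, fun I₁ I₂ w₁ w₂ hI₁ hI₂ ht₁ ht₂ h₁ h₂ e₁ e₂ =>
      IsWaveSolution.eqOn hH' hI₁ hI₂ h₁ h₂ ht₁ ht₂ (e₁.trans e₂.symm) (e₁ ▸ hnd)⟩
    obtain ⟨ε, side, W, hW⟩ := exists_normalForm hH' (y := (x, v)) hx hnd t₀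
    have hε := hW.pos
    -- The normal form lives on an open interval; half its radius gives a closed one inside.
    have hw : IsWaveSolution Λ H (Set.Icc (t₀ - ε / 2) (t₀ + ε / 2)) (glue t₀ W) :=
      (hW.isWaveSolution_glue hH' hx).mono
        (Set.Icc_subset_Ioo (by linarith) (by linarith)) Set.Subset.rfl
    exact ⟨ε / 2, glue t₀ W, by linarith, hw, hW.glue_self,
      hw.contDiffOn_fst Set.ordConnected_Icc (uniqueDiffOn_Icc (by linarith)),
      fun t ht => hw.hasDerivWithinAt_fst Set.ordConnected_Icc ht⟩
  · obtain ⟨ε, hε, γ, hγ, hγx, hγv⟩ := k.exists_isGeodesic hH' hx hx0 v t₀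
    have ht₀ : t₀ ∈ Set.Ioo (t₀ - ε) (t₀ + ε) := ⟨by linarith, by linarith⟩
    have h0 : γ t₀ 0 ≠ 0 := by rwa [hγx, Ne, Chart.point_eq_zero_iff hx]
    obtain ⟨J, η, hJ, heq, hη⟩ := hγ.exists_isMaximalGeodesic hH' ht₀ h0
    exact ⟨J, η, hJ ht₀, hη, (heq ht₀).trans hγx,
      hγv.congr_of_eventuallyEq (heq.eventuallyEq_of_mem (isOpen_Ioo.mem_nhds ht₀))⟩
  · have hfut : ¬ RunsIntoSingularityInFuture Λ I γ → ¬ BddAbove I := fun hn hb =>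
      hn (h.runsIntoSingularityInFuture hH' ht₀ h0 hb)
    have hpast : ¬ RunsIntoSingularityInPast Λ I γ → ¬ BddBelow I := fun hn hb =>
      hn (h.runsIntoSingularityInPast hH' ht₀ h0 hb)
    refine ⟨hfut, hpast, fun h₁ h₂ => Set.eq_univ_of_forall fun t => ?_⟩
    obtain ⟨b, hb, htb⟩ := not_bddAbove_iff.1 (hfut h₁) t
    obtain ⟨a, ha, hta⟩ := not_bddBelow_iff.1 (hpast h₂) t
    exact h.1.ordConnected.out ha hb ⟨hta.le, htb.le⟩
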